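/- **Forrelation.** For $n=2^{m+1}$ with $m\ge 0$ and $z=(z_1,z_2)\in\{-1,1\}^n$ with halves $z_1,z_2\in\{-1,1\}^{n/2}$, let $$\mathrm{forr}(z)=\frac1n\,\langle z_1|H^{\otimes m}|z_2\rangle,$$ where $H=\frac1{\sqrt2}\begin{pmatrix}1&1\\1&-1\end{pmatrix}$. Given thresholds $\alpha>\beta>0$, the communication forrelation problem is the partial function of $x,y\in\{-1,1\}^n$ with $f(x,y)=-1$ if $\mathrm{forr}(x\cdot y)\ge\alpha$ and $f(x,y)=+1$ if $\mathrm{forr}(x\cdot y)\le\beta$ (undefined otherwise), where $x\cdot y$ is the pointwise product. **CDQS.** A CDQS protocol (conditional disclosure of secrets with quantum resources, one-qubit secret $Q$) for a partial function $g$ of $(x,y)$ with values in $\{0,1\}$ consists of a shared state $\Psi_{LR}$ on finite-dimensional systems, a quantum channel $\mathcal N^x_{QL\to M_A}$ of Alice for each $x$ and a quantum channel $\mathcal N^y_{R\to M_B}$ of Bob for each $y$. Let $\mathcal N^{x,y}_{Q\to M_AM_B}(\rho)=(\mathcal N^x\otimes\mathcal N^y)(\rho\otimes\Psi_{LR})$.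 The protocol is $\epsilon$-correct if for all $(x,y)$ with $g(x,y)=1$ there is a channel $\mathcal D^{x,y}_{M_AM_B\to Q}$ with $\|\mathcal D^{x,y}\circ\mathcal N^{x,y}-\mathrm{id}_Q\|_\diamond\le\epsilon$, and $\delta$-secure if for all $(x,y)$ with $g(x,y)=0$ there is a state $\sigma^{x,y}$ on $M_AM_B$ with $\|\sigma^{x,y}\,\mathrm{tr}_Q(\cdot)-\mathcal N^{x,y}\|_\diamond\le\delta$; here $\|\Phi-\Phi'\|_\diamond$ is the supremum over ancillas and joint input states $\rho$ of the trace norm $\|(\mathrm{id}\otimes\Phi)(\rho)-(\mathrm{id}\otimes\Phi')(\rho)\|_1$. Its communication is $\log_2\dim M_A+\log_2\dim M_B$ and its shared resource (entanglement/randomness) is $\log_2\dim L+\log_2\dim R$. **Theorem.** There is a constant $c>0$ such that for every $\Delta>0$ there is a constant $C>0$ such that for all $n=2^{m+1}$, $m\ge0$, and all $\alpha>\beta>0$ with $\alpha-\beta\ge\Delta$, the communication forrelation problem on $n$-bit inputs with thresholds $\alpha,\beta$, with its two values $-1,+1$ identified with $0,1$ in either way, has a CDQS protocol that is $0.09$-correct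 and $0.09$-secure and uses at most $C(\log_2 n)^c$ qubits of communication and at most $C(\log_2 n)^c$ qubits of shared resource. -/

import Mathlib

open scoped Kronecker ENNReal ComplexOrder

noncomputable section

namespace CDQS

/-! ### Finite-dimensional quantum systems

A system with orthonormal basis indexed by the finite type `a` has operators `Matrix a a ℂ`;
the composite of the systems `a` and `b` is indexed by `a × b`. -/

/-- Linear maps from operators on the system `a` to operators on the system `b`. -/
abbrev SuperOp (a b : Type) : Type := Matrix a a ℂ →ₗ[ℂ] Matrix b b ℂ

/-- Density matrices. -/
def IsDensity {a : Type} [Fintype a] (ρ : Matrix a a ℂ) : Prop :=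
  ρ.PosSemidef ∧ ρ.trace = 1

/-- The tensor product `Φ ⊗ Ψ`: the linear map with
`|i⟩⟨i'| ⊗ |j⟩⟨j'| ↦ Φ(|i⟩⟨i'|) ⊗ Ψ(|j⟩⟨j'|)`. -/
def SuperOp.tensor {a b c d : Type} [Fintype a] [DecidableEq a] [Fintype c] [DecidableEq c]
    (Φ : SuperOp a b) (Ψ : SuperOp c d) : SuperOp (a × c) (b × d) where
  toFun X := ∑ i, ∑ i', ∑ j, ∑ j',
    X (i, j) (i', j') • (Φ (Matrix.single i i' 1) ⊗ₖ Ψ (Matrix.single j j' 1))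
  map_add' X Y := by
    simp only [Matrix.add_apply, add_smul, Finset.sum_add_distrib]
  map_smul' r X := by
    simp only [Matrix.smul_apply, smul_eq_mul, mul_smul, Finset.smul_sum, RingHom.id_apply]

/-- Quantum channels: completely positive, trace preserving maps. -/
def IsChannel {a b : Type} [Fintype a] [DecidableEq a] [Fintype b] (Φ : SuperOp a b) : Prop :=
  (∀ (d : ℕ) (X : Matrix (Fin d × a) (Fin d × a) ℂ), X.PosSemidef →
    (SuperOp.tensor (LinearMap.id : SuperOp (Fin d) (Fin d)) Φ X).PosSemidef) ∧
  ∀ X : Matrix a a ℂ, (Φ X).trace = X.trace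

/-- The trace norm `‖X‖₁ = tr √(X†X)`, the sum of the singular values of `X`. -/
def traceNorm {a : Type} [Fintype a] [DecidableEq a] (X : Matrix a a ℂ) : ℝ :=
  ∑ i, √((Matrix.isHermitian_conjTranspose_mul_self X).eigenvalues i)

/-- The diamond norm distance: the supremum over all ancilla dimensions `d` and all joint states
`ρ` of the ancilla and the input of `‖(id ⊗ Φ)(ρ) - (id ⊗ Ψ)(ρ)‖₁`. -/
def diamondDist {a b : Type} [Fintype a] [DecidableEq a] [Fintype b] [DecidableEq b]
    (Φ Ψ : SuperOp a b) : ℝ≥0∞ :=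
  ⨆ (d : ℕ) (ρ : Matrix (Fin d × a) (Fin d × a) ℂ) (_ : IsDensity ρ),
    ENNReal.ofReal (traceNorm
      (SuperOp.tensor (LinearMap.id : SuperOp (Fin d) (Fin d)) Φ ρ -
        SuperOp.tensor (LinearMap.id : SuperOp (Fin d) (Fin d)) Ψ ρ))

/-- Discard the input and prepare `σ`: the map `ρ ↦ tr(ρ) σ`. -/
def discardPrepare (a : Type) {b : Type} [Fintype a] (σ : Matrix b b ℂ) : SuperOp a b :=
  (Matrix.traceLinearMap a ℂ ℂ).smulRight σ

/-- Append the shared state `Ψ` on `LR` to the system `Q`: the map `ρ ↦ ρ ⊗ Ψ`, with the result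
grouped as `(QL)R`. -/
def appendState {Q L R : Type} (Ψ : Matrix (L × R) (L × R) ℂ) : SuperOp Q ((Q × L) × R) where
  toFun ρ := (ρ ⊗ₖ Ψ).submatrix (Equiv.prodAssoc Q L R) (Equiv.prodAssoc Q L R)
  map_add' ρ ρ' := by
    ext i j
    simp [Matrix.kroneckerMap_apply, add_mul]
  map_smul' r ρ := by
    ext i j
    simp [Matrix.kroneckerMap_apply, mul_assoc]

/-! ### Conditional disclosure of secrets with quantum resources -/

/-- What Alice and Bob do: they share a resource state on `LR`; on input `x` Alice applies a
channel to the secret `Q` and to `L` and sends `MA`, on input `y` Bob applies a channel to `R` and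
sends `MB`. There is no communication between Alice and Bob. -/
structure Protocol (X Y Q L R MA MB : Type)
    [Fintype Q] [DecidableEq Q] [Fintype L] [DecidableEq L] [Fintype R] [DecidableEq R]
    [Fintype MA] [DecidableEq MA] [Fintype MB] [DecidableEq MB] where
  resource : Matrix (L × R) (L × R) ℂ
  resource_isDensity : IsDensity resource
  alice : X → SuperOp (Q × L) MA
  alice_isChannel : ∀ x, IsChannel (alice x)
  bob : Y → SuperOp R MB
  bob_isChannel : ∀ y, IsChannel (bob y)

namespace Protocol

variable {X Y Q L R MA MB : Type}
  [Fintype Q] [DecidableEq Q] [Fintype L] [DecidableEq L] [Fintype R] [DecidableEq R]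
  [Fintype MA] [DecidableEq MA] [Fintype MB] [DecidableEq MB]

/-- The channel from the secret `Q` to the messages `M = MA MB` on inputs `x`, `y`. -/
def encoding (P : Protocol X Y Q L R MA MB) (x : X) (y : Y) : SuperOp Q (MA × MB) :=
  (SuperOp.tensor (P.alice x) (P.bob y)).comp (appendState P.resource)

/-- `ε`-correctness for the partial function `f` (`none` where `f` is undefined): on inputs with
`f x y = 1` the referee, who knows `x` and `y`, can recover the secret up to error `ε`. -/
def IsCorrect (P : Protocol X Y Q L R MA MB) (f : X → Y → Option Bool) (ε : ℝ) : Prop :=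
  ∀ x y, f x y = some true →
    ∃ D : SuperOp (MA × MB) Q, IsChannel D ∧
      diamondDist (D.comp (P.encoding x y)) LinearMap.id ≤ ENNReal.ofReal ε

/-- `δ`-security for the partial function `f`: on inputs with `f x y = 0` the messages are
simulated, up to error `δ`, by a state that does not depend on the secret. -/
def IsSecure (P : Protocol X Y Q L R MA MB) (f : X → Y → Option Bool) (δ : ℝ) : Prop :=
  ∀ x y, f x y = some false →
    ∃ σ : Matrix (MA × MB) (MA × MB) ℂ, IsDensity σ ∧
      diamondDist (discardPrepare Q σ) (P.encoding x y) ≤ ENNReal.ofReal δ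

end Protocol

/-- The partial function `f` has an `ε`-correct and `δ`-secure CDQS protocol for a one-qubit secret
with communication `log₂ dim MA + log₂ dim MB` at most `t` and shared resource
`log₂ dim L + log₂ dim R` at most `e`, both counted in qubits. -/
def HasProtocol {X Y : Type} (f : X → Y → Option Bool) (ε δ t e : ℝ) : Prop :=
  ∃ (L R MA MB : Type)
    (_ : Fintype L) (_ : DecidableEq L) (_ : Fintype R) (_ : DecidableEq R)
    (_ : Fintype MA) (_ : DecidableEq MA) (_ : Fintype MB) (_ : DecidableEq MB)
    (P : Protocol X Y (Fin 2) L R MA MB),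
    P.IsCorrect f ε ∧ P.IsSecure f δ ∧
    Real.logb 2 (Fintype.card MA) + Real.logb 2 (Fintype.card MB) ≤ t ∧
    Real.logb 2 (Fintype.card L) + Real.logb 2 (Fintype.card R) ≤ e

end CDQS

namespace Forrelation

/-- The one-qubit Hadamard gate, rows and columns indexed by bits. -/
def hadamardGate (s t : Bool) : ℝ := (if s && t then -1 else 1) / √2

/-- The entries of the `2^m × 2^m` matrix `H^{⊗m}`, indices being read in binary. -/
def hadamardPow (m : ℕ) (i j : Fin (2 ^ m)) : ℝ :=
  ∏ b ∈ Finset.range m, hadamardGate (i.val.testBit b) (j.val.testBit b)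

/-- The first half of a string of length `2^(m+1)`. -/
def firstHalf {m : ℕ} (z : Fin (2 ^ (m + 1)) → ℤˣ) (i : Fin (2 ^ m)) : ℤˣ :=
  z ⟨i, by have := i.isLt; rw [pow_succ]; omega⟩

/-- The second half of a string of length `2^(m+1)`. -/
def secondHalf {m : ℕ} (z : Fin (2 ^ (m + 1)) → ℤˣ) (i : Fin (2 ^ m)) : ℤˣ :=
  z ⟨2 ^ m + i, by have := i.isLt; rw [pow_succ]; omega⟩

/-- The forrelation `(1/n) ⟨z₁| H^{⊗m} |z₂⟩` of a sign string `z = (z₁, z₂)` of length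
`n = 2^(m+1)`; `ℤˣ` is `{-1, 1}`. -/
def forr {m : ℕ} (z : Fin (2 ^ (m + 1)) → ℤˣ) : ℝ :=
  (1 / ((2 ^ (m + 1) : ℕ) : ℝ)) *
    ∑ i, ∑ j, ((firstHalf z i : ℤ) : ℝ) * hadamardPow m i j * ((secondHalf z j : ℤ) : ℝ)

open Classical in
/-- The communication forrelation problem with thresholds `α > β`, a partial function of Alice's
input `x` and Bob's input `y` (`none` where the promise fails); `x * y` is the pointwise product. -/
def problem (m : ℕ) (α β : ℝ) (x y : Fin (2 ^ (m + 1)) → ℤˣ) : Option ℤˣ :=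
  if α ≤ forr (x * y) then some (-1) else if forr (x * y) ≤ β then some 1 else none

end Forrelation

end

/-! Write n = 2^(m+1) and F = X ⊗ H^{⊗m}, acting on m + 1 qubits. For a sign vector z in which the
first half carries an extra sign ε = ±1, the expectation of F in the state z/√n is 2ε·forr. The
secret is hidden by a quantum one-time pad. Its two key bits are sent through noisy classical
channels whose bias is affine in forr, so the referee learns the key exactly when that bias is
large.

One use of the channel is a `Gadget`. Alice and Bob share a maximally entangled state. Bob's
measurement in the basis Z^w v steers Alice's half to Z^w v, and her signs u turn it into Z^w (uv).
She hides it behind random Hadamard gates and a random Pauli. The error Z^w becomes a Pauli whose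
label Bob knows (`hadamards_mul_pauli`), so the label he reports corrects it. His report is also
shifted by a random Pauli that commutes with F when the transmitted bit τ is 0 and anticommutes with
F when it is 1. Averaging over the shared randomness destroys everything except the trace and the
expectation of F (`sum_twirl`, `sum_frames`). The referee therefore holds one classical bit, equal
to τ with probability (1 + bias)/2. Mixing in, with weight 1 - θ, a branch of correlation 1 makes
the bias 1 - θ + 2θε·forr, which is nonnegative for θ ≤ 1/2.

Each key bit is encoded in K blocks of d gadgets, as the parity of each block. Parities multiply
biases, so a block has bias b^d (`law_blockLaw`). If K·b^(2d) ≥ 16, a majority vote recovers the key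
(`sum_wrong_law_le`, a Chernoff bound). If K·b^(2d) ≤ 0.002, key and bits are nearly jointly uniform
(`sum_abs_uniform_sub_law_le`, a χ² bound), and the pad then erases the secret. A constant gap
between biases in [0,1] yields constants d and K that separate the two regimes
(`exists_amplification`). Hence the cost is O(m + 1), linear in log n.

The quantum part reduces to the classical law because `protocol_encoding` writes the protocol as a
mixture of fixed channels, and `diamondDist_le_of_sub_eq_sum` bounds diamond distances by sums of
absolute weights. -/

noncomputable section

namespace CDQS

/-! ### The trace norm -/

/-- Polar decomposition: with V diagonalizing X†X, the columns of XV are orthogonal, and normalizing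
the nonzero ones gives U. -/
theorem exists_traceNorm_eq {a : Type} [Fintype a] [DecidableEq a] (X : Matrix a a ℂ) :
    ∃ U V : Matrix a a ℂ, V * V.conjTranspose = 1 ∧ (1 - U * U.conjTranspose).PosSemidef ∧
      (traceNorm X : ℂ) = (U.conjTranspose * X * V).trace := by
  classical
  set hA := Matrix.isHermitian_conjTranspose_mul_self X with hA_def
  set V : Matrix a a ℂ := (hA.eigenvectorUnitary : Matrix a a ℂ) with hV
  set l := hA.eigenvalues with hl
  have hVV : V * V.conjTranspose = 1 := Unitary.mul_star_self_of_mem hA.eigenvectorUnitary.2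
  have hVV' : V.conjTranspose * V = 1 := Unitary.star_mul_self_of_mem hA.eigenvectorUnitary.2
  have hdiag : V.conjTranspose * (X.conjTranspose * X) * V =
      Matrix.diagonal (fun i => (l i : ℂ)) := by
    have h := hA.conjStarAlgAut_star_eigenvectorUnitary
    rw [Unitary.conjStarAlgAut_apply] at h
    simp only [star_star, Unitary.coe_star] at h
    exact h
  have hl0 : ∀ i, 0 ≤ l i := (Matrix.posSemidef_conjTranspose_mul_self X).eigenvalues_nonneg
  -- On the kernel of X†X the convention `0⁻¹ = 0` makes `g` vanish, so U is only a partial isometry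
  -- and 1 - UU† a projection.
  set g : a → ℂ := fun i => (((√(l i))⁻¹ : ℝ) : ℂ) with hg
  set U := X * V * Matrix.diagonal g with hU
  have hgH : (Matrix.diagonal g).conjTranspose = Matrix.diagonal g := by
    rw [Matrix.diagonal_conjTranspose]; congr 1; ext i; simp [hg]
  have hUX : U.conjTranspose * X * V = Matrix.diagonal (fun i => ((√(l i) : ℝ) : ℂ)) := by
    have : U.conjTranspose * X * V =
        Matrix.diagonal g * (V.conjTranspose * (X.conjTranspose * X) * V) := by
      rw [hU, Matrix.conjTranspose_mul, Matrix.conjTranspose_mul, hgH]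
      simp only [Matrix.mul_assoc]
    rw [this, hdiag, Matrix.diagonal_mul_diagonal]
    congr 1; ext i
    simp only [hg]
    norm_cast
    rcases (hl0 i).eq_or_lt with h | h
    · simp [← h]
    · rw [inv_mul_eq_div, Real.div_sqrt]
  have hUU : U * (U.conjTranspose * U) = U := by
    have : U.conjTranspose * U = Matrix.diagonal (fun i => ((√(l i) * (√(l i))⁻¹ : ℝ) : ℂ)) := by
      conv_lhs => rw [hU, ← Matrix.mul_assoc, ← Matrix.mul_assoc, ← hU, hUX,
        Matrix.diagonal_mul_diagonal]
      congr 1; ext i; simp [hg]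
    rw [this, hU, Matrix.mul_assoc (X * V), Matrix.diagonal_mul_diagonal]
    congr 2; ext i
    simp only [hg]
    norm_cast
    rcases eq_or_ne (√(l i)) 0 with h | h
    · simp [h]
    · field_simp
  refine ⟨U, V, hVV, ?_, ?_⟩
  · have h1 : (1 - U * U.conjTranspose) =
        (1 - U * U.conjTranspose).conjTranspose * (1 - U * U.conjTranspose) := by
      have : U * U.conjTranspose * (U * U.conjTranspose) = U * U.conjTranspose := by
        calc _ = U * (U.conjTranspose * U) * U.conjTranspose := by simp only [Matrix.mul_assoc]
          _ = _ := by rw [hUU]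
      have hH : (U * U.conjTranspose).conjTranspose = U * U.conjTranspose :=
        Matrix.isHermitian_mul_conjTranspose_self U
      rw [Matrix.conjTranspose_sub, hH, Matrix.conjTranspose_one, Matrix.mul_sub, Matrix.sub_mul,
        Matrix.sub_mul, this]
      simp
    rw [h1]
    exact Matrix.posSemidef_conjTranspose_mul_self _
  · rw [hUX, Matrix.trace_diagonal, traceNorm]
    push_cast; rfl

open scoped MatrixOrder in
theorem trace_conjugate_le {a : Type} [Fintype a] [DecidableEq a] {P W : Matrix a a ℂ}
    (hP : P.PosSemidef) (hW : (1 - W * W.conjTranspose).PosSemidef) :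
    (W.conjTranspose * P * W).trace.re ≤ P.trace.re := by
  obtain ⟨B, rfl⟩ := (CStarAlgebra.nonneg_iff_eq_star_mul_self (a := P)).1 hP.nonneg
  have h := (hW.mul_mul_conjTranspose_same B).trace_nonneg
  rw [Matrix.mul_sub, Matrix.sub_mul, Matrix.trace_sub, Matrix.mul_one] at h
  have h1 : (B * B.conjTranspose).trace = (star B * B).trace := Matrix.trace_mul_comm _ _
  have h2 : (B * (W * W.conjTranspose) * B.conjTranspose).trace =
      (W.conjTranspose * (star B * B) * W).trace := by
    rw [Matrix.trace_mul_comm, Matrix.mul_assoc W.conjTranspose,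
      Matrix.trace_mul_comm W.conjTranspose,
      Matrix.star_eq_conjTranspose]
    simp only [Matrix.mul_assoc]
  rw [h1, h2] at h
  have := (Complex.le_def.1 h).1
  simp at this
  linarith

/-- In the variational form of the trace norm, P and N are treated separately. Positivity of (U ±
V)†M(U ± V) bounds the cross term by the average of tr U†MU and tr V†MV, each at most tr M. -/
theorem traceNorm_sub_le {a : Type} [Fintype a] [DecidableEq a] {P N : Matrix a a ℂ}
    (hP : P.PosSemidef) (hN : N.PosSemidef) :
    traceNorm (P - N) ≤ P.trace.re + N.trace.re := by
  obtain ⟨U, V, hV, hU, h⟩ := exists_traceNorm_eq (P - N)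
  have hV' : (1 - V * V.conjTranspose).PosSemidef := by
    rw [hV, sub_self]; exact Matrix.PosSemidef.zero
  have key : ∀ {M : Matrix a a ℂ} (_ : M.PosSemidef) (s : ℂ) (_ : star s * s = 1)
      (_ : star s = s), -(s * (U.conjTranspose * M * V).trace).re ≤ M.trace.re := by
    intro M hM s hs hs'
    have h0 := (hM.conjTranspose_mul_mul_same (U + s • V)).trace_nonneg
    have e : ((U + s • V).conjTranspose * M * (U + s • V)).trace =
        (U.conjTranspose * M * U).trace + (V.conjTranspose * M * V).trace +
          (s * (U.conjTranspose * M * V).trace + star (s * (U.conjTranspose * M * V).trace)) := by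
      have : star (U.conjTranspose * M * V).trace = (V.conjTranspose * M * U).trace := by
        rw [← Matrix.trace_conjTranspose, Matrix.conjTranspose_mul, Matrix.conjTranspose_mul,
          Matrix.conjTranspose_conjTranspose, hM.isHermitian.eq, Matrix.mul_assoc]
      rw [star_mul', this, hs', Matrix.conjTranspose_add, Matrix.conjTranspose_smul]
      simp only [Matrix.add_mul, Matrix.mul_add, Matrix.trace_add, Matrix.smul_mul,
        Matrix.mul_smul, Matrix.trace_smul, smul_eq_mul]
      linear_combination (V.conjTranspose * M * V).trace * hs +
        (V.conjTranspose * M * U).trace * hs'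
    rw [e] at h0
    have h1 := (Complex.le_def.1 h0).1
    have hs2 : (star (s * (U.conjTranspose * M * V).trace)).re =
      (s * (U.conjTranspose * M * V).trace).re := Complex.conj_re _
    simp only [Complex.add_re, Complex.zero_re, hs2] at h1
    have := trace_conjugate_le hM hU
    have := trace_conjugate_le hM hV'
    linarith
  -- The sign -1 bounds the cross term of P from above, the sign 1 that of N from below.
  have hp := key hP (-1) (by simp) (by simp)
  have hn := key hN 1 (by simp) (by simp)
  have h' := congrArg Complex.re h
  rw [Complex.ofReal_re, Matrix.mul_sub, Matrix.sub_mul, Matrix.trace_sub, Complex.sub_re] at h'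
  simp at hp hn
  linarith

/-! ### Tensor products of superoperators and Kraus maps -/

section Kraus

variable {a b c d : Type} [Fintype a] [DecidableEq a] [Fintype c] [DecidableEq c]

theorem SuperOp.tensor_single (Φ : SuperOp a b) (Ψ : SuperOp c d) (i i' : a) (j j' : c) (r : ℂ) :
    SuperOp.tensor Φ Ψ (Matrix.single (i, j) (i', j') r) =
      r • (Φ (Matrix.single i i' 1) ⊗ₖ Ψ (Matrix.single j j' 1)) := by
  change ∑ k, ∑ k', ∑ l, ∑ l', Matrix.single (i, j) (i', j') r (k, l) (k', l') •
    (Φ (Matrix.single k k' 1) ⊗ₖ Ψ (Matrix.single l l' 1)) = _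
  rw [Finset.sum_eq_single i, Finset.sum_eq_single i', Finset.sum_eq_single j,
    Finset.sum_eq_single j']
  · simp
  all_goals first | (intro h; exact absurd (Finset.mem_univ _) h) | skip
  all_goals
    intro k _ hk
    simp [hk.symm]

theorem SuperOp.ext_single {Φ Ψ : SuperOp a b}
    (h : ∀ i j, Φ (Matrix.single i j 1) = Ψ (Matrix.single i j 1)) : Φ = Ψ := by
  refine LinearMap.ext fun X => ?_
  rw [Matrix.matrix_eq_sum_single X]
  simp only [map_sum]
  refine Finset.sum_congr rfl fun i _ => Finset.sum_congr rfl fun j _ => ?_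
  have : Matrix.single i j (X i j) = X i j • Matrix.single i j (1 : ℂ) := by simp
  rw [this, map_smul, map_smul, h]

/-- The map `X ↦ ∑ k, K k * X * (K k)†`. -/
def krausMap {κ : Type} [Fintype κ] (K : κ → Matrix b a ℂ) : SuperOp a b where
  toFun X := ∑ k, K k * X * (K k).conjTranspose
  map_add' X Y := by simp [Matrix.mul_add, Matrix.add_mul, Finset.sum_add_distrib]
  map_smul' r X := by simp [Finset.smul_sum]

theorem krausMap_apply {a b κ : Type} [Fintype a] [Fintype κ] (K : κ → Matrix b a ℂ) (X : Matrix a a ℂ) :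
    krausMap K X = ∑ k, K k * X * (K k).conjTranspose := rfl

/-- Lets every tensor product of channels be computed at the level of Kraus operators. -/
theorem tensor_krausMap {κ ι : Type} [Fintype κ] [Fintype ι] (K : κ → Matrix b a ℂ)
    (J : ι → Matrix d c ℂ) :
    SuperOp.tensor (krausMap K) (krausMap J) =
      krausMap (fun k : κ × ι => K k.1 ⊗ₖ J k.2) := by
  refine SuperOp.ext_single ?_
  rintro ⟨i, j⟩ ⟨i', j'⟩
  rw [SuperOp.tensor_single, one_smul, krausMap_apply, krausMap_apply, krausMap_apply,
    Fintype.sum_prod_type]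
  have : Matrix.single (i, j) (i', j') (1 : ℂ) =
      Matrix.single i i' (1 : ℂ) ⊗ₖ Matrix.single j j' (1 : ℂ) := by
    rw [Matrix.single_kronecker_single, mul_one]
  rw [this]
  simp only [Matrix.conjTranspose_kronecker, ← Matrix.mul_kronecker_mul]
  ext p q
  simp only [Matrix.kroneckerMap_apply, Matrix.sum_apply, Finset.sum_mul_sum]

theorem id_eq_krausMap : (LinearMap.id : SuperOp a a) = krausMap (fun _ : Unit => 1) := by
  refine LinearMap.ext fun X => ?_
  simp [krausMap_apply]

theorem isChannel_krausMap [Fintype b] {κ : Type} [Fintype κ] {K : κ → Matrix b a ℂ}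
    (h : ∑ k, (K k).conjTranspose * K k = 1) : IsChannel (krausMap K) := by
  refine ⟨fun e X hX => ?_, fun X => ?_⟩
  · rw [id_eq_krausMap, tensor_krausMap, krausMap_apply]
    exact Matrix.posSemidef_sum _ fun k _ => hX.mul_mul_conjTranspose_same _
  · rw [krausMap_apply, Matrix.trace_sum]
    have : ∀ k, (K k * X * (K k).conjTranspose).trace =
        ((K k).conjTranspose * K k * X).trace := fun k => by
      rw [Matrix.trace_mul_comm, Matrix.mul_assoc]
    simp only [this]
    rw [← Matrix.trace_sum, ← Finset.sum_mul, h, one_mul]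

theorem IsChannel.trace_tensor_id [Fintype b] {Φ : SuperOp a b} (hΦ : IsChannel Φ) {e : ℕ}
    (X : Matrix (Fin e × a) (Fin e × a) ℂ) :
    (SuperOp.tensor (LinearMap.id : SuperOp (Fin e) (Fin e)) Φ X).trace = X.trace := by
  rw [Matrix.matrix_eq_sum_single X]
  simp only [map_sum, Matrix.trace_sum]
  refine Finset.sum_congr rfl fun i _ => Finset.sum_congr rfl fun j _ => ?_
  obtain ⟨i, k⟩ := i
  obtain ⟨j, l⟩ := j
  rw [SuperOp.tensor_single, Matrix.trace_smul, Matrix.trace_kronecker, hΦ.2, LinearMap.id_apply]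
  by_cases h1 : i = j <;> by_cases h2 : k = l <;>
    simp [Matrix.trace, h1, h2, Prod.ext_iff]

theorem SuperOp.tensor_sum {ι : Type} [Fintype ι] (Ψ : SuperOp c d) (r : ι → ℂ)
    (E : ι → SuperOp a b) :
    SuperOp.tensor Ψ (∑ i, r i • E i) = ∑ i, r i • SuperOp.tensor Ψ (E i) := by
  refine SuperOp.ext_single ?_
  rintro ⟨i, j⟩ ⟨i', j'⟩
  simp only [LinearMap.sum_apply, LinearMap.smul_apply, SuperOp.tensor_single, one_smul]
  ext p q
  simp only [Matrix.kroneckerMap_apply, Matrix.sum_apply, Matrix.smul_apply, smul_eq_mul,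
    Finset.mul_sum]
  exact Finset.sum_congr rfl fun _ _ => by ring

theorem SuperOp.tensor_sub (Ψ : SuperOp c d) (E F : SuperOp a b) :
    SuperOp.tensor Ψ (E - F) = SuperOp.tensor Ψ E - SuperOp.tensor Ψ F := by
  refine SuperOp.ext_single ?_
  rintro ⟨i, j⟩ ⟨i', j'⟩
  simp only [LinearMap.sub_apply, SuperOp.tensor_single, one_smul]
  ext p q
  simp [Matrix.kroneckerMap_apply, mul_sub]

/-- If the difference of two superoperators is a real combination of channels, the sum of the
absolute values of the coefficients bounds their diamond norm distance. -/
theorem diamondDist_le_of_sub_eq_sum [Fintype b] [DecidableEq b] {ι : Type} [Fintype ι]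
    {Φ Ψ : SuperOp a b} {r : ι → ℝ} {E : ι → SuperOp a b} (hE : ∀ i, IsChannel (E i))
    (h : Φ - Ψ = ∑ i, (r i : ℂ) • E i) :
    diamondDist Φ Ψ ≤ ENNReal.ofReal (∑ i, |r i|) := by
  refine iSup_le fun e => iSup_le fun ρ => iSup_le fun hρ => ENNReal.ofReal_le_ofReal ?_
  have h1 := congrArg (fun Θ => SuperOp.tensor (LinearMap.id : SuperOp (Fin e) (Fin e)) Θ ρ) h
  simp only [SuperOp.tensor_sub, SuperOp.tensor_sum, LinearMap.sub_apply, LinearMap.sum_apply,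
    LinearMap.smul_apply] at h1
  rw [h1]
  set F : ι → Matrix (Fin e × b) (Fin e × b) ℂ := fun i =>
    SuperOp.tensor (LinearMap.id : SuperOp (Fin e) (Fin e)) (E i) ρ with hF
  have hFp : ∀ i, (F i).PosSemidef := fun i => (hE i).1 e ρ hρ.1
  have hFt : ∀ i, (F i).trace = 1 := fun i => ((hE i).trace_tensor_id ρ).trans hρ.2
  have hps : ∀ s : ι → ℝ, (∀ i, 0 ≤ s i) → (∑ i, (s i : ℂ) • F i).PosSemidef := fun s hs =>
    Matrix.posSemidef_sum _ fun i _ => (hFp i).smul (by exact_mod_cast hs i)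
  have htr : ∀ s : ι → ℝ, (∑ i, (s i : ℂ) • F i).trace.re = ∑ i, s i := fun s => by
    simp [Matrix.trace_sum, Matrix.trace_smul, hFt]
  -- Grouping coefficients by sign displays a difference of positive operators, whose traces add up
  -- to the sum of |r i| because the channels preserve the trace.
  have hsplit : ∑ i, (r i : ℂ) • F i =
      ∑ i, ((r i)⁺ : ℝ) • F i - ∑ i, ((r i)⁻ : ℝ) • F i := by
    rw [← Finset.sum_sub_distrib]
    refine Finset.sum_congr rfl fun i _ => ?_
    rw [← sub_smul, posPart_sub_negPart]
    rfl
  have hb := traceNorm_sub_le (hps (fun i => (r i)⁺) fun i => posPart_nonneg _)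
    (hps (fun i => (r i)⁻) fun i => negPart_nonneg _)
  rw [htr, htr, ← Finset.sum_add_distrib] at hb
  simp only [posPart_add_negPart] at hb
  rw [hsplit]
  exact hb

end Kraus

/-! ### Tensor products over a finite index type -/

section PiKron

variable {J A B C : Type} [Fintype J]

/-- The tensor product of a finite family of matrices. -/
def piKron (M : J → Matrix A B ℂ) : Matrix (J → A) (J → B) ℂ :=
  Matrix.of fun a b => ∏ j, M j (a j) (b j)

theorem piKron_apply (M : J → Matrix A B ℂ) (a : J → A) (b : J → B) :
    piKron M a b = ∏ j, M j (a j) (b j) := rfl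

theorem piKron_mul [DecidableEq J] [Fintype B] (M : J → Matrix A B ℂ) (N : J → Matrix B C ℂ) :
    piKron M * piKron N = piKron fun j => M j * N j := by
  ext a c
  simp only [Matrix.mul_apply, piKron_apply, Finset.prod_univ_sum, Fintype.piFinset_univ,
    Finset.prod_mul_distrib]

theorem piKron_conjTranspose (M : J → Matrix A B ℂ) :
    (piKron M).conjTranspose = piKron fun j => (M j).conjTranspose := by
  ext a c
  simp [piKron_apply]

theorem piKron_one [DecidableEq J] [DecidableEq A] :
    piKron (fun _ : J => (1 : Matrix A A ℂ)) = 1 := by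
  ext a b
  simp only [piKron_apply, Matrix.one_apply, funext_iff]
  by_cases h : ∀ j, a j = b j
  · simp [h]
  · rw [if_neg h]
    push Not at h
    obtain ⟨j, hj⟩ := h
    exact Finset.prod_eq_zero (Finset.mem_univ j) (by simp [hj])

theorem piKron_trace [DecidableEq J] [Fintype A] (M : J → Matrix A A ℂ) :
    (piKron M).trace = ∏ j, (M j).trace := by
  simp only [Matrix.trace, Matrix.diag_apply, piKron_apply, Finset.prod_univ_sum,
    Fintype.piFinset_univ]

theorem piKron_sum [DecidableEq J] {G : Type} [Fintype G] (M : J → G → Matrix A B ℂ) :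
    piKron (fun j => ∑ g, M j g) = ∑ g : J → G, piKron fun j => M j (g j) := by
  ext a b
  simp only [piKron_apply, Matrix.sum_apply, Finset.prod_univ_sum, Fintype.piFinset_univ]

theorem piKron_smul (r : J → ℂ) (M : J → Matrix A B ℂ) :
    piKron (fun j => r j • M j) = (∏ j, r j) • piKron M := by
  ext a b
  simp only [piKron_apply, Matrix.smul_apply, smul_eq_mul, Finset.prod_mul_distrib]

open scoped MatrixOrder in
theorem piKron_posSemidef [DecidableEq J] [Fintype A] [DecidableEq A] {M : J → Matrix A A ℂ}
    (h : ∀ j, (M j).PosSemidef) : (piKron M).PosSemidef := by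
  choose N hN using fun j => (CStarAlgebra.nonneg_iff_eq_star_mul_self (a := M j)).1 (h j).nonneg
  have : piKron M = (piKron N).conjTranspose * piKron N := by
    rw [piKron_conjTranspose, piKron_mul]
    congr 1; ext1 j; exact hN j
  rw [this]
  exact Matrix.posSemidef_conjTranspose_mul_self _

/-- The tensor product of a family of bipartite operators, regrouped as a bipartite operator. -/
def piKronPair (M : J → Matrix (A × B) (A × B) ℂ) :
    Matrix ((J → A) × (J → B)) ((J → A) × (J → B)) ℂ :=
  (piKron M).submatrix (Equiv.arrowProdEquivProdArrow J (fun _ => A) (fun _ => B)).symm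
    (Equiv.arrowProdEquivProdArrow J (fun _ => A) (fun _ => B)).symm

theorem piKronPair_mul [DecidableEq J] [Fintype A] [Fintype B]
    (M N : J → Matrix (A × B) (A × B) ℂ) :
    piKronPair M * piKronPair N = piKronPair fun j => M j * N j := by
  rw [piKronPair, piKronPair, Matrix.submatrix_mul_equiv, piKron_mul]; rfl

theorem piKronPair_conjTranspose (M : J → Matrix (A × B) (A × B) ℂ) :
    (piKronPair M).conjTranspose = piKronPair fun j => (M j).conjTranspose := by
  rw [piKronPair, Matrix.conjTranspose_submatrix, piKron_conjTranspose]; rfl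

theorem piKronPair_one [DecidableEq J] [DecidableEq A] [DecidableEq B] :
    piKronPair (fun _ : J => (1 : Matrix (A × B) (A × B) ℂ)) = 1 := by
  rw [piKronPair, piKron_one, Matrix.submatrix_one_equiv]

theorem piKronPair_trace [DecidableEq J] [Fintype A] [Fintype B]
    (M : J → Matrix (A × B) (A × B) ℂ) : (piKronPair M).trace = ∏ j, (M j).trace := by
  rw [← piKron_trace, piKronPair]
  exact Fintype.sum_equiv (Equiv.arrowProdEquivProdArrow J (fun _ => A) (fun _ => B)).symm _ _
    fun _ => rfl

theorem piKronPair_sum [DecidableEq J] {G : Type} [Fintype G]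
    (M : J → G → Matrix (A × B) (A × B) ℂ) :
    piKronPair (fun j => ∑ g, M j g) = ∑ g : J → G, piKronPair fun j => M j (g j) := by
  rw [piKronPair, piKron_sum]
  ext i j
  simp only [Matrix.submatrix_apply, Matrix.sum_apply]
  rfl

theorem piKronPair_smul (r : J → ℂ) (M : J → Matrix (A × B) (A × B) ℂ) :
    piKronPair (fun j => r j • M j) = (∏ j, r j) • piKronPair M := by
  rw [piKronPair, piKron_smul]; rfl

theorem piKronPair_posSemidef [DecidableEq J] [Fintype A] [DecidableEq A] [Fintype B]
    [DecidableEq B] {M : J → Matrix (A × B) (A × B) ℂ} (h : ∀ j, (M j).PosSemidef) :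
    (piKronPair M).PosSemidef := (piKron_posSemidef h).submatrix _

/-- Local product operators act on the copies of a bipartite state one copy at a time, even after
all left halves and all right halves are regrouped. -/
theorem piKron_kronecker_conj [DecidableEq J] {L R : Type} [Fintype L] [Fintype R]
    (F : J → Matrix A L ℂ) (G : J → Matrix B R ℂ) (M : J → Matrix (L × R) (L × R) ℂ) :
    (piKron F ⊗ₖ piKron G) * piKronPair M * (piKron F ⊗ₖ piKron G).conjTranspose =
      piKronPair fun j => (F j ⊗ₖ G j) * M j * (F j ⊗ₖ G j).conjTranspose := by
  have h : piKron F ⊗ₖ piKron G = (piKron fun j => F j ⊗ₖ G j).submatrix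
      (Equiv.arrowProdEquivProdArrow J (fun _ => A) (fun _ => B)).symm
      (Equiv.arrowProdEquivProdArrow J (fun _ => L) (fun _ => R)).symm := by
    ext ⟨a, b⟩ ⟨l, r⟩
    simp only [Matrix.kroneckerMap_apply, piKron_apply, Matrix.submatrix_apply,
      ← Finset.prod_mul_distrib]
    rfl
  rw [h, Matrix.conjTranspose_submatrix, piKronPair, Matrix.submatrix_mul_equiv,
    Matrix.submatrix_mul_equiv, piKron_conjTranspose, piKron_mul, piKron_mul]
  rfl

end PiKron

/-! ### Appending states -/

section Append

variable {Q L R : Type}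

theorem appendState_apply (Ψ : Matrix (L × R) (L × R) ℂ) (ρ : Matrix Q Q ℂ)
    (i j : (Q × L) × R) :
    appendState Ψ ρ i j = ρ i.1.1 j.1.1 * Ψ (i.1.2, i.2) (j.1.2, j.2) := rfl

theorem appendState_sum {ι : Type} [Fintype ι] (Ψ : ι → Matrix (L × R) (L × R) ℂ) :
    (appendState (∑ i, Ψ i) : SuperOp Q _) = ∑ i, appendState (Ψ i) := by
  refine LinearMap.ext fun ρ => ?_
  ext i j
  simp [appendState_apply, LinearMap.sum_apply, Matrix.sum_apply, Finset.mul_sum]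

theorem appendState_smul (r : ℂ) (Ψ : Matrix (L × R) (L × R) ℂ) :
    (appendState (r • Ψ) : SuperOp Q _) = r • appendState Ψ := by
  refine LinearMap.ext fun ρ => ?_
  ext i j
  simp [appendState_apply]
  ring

theorem appendState_one_one [DecidableEq Q] [DecidableEq L] [DecidableEq R] :
    appendState (1 : Matrix (L × R) (L × R) ℂ) (1 : Matrix Q Q ℂ) = 1 := by
  ext ⟨⟨q, l⟩, r⟩ ⟨⟨q', l'⟩, r'⟩
  by_cases h1 : q = q' <;> by_cases h2 : l = l' <;> by_cases h3 : r = r' <;>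
    simp [appendState_apply, Matrix.one_apply, h1, h2, h3]

theorem conj_appendState {A B : Type} [Fintype Q] [Fintype L] [Fintype R] (U : Matrix Q Q ℂ)
    (F : Matrix A L ℂ) (G : Matrix B R ℂ) (Ψ : Matrix (L × R) (L × R) ℂ) (ρ : Matrix Q Q ℂ) :
    ((U ⊗ₖ F) ⊗ₖ G) * appendState Ψ ρ * ((U ⊗ₖ F) ⊗ₖ G).conjTranspose =
      appendState ((F ⊗ₖ G) * Ψ * (F ⊗ₖ G).conjTranspose) (U * ρ * U.conjTranspose) := by
  have h : (U ⊗ₖ F) ⊗ₖ G = (U ⊗ₖ (F ⊗ₖ G)).submatrix (Equiv.prodAssoc Q A B)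
      (Equiv.prodAssoc Q L R) := by
    ext i j
    simp [Matrix.kroneckerMap_apply, mul_assoc]
  change _ * (ρ ⊗ₖ Ψ).submatrix (Equiv.prodAssoc Q L R) (Equiv.prodAssoc Q L R) * _ =
    (_ ⊗ₖ _).submatrix (Equiv.prodAssoc Q A B) (Equiv.prodAssoc Q A B)
  rw [h, Matrix.conjTranspose_submatrix, Matrix.submatrix_mul_equiv, Matrix.submatrix_mul_equiv,
    Matrix.conjTranspose_kronecker, ← Matrix.mul_kronecker_mul, ← Matrix.mul_kronecker_mul]

/-- The operator `U ⊗ ⟨v|`, where `v` is a functional on the system `LR`. -/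
def tensorRow (U : Matrix Q Q ℂ) (v : L × R → ℂ) : Matrix Q ((Q × L) × R) ℂ :=
  Matrix.of fun q p => U q p.1.1 * v (p.1.2, p.2)

variable [Fintype Q] [Fintype L] [Fintype R]

theorem sum_prod_prod (f : Q → L → R → ℂ) :
    ∑ p : (Q × L) × R, f p.1.1 p.1.2 p.2 = ∑ q, ∑ s : L × R, f q s.1 s.2 := by
  simp only [Fintype.sum_prod_type]

/-- The rows of M serve as Kraus operators for applying M to LR and tracing that system out; the
secret only sees U and a scalar weight. -/
theorem tensorRow_conj {ι : Type} [Fintype ι] (U : Matrix Q Q ℂ) (M : Matrix ι (L × R) ℂ)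
    (Ψ : Matrix (L × R) (L × R) ℂ) (ρ : Matrix Q Q ℂ) :
    ∑ i, tensorRow U (M i) * appendState Ψ ρ * (tensorRow U (M i)).conjTranspose =
      (M * Ψ * M.conjTranspose).trace • (U * ρ * U.conjTranspose) := by
  ext q q'
  simp only [Matrix.sum_apply, Matrix.smul_apply, smul_eq_mul, Matrix.trace, Matrix.diag_apply,
    Finset.sum_mul]
  refine Finset.sum_congr rfl fun i _ => ?_
  simp only [Matrix.mul_apply, Matrix.conjTranspose_apply, tensorRow, Matrix.of_apply,
    appendState_apply]
  rw [sum_prod_prod (fun q₁ l r => (∑ p : (Q × L) × R, U q p.1.1 * M i (p.1.2, p.2) *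
    (ρ p.1.1 q₁ * Ψ (p.1.2, p.2) (l, r))) * star (U q' q₁ * M i (l, r))), Finset.sum_mul_sum,
    Finset.sum_comm]
  refine Finset.sum_congr rfl fun s _ => Finset.sum_congr rfl fun q₁ _ => ?_
  rw [sum_prod_prod (fun q₂ l r => U q q₂ * M i (l, r) * (ρ q₂ q₁ * Ψ (l, r) (s.1, s.2)))]
  rw [star_mul', mul_mul_mul_comm, mul_comm (star _), Finset.sum_mul_sum, Finset.sum_comm]
  congr 1
  refine Finset.sum_congr rfl fun s _ => Finset.sum_congr rfl fun q₁ _ => ?_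
  ring

theorem sum_conjTranspose_mul_tensorRow {ι : Type} [Fintype ι] (U : Matrix Q Q ℂ)
    (M : Matrix ι (L × R) ℂ) :
    ∑ i, (tensorRow U (M i)).conjTranspose * tensorRow U (M i) =
      appendState (M.conjTranspose * M) (U.conjTranspose * U) := by
  ext p p'
  simp only [Matrix.sum_apply, appendState_apply, Matrix.mul_apply, Matrix.conjTranspose_apply,
    tensorRow, Matrix.of_apply, Finset.sum_mul_sum, star_mul']
  rw [Finset.sum_comm]
  refine Finset.sum_congr rfl fun s _ => Finset.sum_congr rfl fun q₁ _ => ?_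
  ring

theorem sum_mul_conjTranspose_tensorRow {ι : Type} [Fintype ι] [DecidableEq Q]
    (M : Matrix ι (L × R) ℂ) :
    ∑ i, tensorRow (1 : Matrix Q Q ℂ) (M i) * (tensorRow (1 : Matrix Q Q ℂ) (M i)).conjTranspose =
      (M * M.conjTranspose).trace • (1 : Matrix Q Q ℂ) := by
  classical
  have := tensorRow_conj (1 : Matrix Q Q ℂ) M 1 1
  rw [appendState_one_one] at this
  simpa using this

/-- The adjoints of the rows of a square root of the state inject its unnormalized components, so
appending a positive operator is completely positive. -/
theorem appendState_eq_krausMap {ι : Type} [Fintype ι] [DecidableEq Q] (M : Matrix ι (L × R) ℂ) :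
    (appendState (M.conjTranspose * M) : SuperOp Q _) =
      krausMap fun i => (tensorRow 1 (M i)).conjTranspose := by
  refine LinearMap.ext fun ρ => ?_
  ext p p'
  simp only [krausMap_apply, Matrix.conjTranspose_conjTranspose, Matrix.sum_apply]
  rw [appendState_apply, Matrix.mul_apply, Finset.mul_sum]
  refine Finset.sum_congr rfl fun i _ => ?_
  have h : ∀ q' : Q, ((tensorRow (1 : Matrix Q Q ℂ) (M i)).conjTranspose * ρ) p q' =
      star (M i (p.1.2, p.2)) * ρ p.1.1 q' := fun q' => by
    rw [Matrix.mul_apply, Finset.sum_eq_single p.1.1]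
    · simp [tensorRow]
    · intro r _ hr
      simp [tensorRow, Matrix.one_apply, hr]
    · simp
  rw [Matrix.mul_apply, Finset.sum_eq_single p'.1.1]
  · rw [h]
    simp [tensorRow]
    ring
  · intro r _ hr
    simp [tensorRow, Matrix.one_apply, hr]
  · simp

theorem krausMap_comp {a b c κ ι : Type} [Fintype a] [Fintype b] [Fintype κ] [Fintype ι]
    (K : κ → Matrix c b ℂ) (J : ι → Matrix b a ℂ) :
    (krausMap K).comp (krausMap J) = krausMap fun k : κ × ι => K k.1 * J k.2 := by
  refine LinearMap.ext fun ρ => ?_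
  simp only [LinearMap.comp_apply, krausMap_apply, Fintype.sum_prod_type, Matrix.mul_sum,
    Matrix.sum_mul, Matrix.conjTranspose_mul, Matrix.mul_assoc]

/-- Conjugation by `U`. -/
def conjMap {a b : Type} [Fintype a] (U : Matrix b a ℂ) : SuperOp a b := krausMap fun _ : Unit => U

theorem conjMap_apply {a b : Type} [Fintype a] (U : Matrix b a ℂ) (X : Matrix a a ℂ) :
    conjMap U X = U * X * U.conjTranspose := by simp [conjMap, krausMap_apply]

theorem isChannel_conjMap {a b : Type} [Fintype a] [DecidableEq a] [Fintype b] {U : Matrix b a ℂ}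
    (hU : U.conjTranspose * U = 1) : IsChannel (conjMap U) := isChannel_krausMap (by simpa using hU)

open scoped MatrixOrder in
theorem isChannel_appendState_comp_conjMap [DecidableEq Q] [DecidableEq L] [DecidableEq R]
    {Ψ : Matrix (L × R) (L × R) ℂ} (hΨ : IsDensity Ψ) {U : Matrix Q Q ℂ}
    (hU : U.conjTranspose * U = 1) :
    IsChannel ((appendState Ψ).comp (conjMap U)) := by
  obtain ⟨M, hM⟩ := (CStarAlgebra.nonneg_iff_eq_star_mul_self (a := Ψ)).1 hΨ.1.nonneg
  rw [Matrix.star_eq_conjTranspose] at hM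
  subst hM
  rw [appendState_eq_krausMap, conjMap, krausMap_comp]
  refine isChannel_krausMap ?_
  have : ∀ i : (L × R) × Unit, ((tensorRow (1 : Matrix Q Q ℂ) (M i.1)).conjTranspose *
      U).conjTranspose * ((tensorRow (1 : Matrix Q Q ℂ) (M i.1)).conjTranspose * U) =
      U.conjTranspose * (tensorRow (1 : Matrix Q Q ℂ) (M i.1) *
        (tensorRow (1 : Matrix Q Q ℂ) (M i.1)).conjTranspose) * U := fun i => by
    rw [Matrix.conjTranspose_mul, Matrix.conjTranspose_conjTranspose]
    simp only [Matrix.mul_assoc]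
  simp only [this]
  rw [Fintype.sum_prod_type]
  simp only [Finset.univ_unique, Finset.sum_singleton]
  rw [← Finset.sum_mul, ← Finset.mul_sum, sum_mul_conjTranspose_tensorRow,
    Matrix.trace_mul_comm, hΨ.2]
  simpa using hU

end Append

/-! ### Protocols with shared randomness -/

section Randomness

variable {Ω L : Type} [DecidableEq Ω] [DecidableEq L]

/-- The isometry `|l⟩ ↦ |r⟩|l⟩`. -/
def embed (L : Type) [DecidableEq L] (r : Ω) : Matrix (Ω × L) L ℂ :=
  Matrix.of fun p l => if p = (r, l) then 1 else 0

theorem conjTranspose_embed_mul_embed [Fintype Ω] [Fintype L] (r s : Ω) :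
    (embed L r).conjTranspose * embed L s = if r = s then 1 else 0 := by
  ext l l'
  by_cases h : r = s
  · subst h
    simp [Matrix.mul_apply, embed, Matrix.one_apply, eq_comm]
  · simp [Matrix.mul_apply, embed, h, Ne.symm h]

theorem sum_embed_mul_conjTranspose [Fintype Ω] [Fintype L] :
    ∑ r : Ω, embed L r * (embed L r).conjTranspose = 1 := by
  ext ⟨r, l⟩ ⟨r', l'⟩
  rw [Matrix.sum_apply, Finset.sum_eq_single r, Matrix.mul_apply, Finset.sum_eq_single l]
  · simp [embed, Matrix.one_apply, eq_comm]
  · intro b _ hb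
    simp [embed, hb.symm]
  · simp
  · intro b _ hb
    simp [embed, hb.symm, Matrix.mul_apply]
  · simp

theorem sum_kraus_embed [Fintype Ω] [Fintype L] {M κ : Type} [Fintype M] [Fintype κ]
    {F : Ω → κ → Matrix M L ℂ} (hF : ∀ r, ∑ k, (F r k).conjTranspose * F r k = 1) :
    ∑ p : Ω × κ, (F p.1 p.2 * (embed L p.1).conjTranspose).conjTranspose *
      (F p.1 p.2 * (embed L p.1).conjTranspose) = 1 := by
  rw [Fintype.sum_prod_type, ← sum_embed_mul_conjTranspose (Ω := Ω) (L := L)]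
  refine Finset.sum_congr rfl fun r _ => ?_
  have : ∀ k, (F r k * (embed L r).conjTranspose).conjTranspose *
      (F r k * (embed L r).conjTranspose) =
      embed L r * ((F r k).conjTranspose * F r k) * (embed L r).conjTranspose := fun k => by
    rw [Matrix.conjTranspose_mul, Matrix.conjTranspose_conjTranspose]
    simp only [Matrix.mul_assoc]
  simp only [this]
  rw [← Matrix.sum_mul, ← Matrix.mul_sum, hF, Matrix.mul_one]

variable {R : Type} [DecidableEq R] [Fintype Ω] [Fintype L] [Fintype R]

/-- The state `Ψ` together with a shared random variable of law `μ`. -/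
def randomizedState (μ : Ω → ℝ) (Ψ : Matrix (L × R) (L × R) ℂ) :
    Matrix ((Ω × L) × (Ω × R)) ((Ω × L) × (Ω × R)) ℂ :=
  ∑ r, (μ r : ℂ) • ((embed L r ⊗ₖ embed R r) * Ψ * (embed L r ⊗ₖ embed R r).conjTranspose)

theorem isDensity_randomizedState {μ : Ω → ℝ} (hμ : ∀ r, 0 ≤ μ r) (hμ' : ∑ r, μ r = 1)
    {Ψ : Matrix (L × R) (L × R) ℂ} (hΨ : IsDensity Ψ) : IsDensity (randomizedState μ Ψ) := by
  refine ⟨Matrix.posSemidef_sum _ fun r _ =>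
    (hΨ.1.mul_mul_conjTranspose_same _).smul (by exact_mod_cast hμ r), ?_⟩
  have : ∀ r : Ω, ((embed L r ⊗ₖ embed R r) * Ψ * (embed L r ⊗ₖ embed R r).conjTranspose).trace = 1 :=
      fun r => by
    rw [Matrix.trace_mul_comm, ← Matrix.mul_assoc, Matrix.conjTranspose_kronecker,
      ← Matrix.mul_kronecker_mul, conjTranspose_embed_mul_embed, conjTranspose_embed_mul_embed,
      if_pos rfl, if_pos rfl, Matrix.one_kronecker_one, Matrix.one_mul, hΨ.2]
  rw [randomizedState, Matrix.trace_sum]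
  simp only [Matrix.trace_smul, this, smul_eq_mul, mul_one]
  exact_mod_cast hμ'

/-- The shared variable is perfectly correlated: Kraus operators reading different values on the two
sides annihilate the state, and equal values release the branch with its weight. -/
theorem randomizedState_conj {A B : Type} (μ : Ω → ℝ) (Ψ : Matrix (L × R) (L × R) ℂ) (r s : Ω)
    (F : Matrix A L ℂ) (G : Matrix B R ℂ) :
    ((F * (embed L r).conjTranspose) ⊗ₖ (G * (embed R s).conjTranspose)) * randomizedState μ Ψ *
      ((F * (embed L r).conjTranspose) ⊗ₖ (G * (embed R s).conjTranspose)).conjTranspose =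
      if r = s then (μ r : ℂ) • ((F ⊗ₖ G) * Ψ * (F ⊗ₖ G).conjTranspose) else 0 := by
  have h : ∀ t : Ω, ((F * (embed L r).conjTranspose) ⊗ₖ (G * (embed R s).conjTranspose)) *
      (embed L t ⊗ₖ embed R t) = if r = t ∧ s = t then F ⊗ₖ G else 0 := fun t => by
    rw [← Matrix.mul_kronecker_mul, Matrix.mul_assoc, Matrix.mul_assoc,
      conjTranspose_embed_mul_embed, conjTranspose_embed_mul_embed]
    by_cases h1 : r = t <;> by_cases h2 : s = t <;> simp [h1, h2]
  have h' : ∀ t : Ω, ((F * (embed L r).conjTranspose) ⊗ₖ (G * (embed R s).conjTranspose)) *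
      ((μ t : ℂ) • ((embed L t ⊗ₖ embed R t) * Ψ * (embed L t ⊗ₖ embed R t).conjTranspose)) *
      ((F * (embed L r).conjTranspose) ⊗ₖ (G * (embed R s).conjTranspose)).conjTranspose =
      if r = t ∧ s = t then (μ t : ℂ) • ((F ⊗ₖ G) * Ψ * (F ⊗ₖ G).conjTranspose) else 0 :=
    fun t => by
    have : ((F * (embed L r).conjTranspose) ⊗ₖ (G * (embed R s).conjTranspose)) *
      ((μ t : ℂ) • ((embed L t ⊗ₖ embed R t) * Ψ * (embed L t ⊗ₖ embed R t).conjTranspose)) *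
      ((F * (embed L r).conjTranspose) ⊗ₖ (G * (embed R s).conjTranspose)).conjTranspose =
      (μ t : ℂ) • ((((F * (embed L r).conjTranspose) ⊗ₖ (G * (embed R s).conjTranspose)) *
      (embed L t ⊗ₖ embed R t)) * Ψ * (((F * (embed L r).conjTranspose) ⊗ₖ
      (G * (embed R s).conjTranspose)) * (embed L t ⊗ₖ embed R t)).conjTranspose) := by
      rw [Matrix.mul_smul, Matrix.smul_mul, Matrix.conjTranspose_mul (_ ⊗ₖ _) (_ ⊗ₖ _)]
      simp only [Matrix.mul_assoc]
    rw [this, h]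
    split_ifs <;> simp
  rw [randomizedState, Matrix.mul_sum, Matrix.sum_mul]
  simp only [h']
  by_cases hrs : r = s
  · subst hrs
    simp
  · rw [if_neg hrs]
    refine Finset.sum_eq_zero fun t _ => if_neg ?_
    rintro ⟨rfl, rfl⟩
    exact hrs rfl

variable {X Y Q A B κ ι : Type} [Fintype Q] [DecidableEq Q] [Fintype A] [DecidableEq A]
  [Fintype B] [DecidableEq B] [Fintype κ] [Fintype ι]

/-- Alice and Bob share the state `Ψ` and a random variable `r` of law `μ`. Alice applies the
unitary `U r` to the secret and `F x r` to her share of `Ψ`, Bob applies `G y r` to his. -/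
def randomizedProtocol {μ : Ω → ℝ} (hμ : ∀ r, 0 ≤ μ r) (hμ' : ∑ r, μ r = 1)
    {Ψ : Matrix (L × R) (L × R) ℂ} (hΨ : IsDensity Ψ)
    {U : Ω → Matrix Q Q ℂ} (hU : ∀ r, (U r).conjTranspose * U r = 1)
    {F : X → Ω → κ → Matrix A L ℂ} (hF : ∀ x r, ∑ k, (F x r k).conjTranspose * F x r k = 1)
    {G : Y → Ω → ι → Matrix B R ℂ} (hG : ∀ y r, ∑ k, (G y r k).conjTranspose * G y r k = 1) :
    Protocol X Y Q (Ω × L) (Ω × R) (Q × A) B where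
  resource := randomizedState μ Ψ
  resource_isDensity := isDensity_randomizedState hμ hμ' hΨ
  alice x := krausMap fun p : Ω × κ => U p.1 ⊗ₖ (F x p.1 p.2 * (embed L p.1).conjTranspose)
  alice_isChannel x := by
    refine isChannel_krausMap ?_
    simp only [Matrix.conjTranspose_kronecker, ← Matrix.mul_kronecker_mul, hU]
    rw [← Matrix.one_kronecker_one, ← sum_kraus_embed (hF x)]
    ext i j
    simp only [Matrix.sum_apply, Matrix.kroneckerMap_apply, Finset.mul_sum]
  bob y := krausMap fun p : Ω × ι => G y p.1 p.2 * (embed R p.1).conjTranspose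
  bob_isChannel y := isChannel_krausMap (sum_kraus_embed (hG y))

/-- Both parties condition on the same value, so the double sum over what they read collapses to its
diagonal. -/
theorem randomizedProtocol_encoding {μ : Ω → ℝ} (hμ : ∀ r, 0 ≤ μ r) (hμ' : ∑ r, μ r = 1)
    {Ψ : Matrix (L × R) (L × R) ℂ} (hΨ : IsDensity Ψ)
    {U : Ω → Matrix Q Q ℂ} (hU : ∀ r, (U r).conjTranspose * U r = 1)
    {F : X → Ω → κ → Matrix A L ℂ} (hF : ∀ x r, ∑ k, (F x r k).conjTranspose * F x r k = 1)
    {G : Y → Ω → ι → Matrix B R ℂ} (hG : ∀ y r, ∑ k, (G y r k).conjTranspose * G y r k = 1)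
    (x : X) (y : Y) :
    (randomizedProtocol hμ hμ' hΨ hU hF hG).encoding x y =
      ∑ r, (appendState (∑ k, ∑ l, (μ r : ℂ) • ((F x r k ⊗ₖ G y r l) * Ψ *
        (F x r k ⊗ₖ G y r l).conjTranspose))).comp (conjMap (U r)) := by
  refine LinearMap.ext fun ρ => ?_
  rw [Protocol.encoding]
  simp only [randomizedProtocol, tensor_krausMap, LinearMap.comp_apply, krausMap_apply,
    conj_appendState, randomizedState_conj, LinearMap.sum_apply, conjMap_apply]
  rw [Fintype.sum_prod_type, Fintype.sum_prod_type]
  refine Finset.sum_congr rfl fun r _ => ?_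
  simp only [appendState_sum, LinearMap.sum_apply]
  refine Finset.sum_congr rfl fun k _ => ?_
  rw [Fintype.sum_prod_type, Finset.sum_eq_single r]
  · simp
  · intro s _ hs
    refine Finset.sum_eq_zero fun l _ => ?_
    rw [if_neg hs.symm]
    ext i j
    simp [appendState_apply]
  · simp

end Randomness

/-! ### Gadgets and their composition -/

/-- The sign `(-1)^a`. -/
def sgn (a : ZMod 2) : ℝ := if a = 0 then 1 else -1

/-- A gadget transmits a bit `τ` known to Alice and Bob to the referee, over a classical channel
whose bias depends on the inputs: what the referee receives is equivalent to a bit `o` with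
`o = τ` with probability `(1 + bias) / 2`, encoded in two orthogonal subspaces. -/
structure Gadget (X Y L R A B G κ ι : Type) [Fintype L] [DecidableEq L] [Fintype R] [DecidableEq R]
    [Fintype A] [DecidableEq A] [Fintype B] [DecidableEq B] [Fintype G] [Fintype κ]
    [Fintype ι] where
  weight : G → ℝ
  weight_nonneg : ∀ g, 0 ≤ weight g
  weight_sum : ∑ g, weight g = 1
  state : Matrix (L × R) (L × R) ℂ
  state_isDensity : IsDensity state
  alice : X → G → κ → Matrix A L ℂ
  alice_complete : ∀ x g, ∑ k, (alice x g k).conjTranspose * alice x g k = 1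
  bob : Y → ZMod 2 → G → ι → Matrix B R ℂ
  bob_complete : ∀ y τ g, ∑ k, (bob y τ g k).conjTranspose * bob y τ g k = 1
  proj : ZMod 2 → Matrix (A × B) (A × B) ℂ
  proj_isHermitian : ∀ o, (proj o).conjTranspose = proj o
  proj_mul : ∀ o o', proj o * proj o' = if o = o' then proj o else 0
  proj_sum : ∑ o, proj o = 1
  rank : ℝ
  rank_pos : 0 < rank
  proj_trace : ∀ o, (proj o).trace = rank
  bias : X → Y → ℝ
  output_eq : ∀ x y τ, ∑ g, ∑ k, ∑ l, (weight g : ℂ) • ((alice x g k ⊗ₖ bob y τ g l) * state *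
    (alice x g k ⊗ₖ bob y τ g l).conjTranspose) =
      ∑ o, (((1 + sgn τ * sgn o * bias x y) / 2 : ℝ) : ℂ) • ((rank : ℂ)⁻¹ • proj o)

theorem isDensity_piKronPair {J A B : Type} [Fintype J] [DecidableEq J] [Fintype A] [DecidableEq A]
    [Fintype B] [DecidableEq B] {M : J → Matrix (A × B) (A × B) ℂ} (h : ∀ j, IsDensity (M j)) :
    IsDensity (piKronPair M) :=
  ⟨piKronPair_posSemidef fun j => (h j).1, by
    rw [piKronPair_trace]
    exact Finset.prod_eq_one fun j _ => (h j).2⟩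

/-- Two-bit keys of the quantum one-time pad. -/
abbrev Key : Type := ZMod 2 → ZMod 2

/-- The Pauli operator with key `k`. -/
def pad (k : Key) : Matrix (Fin 2) (Fin 2) ℂ :=
  (if k 0 = 0 then 1 else !![0, 1; 1, 0]) * (if k 1 = 0 then 1 else !![1, 0; 0, -1])

theorem conjTranspose_pad_mul_pad (k : Key) : (pad k).conjTranspose * pad k = 1 := by
  unfold pad
  split_ifs <;> ext i j <;> fin_cases i <;> fin_cases j <;>
    simp [Matrix.mul_apply, Fin.sum_univ_two]

theorem pad_mul_conjTranspose_pad (k : Key) : pad k * (pad k).conjTranspose = 1 :=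
  mul_eq_one_comm.1 (conjTranspose_pad_mul_pad k)

theorem sum_key {M : Type} [AddCommMonoid M] (f : ZMod 2 → ZMod 2 → M) :
    ∑ k : Key, f (k 0) (k 1) = ∑ a, ∑ b, f a b := by
  rw [← Fintype.sum_prod_type']
  exact Fintype.sum_equiv (finTwoArrowEquiv (ZMod 2)) _ _ fun k => rfl

/-- The Z-type keys cancel the off-diagonal entries and the X-type keys exchange the diagonal ones.
A uniformly random key therefore leaves no trace of the secret. -/
theorem sum_pad_conj (ρ : Matrix (Fin 2) (Fin 2) ℂ) :
    ∑ k : Key, pad k * ρ * (pad k).conjTranspose = (2 * ρ.trace) • 1 := by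
  have h := sum_key fun a b => ((if a = 0 then 1 else !![0, 1; 1, 0]) * (if b = 0 then 1 else
    !![1, 0; 0, -1]) : Matrix (Fin 2) (Fin 2) ℂ) * ρ * ((if a = 0 then 1 else !![0, 1; 1, 0]) *
    (if b = 0 then 1 else !![1, 0; 0, -1]) : Matrix (Fin 2) (Fin 2) ℂ).conjTranspose
  refine h.trans ?_
  have hu : (Finset.univ : Finset (ZMod 2)) = {0, 1} := rfl
  simp only [hu, Finset.sum_pair (zero_ne_one : (0 : ZMod 2) ≠ 1)]
  simp only [if_true, one_ne_zero, if_false]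
  ext i j
  simp only [Matrix.add_apply, Matrix.mul_apply, Matrix.conjTranspose_apply, Fin.sum_univ_two,
    Matrix.smul_apply, Matrix.trace, Matrix.diag_apply]
  fin_cases i <;> fin_cases j <;> simp [Matrix.one_apply] <;> ring

/-! ### Parallel gadgets under a one-time pad: correctness and security in terms of the classical
law. -/

section Compose

variable {X Y L R A B G κ ι J : Type} [Fintype L] [DecidableEq L] [Fintype R] [DecidableEq R]
  [Fintype A] [DecidableEq A] [Fintype B] [DecidableEq B] [Fintype G] [Fintype κ]
  [Fintype ι] [Fintype J] [DecidableEq J]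
  (𝒢 : Gadget X Y L R A B G κ ι)

theorem SuperOp.sum_comp {a b c ι : Type} [Fintype ι] (Φ : ι → SuperOp b c) (Ψ : SuperOp a b) :
    (∑ i, Φ i).comp Ψ = ∑ i, (Φ i).comp Ψ := by
  refine LinearMap.ext fun ρ => ?_
  simp [LinearMap.sum_apply]

theorem SuperOp.comp_sum {a b c ι : Type} [Fintype ι] (Φ : SuperOp b c) (Ψ : ι → SuperOp a b) :
    Φ.comp (∑ i, Ψ i) = ∑ i, Φ.comp (Ψ i) := by
  refine LinearMap.ext fun ρ => ?_
  simp [LinearMap.sum_apply]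

namespace Gadget

/-- The state of the referee when the gadget delivers the bit `o`. -/
def received (o : ZMod 2) : Matrix (A × B) (A × B) ℂ := (𝒢.rank : ℂ)⁻¹ • 𝒢.proj o

theorem isDensity_received (o : ZMod 2) : IsDensity (𝒢.received o) := by
  refine ⟨?_, ?_⟩
  · have : 𝒢.proj o = (𝒢.proj o).conjTranspose * 𝒢.proj o := by
      rw [𝒢.proj_isHermitian, 𝒢.proj_mul, if_pos rfl]
    refine Matrix.PosSemidef.smul ?_ ?_
    · rw [this]
      exact Matrix.posSemidef_conjTranspose_mul_self _
    · have := 𝒢.rank_pos.le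
      rw [← Complex.ofReal_inv]
      exact_mod_cast inv_nonneg.2 this
  · rw [received, Matrix.trace_smul, 𝒢.proj_trace, smul_eq_mul,
      inv_mul_cancel₀ (by exact_mod_cast ne_of_gt 𝒢.rank_pos)]

/-- The message when the secret is padded with the key `k` and the gadgets deliver the bits `o`. -/
def message (k : Key) (o : J → ZMod 2) :
    SuperOp (Fin 2) ((Fin 2 × (J → A)) × (J → B)) :=
  (appendState (piKronPair fun j => 𝒢.received (o j))).comp (conjMap (pad k))

theorem isChannel_message (k : Key) (o : J → ZMod 2) : IsChannel (𝒢.message k o) :=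
  isChannel_appendState_comp_conjMap (isDensity_piKronPair fun j => 𝒢.isDensity_received (o j))
    (conjTranspose_pad_mul_pad k)

/-- The referee measures the bits `o`, and removes the pad with the key `guess o`. -/
def decoder (guess : (J → ZMod 2) → Key) : SuperOp ((Fin 2 × (J → A)) × (J → B)) (Fin 2) :=
  krausMap fun p : (J → ZMod 2) × ((J → A) × (J → B)) =>
    tensorRow (pad (guess p.1)).conjTranspose (piKronPair (fun j => 𝒢.proj (p.1 j)) p.2)

theorem isChannel_decoder (guess : (J → ZMod 2) → Key) : IsChannel (𝒢.decoder guess) := by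
  refine isChannel_krausMap ?_
  rw [Fintype.sum_prod_type]
  simp only [sum_conjTranspose_mul_tensorRow, Matrix.conjTranspose_conjTranspose,
    pad_mul_conjTranspose_pad, piKronPair_conjTranspose, piKronPair_mul, 𝒢.proj_isHermitian,
    𝒢.proj_mul, if_true]
  rw [← appendState_one_one, ← piKronPair_one (J := J), ← 𝒢.proj_sum, piKronPair_sum,
    appendState_sum, LinearMap.sum_apply]

/-- The subspaces of distinct bit strings are orthogonal, so the measurement reads the bits without
error, and only the mismatch between the guessed and the true pad survives. -/
theorem decoder_comp_message (guess : (J → ZMod 2) → Key) (k : Key) (o : J → ZMod 2) :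
    (𝒢.decoder guess).comp (𝒢.message k o) =
      conjMap ((pad (guess o)).conjTranspose * pad k) := by
  refine LinearMap.ext fun ρ => ?_
  rw [LinearMap.comp_apply, message, LinearMap.comp_apply, decoder, krausMap_apply,
    Fintype.sum_prod_type]
  simp only [tensorRow_conj]
  rw [Finset.sum_eq_single o]
  · have : (piKronPair (fun j => 𝒢.proj (o j)) * piKronPair (fun j => 𝒢.received (o j)) *
        (piKronPair fun j => 𝒢.proj (o j)).conjTranspose).trace = 1 := by
      rw [piKronPair_conjTranspose, piKronPair_mul, piKronPair_mul, piKronPair_trace]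
      refine Finset.prod_eq_one fun j _ => ?_
      rw [← (𝒢.isDensity_received (o j)).2, received, 𝒢.proj_isHermitian, Matrix.mul_smul,
        Matrix.smul_mul, 𝒢.proj_mul, if_pos rfl, 𝒢.proj_mul, if_pos rfl]
    rw [this, one_smul, conjMap_apply, conjMap_apply, Matrix.conjTranspose_mul]
    simp only [Matrix.mul_assoc]
  · intro o' _ ho
    obtain ⟨j, hj⟩ := Function.ne_iff.1 ho
    have : (piKronPair (fun j => 𝒢.proj (o' j)) * piKronPair (fun j => 𝒢.received (o j)) *
        (piKronPair fun j => 𝒢.proj (o' j)).conjTranspose).trace = 0 := by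
      rw [piKronPair_conjTranspose, piKronPair_mul, piKronPair_mul, piKronPair_trace]
      refine Finset.prod_eq_zero (Finset.mem_univ j) ?_
      rw [received, Matrix.mul_smul, 𝒢.proj_mul, if_neg hj]
      simp
    rw [this, zero_smul]
  · simp

/-- The joint law of the key and the delivered bits. -/
def law (μ : Key × (J → ZMod 2) → ℝ) (b : ℝ) (k : Key) (o : J → ZMod 2) : ℝ :=
  ∑ τ, μ (k, τ) * ∏ j, (1 + sgn (τ j) * sgn (o j) * b) / 2

variable {μ : Key × (J → ZMod 2) → ℝ} (hμ : ∀ r, 0 ≤ μ r) (hμ' : ∑ r, μ r = 1)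

theorem sum_weight :
    ∑ r : (Key × (J → ZMod 2)) × (J → G), μ r.1 * ∏ j, 𝒢.weight (r.2 j) = ∑ r, μ r := by
  rw [Fintype.sum_prod_type]
  refine Finset.sum_congr rfl fun r _ => ?_
  simp only [← Finset.mul_sum]
  have := Finset.prod_univ_sum (fun _ : J => Finset.univ) (fun _ g => 𝒢.weight g)
  rw [Fintype.piFinset_univ] at this
  rw [← this]
  simp [𝒢.weight_sum]

theorem sum_conjTranspose_piKron {M N κ : Type} [Fintype M] [Fintype N] [DecidableEq N]
    [Fintype κ] {F : J → κ → Matrix M N ℂ}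
    (h : ∀ j, ∑ k, (F j k).conjTranspose * F j k = 1) :
    ∑ k : J → κ, (piKron fun j => F j (k j)).conjTranspose * piKron (fun j => F j (k j)) = 1 := by
  simp only [piKron_conjTranspose, piKron_mul]
  rw [← piKron_sum (fun j k => (F j k).conjTranspose * F j k)]
  simp only [h, piKron_one]

theorem sum_alice_piKron (x : X) (g : J → G) :
    ∑ k : J → κ, (piKron fun j => 𝒢.alice x (g j) (k j)).conjTranspose *
      piKron (fun j => 𝒢.alice x (g j) (k j)) = 1 :=
  sum_conjTranspose_piKron (F := fun j => 𝒢.alice x (g j)) fun _ => 𝒢.alice_complete _ _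

theorem sum_bob_piKron (y : Y) (τ : J → ZMod 2) (g : J → G) :
    ∑ k : J → ι, (piKron fun j => 𝒢.bob y (τ j) (g j) (k j)).conjTranspose *
      piKron (fun j => 𝒢.bob y (τ j) (g j) (k j)) = 1 :=
  sum_conjTranspose_piKron (F := fun j => 𝒢.bob y (τ j) (g j)) fun _ => 𝒢.bob_complete _ _ _

/-- The protocol that runs one gadget for each `j : J` and pads the secret. The key and the bits
fed into the gadgets have joint law `μ`. -/
def protocol [DecidableEq G] : Protocol X Y (Fin 2) (((Key × (J → ZMod 2)) × (J → G)) × (J → L))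
    (((Key × (J → ZMod 2)) × (J → G)) × (J → R)) (Fin 2 × (J → A)) (J → B) :=
  randomizedProtocol (Ω := (Key × (J → ZMod 2)) × (J → G)) (κ := J → κ) (ι := J → ι)
    (A := J → A) (B := J → B)
    (μ := fun r => μ r.1 * ∏ j, 𝒢.weight (r.2 j))
    (fun _ => mul_nonneg (hμ _) (Finset.prod_nonneg fun _ _ => 𝒢.weight_nonneg _))
    (𝒢.sum_weight.trans hμ')
    (Ψ := piKronPair fun _ => 𝒢.state)
    (isDensity_piKronPair fun _ => 𝒢.state_isDensity)
    (U := fun r => pad r.1.1) (fun _ => conjTranspose_pad_mul_pad _)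
    (F := fun x r k => piKron fun j => 𝒢.alice x (r.2 j) (k j))
    (fun x r => 𝒢.sum_alice_piKron x r.2)
    (G := fun y r k => piKron fun j => 𝒢.bob y (r.1.2 j) (r.2 j) (k j))
    (fun y r => 𝒢.sum_bob_piKron y r.1.2 r.2)

/-- Tensor power of `output_eq`: the gadgets act independently once the bits τ fed into them are
fixed. -/
theorem piKronPair_output (x : X) (y : Y) (τ : J → ZMod 2) :
    ∑ g : J → G, ∑ k : J → κ, ∑ l : J → ι, ((∏ j, 𝒢.weight (g j) : ℝ) : ℂ) •
      piKronPair (fun j => (𝒢.alice x (g j) (k j) ⊗ₖ 𝒢.bob y (τ j) (g j) (l j)) * 𝒢.state *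
        (𝒢.alice x (g j) (k j) ⊗ₖ 𝒢.bob y (τ j) (g j) (l j)).conjTranspose) =
      ∑ o : J → ZMod 2, ((∏ j, (1 + sgn (τ j) * sgn (o j) * 𝒢.bias x y) / 2 : ℝ) : ℂ) •
        piKronPair fun j => 𝒢.received (o j) := by
  have h := congrArg piKronPair (funext fun j : J => 𝒢.output_eq x y (τ j))
  rw [piKronPair_sum, piKronPair_sum] at h
  simp only [piKronPair_sum, piKronPair_smul] at h
  simp only [received, piKronPair_smul]
  push_cast at h ⊢
  exact h

/-- The whole protocol is a classical mixture of channels that depend neither on x nor on y; the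
inputs enter only through the bias in the law. Correctness and security thus become statements about
a probability distribution. -/
theorem protocol_encoding [DecidableEq G] (x : X) (y : Y) :
    (𝒢.protocol hμ hμ').encoding x y =
      ∑ p : Key × (J → ZMod 2), (law μ (𝒢.bias x y) p.1 p.2 : ℂ) • 𝒢.message p.1 p.2 := by
  rw [protocol, randomizedProtocol_encoding, Fintype.sum_prod_type, Fintype.sum_prod_type,
    Fintype.sum_prod_type]
  refine Finset.sum_congr rfl fun k _ => ?_
  simp only [piKron_kronecker_conj, law]
  have key : ∀ τ : J → ZMod 2, ∑ g : J → G, ∑ a : J → κ, ∑ l : J → ι,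
      ((μ (k, τ) * ∏ j, 𝒢.weight (g j) : ℝ) : ℂ) •
      piKronPair (fun j => (𝒢.alice x (g j) (a j) ⊗ₖ 𝒢.bob y (τ j) (g j) (l j)) * 𝒢.state *
        (𝒢.alice x (g j) (a j) ⊗ₖ 𝒢.bob y (τ j) (g j) (l j)).conjTranspose) =
      ∑ o : J → ZMod 2, ((μ (k, τ) * ∏ j, (1 + sgn (τ j) * sgn (o j) * 𝒢.bias x y) / 2 : ℝ) : ℂ) •
        piKronPair fun j => 𝒢.received (o j) := fun τ => by
    have := congrArg ((μ (k, τ) : ℂ) • ·) (𝒢.piKronPair_output x y τ)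
    simp only [Finset.smul_sum, smul_smul, ← Complex.ofReal_mul] at this
    exact this
  have step : ∀ τ : J → ZMod 2, ∑ g : J → G, (appendState (∑ a : J → κ, ∑ l : J → ι,
      ((μ (k, τ) * ∏ j, 𝒢.weight (g j) : ℝ) : ℂ) •
      piKronPair (fun j => (𝒢.alice x (g j) (a j) ⊗ₖ 𝒢.bob y (τ j) (g j) (l j)) * 𝒢.state *
        (𝒢.alice x (g j) (a j) ⊗ₖ 𝒢.bob y (τ j) (g j) (l j)).conjTranspose))).comp
          (conjMap (pad k)) =
      ∑ o : J → ZMod 2, ((μ (k, τ) * ∏ j, (1 + sgn (τ j) * sgn (o j) * 𝒢.bias x y) / 2 : ℝ) : ℂ) •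
        𝒢.message k o := fun τ => by
    rw [← SuperOp.sum_comp, ← appendState_sum, key, appendState_sum, SuperOp.sum_comp]
    simp only [appendState_smul, LinearMap.smul_comp, message]
  refine (Finset.sum_congr rfl fun τ _ => step τ).trans ?_
  rw [Finset.sum_comm]
  refine Finset.sum_congr rfl fun o _ => ?_
  rw [← Finset.sum_smul]
  push_cast
  rfl

theorem sum_sgn_mul (f : ZMod 2 → ℝ → ℝ) :
    ∑ o : ZMod 2, f o (sgn o) = f 0 1 + f 1 (-1) := by
  have hu : (Finset.univ : Finset (ZMod 2)) = {0, 1} := rfl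
  rw [hu, Finset.sum_pair zero_ne_one]
  simp [sgn]

theorem sum_law {μ : Key × (J → ZMod 2) → ℝ} (h : ∑ r, μ r = 1) (b : ℝ) :
    ∑ p : Key × (J → ZMod 2), law μ b p.1 p.2 = 1 := by
  rw [← h, Fintype.sum_prod_type, Fintype.sum_prod_type]
  refine Finset.sum_congr rfl fun k _ => ?_
  simp only [law]
  rw [Finset.sum_comm]
  refine Finset.sum_congr rfl fun τ _ => ?_
  rw [← Finset.mul_sum]
  have := Finset.prod_univ_sum (fun _ : J => Finset.univ)
    (fun j (o : ZMod 2) => (1 + sgn (τ j) * sgn o * b) / 2)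
  rw [Fintype.piFinset_univ] at this
  rw [← this, Finset.prod_eq_one, mul_one]
  intro j _
  rw [sum_sgn_mul fun _ s => (1 + sgn (τ j) * s * b) / 2]
  ring

/-- Correctly guessed keys contribute the identity and cancel. Each wrong guess leaves a wrong Pauli
and a missing identity of the same weight, whence the factor 2. -/
theorem diamondDist_decoder [DecidableEq G] (guess : (J → ZMod 2) → Key) (x : X) (y : Y) :
    diamondDist ((𝒢.decoder guess).comp ((𝒢.protocol hμ hμ').encoding x y)) LinearMap.id ≤
      ENNReal.ofReal (2 * ∑ p : Key × (J → ZMod 2),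
        if guess p.2 = p.1 then 0 else |law μ (𝒢.bias x y) p.1 p.2|) := by
  set w : Key × (J → ZMod 2) → ℝ := fun p =>
    if guess p.2 = p.1 then 0 else law μ (𝒢.bias x y) p.1 p.2 with hw
  have hE : ∀ p : (Key × (J → ZMod 2)) × Bool, IsChannel (if p.2 then
      conjMap ((pad (guess p.1.2)).conjTranspose * pad p.1.1) else LinearMap.id) := by
    intro p
    split_ifs
    · refine isChannel_conjMap ?_
      rw [Matrix.conjTranspose_mul, Matrix.conjTranspose_conjTranspose, Matrix.mul_assoc,
        ← Matrix.mul_assoc (pad _), pad_mul_conjTranspose_pad, Matrix.one_mul,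
        conjTranspose_pad_mul_pad]
    · rw [id_eq_krausMap]
      exact isChannel_krausMap (by simp)
  have h : (𝒢.decoder guess).comp ((𝒢.protocol hμ hμ').encoding x y) - LinearMap.id =
      ∑ p : (Key × (J → ZMod 2)) × Bool, ((if p.2 then w p.1 else -w p.1 : ℝ) : ℂ) • (if p.2 then
      conjMap ((pad (guess p.1.2)).conjTranspose * pad p.1.1) else LinearMap.id) := by
    have hid : (LinearMap.id : SuperOp (Fin 2) (Fin 2)) =
        ∑ p : Key × (J → ZMod 2), (law μ (𝒢.bias x y) p.1 p.2 : ℂ) • LinearMap.id := by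
      rw [← Finset.sum_smul, ← Complex.ofReal_sum, sum_law hμ', Complex.ofReal_one, one_smul]
    rw [protocol_encoding, SuperOp.comp_sum]
    conv_lhs => rw [hid]
    conv_rhs => rw [Fintype.sum_prod_type]
    rw [← Finset.sum_sub_distrib]
    refine Finset.sum_congr rfl fun p _ => ?_
    rw [LinearMap.comp_smul, decoder_comp_message, Fintype.sum_bool]
    by_cases hp : guess p.2 = p.1
    · have : conjMap ((pad (guess p.2)).conjTranspose * pad p.1) = LinearMap.id := by
        rw [hp, conjTranspose_pad_mul_pad, id_eq_krausMap]; rfl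
      rw [this]
      refine LinearMap.ext fun ρ => ?_
      simp [hw, hp]
    · refine LinearMap.ext fun ρ => ?_
      simp [hw, hp, sub_eq_add_neg]
  refine (diamondDist_le_of_sub_eq_sum hE h).trans (le_of_eq ?_)
  congr 1
  rw [Fintype.sum_prod_type, Finset.mul_sum]
  refine Finset.sum_congr rfl fun p _ => ?_
  rw [Fintype.sum_bool, two_mul]
  by_cases hp : guess p.2 = p.1 <;> simp [hw, hp]

theorem sum_message (o : J → ZMod 2) (ρ : Matrix (Fin 2) (Fin 2) ℂ) :
    ∑ k, 𝒢.message k o ρ =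
      ρ.trace • appendState (piKronPair fun j => 𝒢.received (o j)) ((2 : ℂ) • 1) := by
  simp only [message, LinearMap.comp_apply, conjMap_apply]
  rw [← map_sum, sum_pad_conj, ← map_smul, smul_smul, mul_comm]

/-- The simulator sends the message with the law replaced by the uniform one. There the key is
independent of the bits, so `sum_message` removes all dependence on the secret, and the error is the
ℓ¹ distance between the two laws. -/
theorem exists_diamondDist_encoding [DecidableEq G] (x : X) (y : Y) :
    ∃ σ, IsDensity σ ∧ diamondDist (discardPrepare (Fin 2) σ) ((𝒢.protocol hμ hμ').encoding x y) ≤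
      ENNReal.ofReal (∑ p : Key × (J → ZMod 2),
        |(Fintype.card (Key × (J → ZMod 2)) : ℝ)⁻¹ - law μ (𝒢.bias x y) p.1 p.2|) := by
  set c : ℝ := (Fintype.card (Key × (J → ZMod 2)) : ℝ)⁻¹ with hc
  have hc0 : 0 ≤ c := by positivity
  -- Any fixed state would do as a dummy secret, since the uniform mixture depends on its input only
  -- through the trace.
  set ρ₀ : Matrix (Fin 2) (Fin 2) ℂ := Matrix.single 0 0 1 with hρ
  have hρ1 : ρ₀.trace = 1 := by simp [hρ, Matrix.trace]
  have hρ0 : ρ₀.PosSemidef := by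
    have : ρ₀ = ρ₀.conjTranspose * ρ₀ := by simp [hρ]
    rw [this]
    exact Matrix.posSemidef_conjTranspose_mul_self _
  have hsum : ∀ ρ : Matrix (Fin 2) (Fin 2) ℂ,
      ∑ p : Key × (J → ZMod 2), (c : ℂ) • 𝒢.message p.1 p.2 ρ =
        ρ.trace • ∑ p : Key × (J → ZMod 2), (c : ℂ) • 𝒢.message p.1 p.2 ρ₀ := by
    intro ρ
    rw [Fintype.sum_prod_type_right, Fintype.sum_prod_type_right, Finset.smul_sum]
    refine Finset.sum_congr rfl fun o _ => ?_
    rw [← Finset.smul_sum, ← Finset.smul_sum, sum_message, sum_message, hρ1, one_smul, smul_comm]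
  refine ⟨∑ p : Key × (J → ZMod 2), (c : ℂ) • 𝒢.message p.1 p.2 ρ₀, ⟨?_, ?_⟩, ?_⟩
  · refine Matrix.posSemidef_sum _ fun p _ => Matrix.PosSemidef.smul ?_ (by exact_mod_cast hc0)
    rw [message, LinearMap.comp_apply, conjMap_apply]
    exact ((hρ0.mul_mul_conjTranspose_same _).kronecker
      (isDensity_piKronPair fun j => 𝒢.isDensity_received (p.2 j)).1).submatrix _
  · simp only [Matrix.trace_sum, Matrix.trace_smul, (𝒢.isChannel_message _ _).2, hρ1]
    rw [Finset.sum_const, Finset.card_univ, smul_eq_mul, mul_one, nsmul_eq_mul, hc,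
      Complex.ofReal_inv, Complex.ofReal_natCast, mul_inv_cancel₀]
    exact_mod_cast Fintype.card_ne_zero
  · refine diamondDist_le_of_sub_eq_sum
      (fun p : Key × (J → ZMod 2) => 𝒢.isChannel_message p.1 p.2) ?_
    rw [protocol_encoding]
    refine LinearMap.ext fun ρ => ?_
    simp only [LinearMap.sub_apply, LinearMap.sum_apply, LinearMap.smul_apply, Complex.ofReal_sub,
      sub_smul, Finset.sum_sub_distrib]
    rw [hsum ρ]
    rfl

end Gadget

end Compose

/-! ### The law of the delivered bits -/

theorem sgn_mul_self (a : ZMod 2) : sgn a * sgn a = 1 := by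
  unfold sgn; split_ifs <;> norm_num

theorem sgn_eq_or (a : ZMod 2) : sgn a = 1 ∨ sgn a = -1 := by
  unfold sgn; split_ifs <;> simp

section Law

variable {C : Type} {d K : ℕ}

/-- The sign of the parity of the bits in block `c`. -/
def parity (o : C × Fin d → ZMod 2) (c : C) : ℝ := ∏ e, sgn (o (c, e))

theorem parity_mul_self (o : C × Fin d → ZMod 2) (c : C) : parity o c * parity o c = 1 := by
  rw [parity, ← Finset.prod_mul_distrib]
  exact Finset.prod_eq_one fun e _ => sgn_mul_self _

theorem parity_eq_or (o : C × Fin d → ZMod 2) (c : C) : parity o c = 1 ∨ parity o c = -1 :=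
  mul_self_eq_one_iff.1 (parity_mul_self o c)

theorem sum_prod_blocks [Fintype C] [DecidableEq C] (g : C → (Fin d → ZMod 2) → ℝ) :
    ∑ o : C × Fin d → ZMod 2, ∏ c, g c (fun e => o (c, e)) = ∏ c, ∑ v, g c v := by
  rw [Finset.prod_univ_sum, Fintype.piFinset_univ]
  exact Fintype.sum_equiv (Equiv.curry C (Fin d) (ZMod 2)) _ _ fun o => rfl

theorem sum_prod_bits (g : Fin d → ZMod 2 → ℝ) :
    ∑ v : Fin d → ZMod 2, ∏ e, g e (v e) = ∏ e, (g e 0 + g e 1) := by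
  have hu : (Finset.univ : Finset (ZMod 2)) = {0, 1} := rfl
  have := Finset.prod_univ_sum (fun _ : Fin d => Finset.univ) g
  rw [Fintype.piFinset_univ] at this
  rw [← this]
  refine Finset.prod_congr rfl fun e _ => ?_
  rw [hu, Finset.sum_pair zero_ne_one]

/-- Blocks are independent, and in a nonempty block even and odd strings are equally many, so the
parity term sums to zero. For d = 0 the parity would be constantly 1. -/
theorem sum_prod_parity [Fintype C] [DecidableEq C] (hd : 0 < d) (a b : C → ℝ) :
    ∑ o : C × Fin d → ZMod 2, ∏ c, (a c + b c * parity o c) = ∏ c, (2 ^ d * a c) := by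
  refine (sum_prod_blocks fun c v => a c + b c * ∏ e, sgn (v e)).trans ?_
  refine Finset.prod_congr rfl fun c _ => ?_
  rw [Finset.sum_add_distrib, ← Finset.mul_sum, sum_prod_bits fun _ => sgn]
  have : sgn 0 + sgn 1 = 0 := by simp [sgn]
  rw [this, Finset.prod_const, Finset.card_univ, Fintype.card_fin, zero_pow hd.ne', mul_zero,
    add_zero, Finset.sum_const, Finset.card_univ, Fintype.card_fun, Fintype.card_fin, ZMod.card,
    nsmul_eq_mul]
  push_cast
  rfl

/-- The joint law of the key and the bits fed into the gadgets: the bits in block `c` are uniform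
with parity the key bit `k c.1`. -/
def blockLaw (d K : ℕ) (p : Key × ((ZMod 2 × Fin K) × Fin d → ZMod 2)) : ℝ :=
  4⁻¹ * ∏ c, ((1 + sgn (p.1 c.1) * parity p.2 c) / 2 ^ d)

theorem card_key : Fintype.card Key = 4 := by
  simp [ZMod.card]

theorem blockLaw_nonneg (p : Key × ((ZMod 2 × Fin K) × Fin d → ZMod 2)) : 0 ≤ blockLaw d K p := by
  refine mul_nonneg (by norm_num) (Finset.prod_nonneg fun c _ => div_nonneg ?_ (by positivity))
  rcases sgn_eq_or (p.1 c.1) with h | h <;> rcases parity_eq_or p.2 c with h' | h' <;>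
    rw [h, h'] <;> norm_num

theorem sum_blockLaw (hd : 0 < d) : ∑ p, blockLaw d K p = 1 := by
  rw [Fintype.sum_prod_type]
  have : ∀ k : Key, ∑ τ, blockLaw d K (k, τ) = 4⁻¹ := fun k => by
    simp only [blockLaw]
    rw [← Finset.mul_sum]
    have h := sum_prod_parity (C := ZMod 2 × Fin K) hd (fun _ => 1 / 2 ^ d)
      (fun c => sgn (k c.1) / 2 ^ d)
    rw [Finset.prod_eq_one fun c _ => by field_simp] at h
    have h' : ∑ τ : (ZMod 2 × Fin K) × Fin d → ZMod 2,
        ∏ c, ((1 + sgn (k c.1) * parity τ c) / 2 ^ d) = 1 := by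
      refine Eq.trans (Finset.sum_congr rfl fun o _ => Finset.prod_congr rfl fun c _ => ?_) h
      rw [add_div, mul_div_right_comm]
    rw [h', mul_one]
  simp only [this]
  rw [Finset.sum_const, Finset.card_univ, card_key, nsmul_eq_mul]
  norm_num

/-- A binary channel of bias b multiplies the sign character of its bit by b. The parity of a block
is the product of d such characters, so the channel multiplies it by b^d, while the constant part is
preserved. -/
theorem law_blockLaw (b : ℝ) (k : Key) (o : (ZMod 2 × Fin K) × Fin d → ZMod 2) :
    Gadget.law (blockLaw d K) b k o =
      4⁻¹ * ∏ c, ((1 + sgn (k c.1) * b ^ d * parity o c) / 2 ^ d) := by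
  simp only [Gadget.law, blockLaw, mul_assoc (4⁻¹ : ℝ)]
  rw [← Finset.mul_sum]
  congr 1
  have h1 : ∀ τ : (ZMod 2 × Fin K) × Fin d → ZMod 2,
      (∏ c, ((1 + sgn (k c.1) * parity τ c) / 2 ^ d)) *
        ∏ j, (1 + sgn (τ j) * sgn (o j) * b) / 2 =
      ∏ c, (((1 + sgn (k c.1) * ∏ e, sgn (τ (c, e))) / 2 ^ d) *
        ∏ e, (1 + sgn (τ (c, e)) * sgn (o (c, e)) * b) / 2) := fun τ => by
    rw [Fintype.prod_prod_type (f := fun j => (1 + sgn (τ j) * sgn (o j) * b) / 2),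
      ← Finset.prod_mul_distrib]
    rfl
  simp only [h1]
  refine (sum_prod_blocks fun c v => ((1 + sgn (k c.1) * ∏ e, sgn (v e)) / 2 ^ d) *
        ∏ e, (1 + sgn (v e) * sgn (o (c, e)) * b) / 2).trans ?_
  refine Finset.prod_congr rfl fun c _ => ?_
  -- The block law is split into its constant and its parity part; each is then a product over
  -- single bits and can be summed bit by bit.
  have h2 : ∀ v : Fin d → ZMod 2, ((1 + sgn (k c.1) * ∏ e, sgn (v e)) / 2 ^ d) *
        ∏ e, (1 + sgn (v e) * sgn (o (c, e)) * b) / 2 =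
      (2 ^ d)⁻¹ * ∏ e, (1 + sgn (v e) * sgn (o (c, e)) * b) / 2 +
        (2 ^ d)⁻¹ * sgn (k c.1) * ∏ e, sgn (v e) * ((1 + sgn (v e) * sgn (o (c, e)) * b) / 2) :=
    fun v => by
    rw [Finset.prod_mul_distrib]
    ring
  simp only [h2]
  rw [Finset.sum_add_distrib, ← Finset.mul_sum, ← Finset.mul_sum,
    sum_prod_bits fun e t => (1 + sgn t * sgn (o (c, e)) * b) / 2,
    sum_prod_bits fun e t => sgn t * ((1 + sgn t * sgn (o (c, e)) * b) / 2)]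
  have h0 : sgn 0 = 1 := by simp [sgn]
  have h1 : sgn 1 = -1 := by simp [sgn]
  simp only [h0, h1]
  rw [Finset.prod_eq_one fun e _ => by ring, Finset.prod_congr rfl fun e _ =>
    show 1 * ((1 + 1 * sgn (o (c, e)) * b) / 2) + -1 * ((1 + -1 * sgn (o (c, e)) * b) / 2) =
      sgn (o (c, e)) * b by ring, Finset.prod_mul_distrib, Finset.prod_const, Finset.card_univ,
    Fintype.card_fin]
  rw [parity]
  ring

theorem card_blocks : Fintype.card (Key × ((ZMod 2 × Fin K) × Fin d → ZMod 2)) =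
    4 * (2 ^ d) ^ (2 * K) := by
  rw [Fintype.card_prod, card_key]
  simp only [Fintype.card_prod, Fintype.card_fun, ZMod.card, Fintype.card_fin]
  rw [← pow_mul, mul_comm d]

/-- For each key, the density f relative to the uniform law is a product over the 2K blocks of 1 ±
b^d·parity. It has mean 1 and second moment (1 + b^(2d))^(2K), so Cauchy–Schwarz bounds the ℓ¹
distance by the square root of the variance. -/
theorem sum_abs_uniform_sub_law_le (hd : 0 < d) (b : ℝ) :
    ∑ p : Key × ((ZMod 2 × Fin K) × Fin d → ZMod 2),
      |(Fintype.card (Key × ((ZMod 2 × Fin K) × Fin d → ZMod 2)) : ℝ)⁻¹ -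
        Gadget.law (blockLaw d K) b p.1 p.2| ≤ √((1 + (b ^ d) ^ 2) ^ (2 * K) - 1) := by
  set N : ℝ := (2 ^ d) ^ (2 * K) with hN
  have hN0 : 0 < N := by positivity
  have hNc : (Fintype.card ((ZMod 2 × Fin K) × Fin d → ZMod 2) : ℝ) = N := by
    simp only [Fintype.card_prod, Fintype.card_fun, ZMod.card, Fintype.card_fin, hN]
    push_cast
    rw [← pow_mul, mul_comm d]
  have hC : Fintype.card (ZMod 2 × Fin K) = 2 * K := by simp [ZMod.card]
  rw [Fintype.sum_prod_type]
  have key : ∀ k : Key, ∑ o, |(Fintype.card (Key × ((ZMod 2 × Fin K) × Fin d → ZMod 2)) : ℝ)⁻¹ -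
        Gadget.law (blockLaw d K) b k o| ≤ 4⁻¹ * √((1 + (b ^ d) ^ 2) ^ (2 * K) - 1) := by
    intro k
    set f : ((ZMod 2 × Fin K) × Fin d → ZMod 2) → ℝ := fun o =>
      ∏ c, (1 + sgn (k c.1) * b ^ d * parity o c) with hf
    have h1 : ∀ o, |(Fintype.card (Key × ((ZMod 2 × Fin K) × Fin d → ZMod 2)) : ℝ)⁻¹ -
        Gadget.law (blockLaw d K) b k o| = 4⁻¹ * (N⁻¹ * |f o - 1|) := fun o => by
      rw [law_blockLaw, card_blocks, Finset.prod_div_distrib, Finset.prod_const, Finset.card_univ,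
        hC, ← hN, abs_sub_comm (f o) 1]
      push_cast
      have e : (4 * N)⁻¹ - 4⁻¹ * ((∏ c, (1 + sgn (k c.1) * b ^ d * parity o c)) / N) =
          4⁻¹ * N⁻¹ * (1 - f o) := by
        simp only [hf]
        rw [mul_inv]
        ring
      rw [← hN, e, abs_mul, abs_of_pos (by positivity), mul_assoc]
    simp only [h1]
    rw [← Finset.mul_sum, ← Finset.mul_sum]
    refine mul_le_mul_of_nonneg_left ?_ (by norm_num)
    refine Real.le_sqrt_of_sq_le ?_
    have hs1 : ∑ o, f o = N := by
      have h := sum_prod_parity (C := ZMod 2 × Fin K) hd (fun _ => 1) (fun c => sgn (k c.1) * b ^ d)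
      rw [Finset.prod_const, Finset.card_univ, hC, mul_one] at h
      exact h
    have hs2 : ∑ o, f o ^ 2 = N * (1 + (b ^ d) ^ 2) ^ (2 * K) := by
      have h := sum_prod_parity (C := ZMod 2 × Fin K) hd (fun _ => 1 + (b ^ d) ^ 2)
        (fun c => 2 * (sgn (k c.1) * b ^ d))
      rw [Finset.prod_const, Finset.card_univ, hC, mul_pow] at h
      rw [hN, ← h]
      refine Finset.sum_congr rfl fun o _ => ?_
      simp only [hf]
      rw [← Finset.prod_pow]
      refine Finset.prod_congr rfl fun c _ => ?_
      linear_combination (b ^ d) ^ 2 * parity o c * parity o c * sgn_mul_self (k c.1) +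
        (b ^ d) ^ 2 * parity_mul_self o c
    have hcs := sq_sum_le_card_mul_sum_sq (s := (Finset.univ :
      Finset ((ZMod 2 × Fin K) × Fin d → ZMod 2))) (f := fun o => |f o - 1|)
    rw [Finset.card_univ, hNc] at hcs
    have hs3 : ∑ o, |f o - 1| ^ 2 = N * ((1 + (b ^ d) ^ 2) ^ (2 * K) - 1) := by
      have : ∀ o, |f o - 1| ^ 2 = f o ^ 2 - 2 * f o + 1 := fun o => by rw [sq_abs]; ring
      simp only [this]
      rw [Finset.sum_add_distrib, Finset.sum_sub_distrib, ← Finset.mul_sum, hs1, hs2,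
        Finset.sum_const, Finset.card_univ, nsmul_eq_mul, hNc]
      ring
    rw [hs3] at hcs
    rw [mul_pow, inv_pow, inv_mul_le_iff₀ (by positivity)]
    refine hcs.trans (le_of_eq ?_)
    ring
  refine (Finset.sum_le_sum fun k _ => key k).trans (le_of_eq ?_)
  rw [Finset.sum_const, Finset.card_univ, card_key, nsmul_eq_mul]
  push_cast
  ring

/-- The key the referee reads off the bits: the majority over the blocks of each key bit. -/
def majority (o : (ZMod 2 × Fin K) × Fin d → ZMod 2) : Key := fun i =>
  if 0 < ∑ c : Fin K, parity o (i, c) then 0 else 1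

/-- A tie is decoded as 1 and may be an error, hence the weak inequality. -/
theorem exists_of_majority_ne {o : (ZMod 2 × Fin K) × Fin d → ZMod 2} {k : Key}
    (h : majority o ≠ k) : ∃ i, sgn (k i) * ∑ c : Fin K, parity o (i, c) ≤ 0 := by
  obtain ⟨i, hi⟩ := Function.ne_iff.1 h
  refine ⟨i, ?_⟩
  unfold majority at hi
  split_ifs at hi with hp
  · rw [sgn, if_neg (Ne.symm hi)]
    linarith
  · push Not at hp
    have : k i = 0 := by
      generalize k i = a at hi
      revert hi; revert a; decide
    rw [sgn, if_pos this]
    linarith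

theorem exp_neg_mul_sign (l : ℝ) {s : ℝ} (hs : s = 1 ∨ s = -1) :
    Real.exp (-(l * s)) = Real.cosh l - Real.sinh l * s := by
  rcases hs with rfl | rfl
  · rw [mul_one, mul_one, Real.cosh_sub_sinh]
  · rw [mul_neg_one, neg_neg, mul_neg_one, sub_neg_eq_add, Real.cosh_add_sinh]

/-- Chernoff bound: the indicator of a wrong majority is at most the sum over the two key bits of
exp(-l · signed vote). The votes are independent across blocks, so each expectation is the K-th
power of that of one block; the factor 2 is the union bound. -/
theorem sum_wrong_law_le (hd : 0 < d) {b : ℝ} (hb : |b| ≤ 1) {l : ℝ} (hl : 0 ≤ l) :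
    (∑ p : Key × ((ZMod 2 × Fin K) × Fin d → ZMod 2),
      if majority p.2 = p.1 then 0 else |Gadget.law (blockLaw d K) b p.1 p.2|) ≤
      2 * (Real.cosh l - Real.sinh l * b ^ d) ^ K := by
  have hbd : |b ^ d| ≤ 1 := by rw [abs_pow]; exact pow_le_one₀ (abs_nonneg _) hb
  have hlaw : ∀ k (o : (ZMod 2 × Fin K) × Fin d → ZMod 2), 0 ≤ Gadget.law (blockLaw d K) b k o := by
    intro k o
    rw [law_blockLaw]
    refine mul_nonneg (by norm_num) (Finset.prod_nonneg fun c _ => div_nonneg ?_ (by positivity))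
    have := abs_le.1 hbd
    rcases sgn_eq_or (k c.1) with h | h <;> rcases parity_eq_or o c with h' | h' <;>
      rw [h, h'] <;> linarith
  have hpt : ∀ p : Key × ((ZMod 2 × Fin K) × Fin d → ZMod 2),
      (if majority p.2 = p.1 then 0 else |Gadget.law (blockLaw d K) b p.1 p.2|) ≤
      ∑ i : ZMod 2, Gadget.law (blockLaw d K) b p.1 p.2 *
        ∏ c : Fin K, (Real.cosh l - Real.sinh l * (sgn (p.1 i) * parity p.2 (i, c))) := by
    rintro ⟨k, o⟩
    have hprod : ∀ i, ∏ c : Fin K, (Real.cosh l - Real.sinh l * (sgn (k i) * parity o (i, c))) =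
        Real.exp (-(l * (sgn (k i) * ∑ c : Fin K, parity o (i, c)))) := fun i => by
      rw [Finset.mul_sum, Finset.mul_sum, ← Finset.sum_neg_distrib, Real.exp_sum]
      refine Finset.prod_congr rfl fun c _ => ?_
      rw [exp_neg_mul_sign]
      rcases sgn_eq_or (k i) with h | h <;> rcases parity_eq_or o (i, c) with h' | h' <;>
        rw [h, h'] <;> norm_num
    simp only [hprod]
    have hnn : ∀ i ∈ (Finset.univ : Finset (ZMod 2)), 0 ≤ Gadget.law (blockLaw d K) b k o *
        Real.exp (-(l * (sgn (k i) * ∑ c : Fin K, parity o (i, c)))) := fun i _ =>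
      mul_nonneg (hlaw k o) (Real.exp_pos _).le
    split_ifs with hm
    · exact Finset.sum_nonneg hnn
    · obtain ⟨i, hi⟩ := exists_of_majority_ne hm
      rw [abs_of_nonneg (hlaw k o)]
      refine le_trans ?_ (Finset.single_le_sum hnn (Finset.mem_univ i))
      refine le_mul_of_one_le_right (hlaw k o) (Real.one_le_exp ?_)
      have := mul_nonpos_of_nonneg_of_nonpos hl hi
      linarith
  refine (Finset.sum_le_sum fun p _ => hpt p).trans ?_
  rw [Finset.sum_comm]
  have hblock : ∀ i : ZMod 2, ∑ p : Key × ((ZMod 2 × Fin K) × Fin d → ZMod 2),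
      Gadget.law (blockLaw d K) b p.1 p.2 *
        ∏ c : Fin K, (Real.cosh l - Real.sinh l * (sgn (p.1 i) * parity p.2 (i, c))) =
      (Real.cosh l - Real.sinh l * b ^ d) ^ K := by
    intro i
    rw [Fintype.sum_prod_type]
    have hk : ∀ k : Key, ∑ o : (ZMod 2 × Fin K) × Fin d → ZMod 2,
        Gadget.law (blockLaw d K) b k o *
          ∏ c : Fin K, (Real.cosh l - Real.sinh l * (sgn (k i) * parity o (i, c))) =
        4⁻¹ * (Real.cosh l - Real.sinh l * b ^ d) ^ K := by
      intro k
      -- With s = sgn·parity and s² = 1, the product (1 + b^d s)(cosh l - sinh l · s) equals (cosh l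
      -- - sinh l · b^d) + (b^d cosh l - sinh l) s. Blocks of the other key bit keep the factor 1 +
      -- b^d s.
      have h := sum_prod_parity (C := ZMod 2 × Fin K) hd
        (fun c => (2 ^ d)⁻¹ * if c.1 = i then Real.cosh l - Real.sinh l * b ^ d else 1)
        (fun c => (2 ^ d)⁻¹ * (sgn (k c.1) * if c.1 = i then Real.cosh l * b ^ d - Real.sinh l
          else b ^ d))
      have hr : ∏ c : ZMod 2 × Fin K, (2 ^ d * ((2 ^ d)⁻¹ * if c.1 = i then
          Real.cosh l - Real.sinh l * b ^ d else 1)) =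
          (Real.cosh l - Real.sinh l * b ^ d) ^ K := by
        rw [Fintype.prod_prod_type, Finset.prod_eq_single i]
        · simp
        · intro j _ hj
          simp [hj]
        · simp
      rw [hr] at h
      rw [← h, Finset.mul_sum]
      refine Finset.sum_congr rfl fun o _ => ?_
      rw [law_blockLaw, mul_assoc]
      congr 1
      have hext : ∏ c : Fin K, (Real.cosh l - Real.sinh l * (sgn (k i) * parity o (i, c))) =
          ∏ c : ZMod 2 × Fin K, if c.1 = i then
            (Real.cosh l - Real.sinh l * (sgn (k c.1) * parity o c)) else 1 := by
        rw [Fintype.prod_prod_type, Finset.prod_eq_single i]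
        · simp
        · intro j _ hj
          simp [hj]
        · simp
      rw [hext, ← Finset.prod_mul_distrib]
      refine Finset.prod_congr rfl fun c _ => ?_
      split_ifs
      · have hs : sgn (k c.1) * parity o c * (sgn (k c.1) * parity o c) = 1 := by
          linear_combination parity o c * parity o c * sgn_mul_self (k c.1) + parity_mul_self o c
        field_simp
        linear_combination (-(Real.sinh l * b ^ d)) * hs
      · field_simp
    simp only [hk]
    rw [Finset.sum_const, Finset.card_univ, card_key, nsmul_eq_mul]
    push_cast
    ring
  simp only [hblock]
  rw [Finset.sum_const, Finset.card_univ, ZMod.card, nsmul_eq_mul]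
  push_cast
  rfl

/-- With l = p/2: cosh l ≤ exp(p²/8) ≤ 1 + p²/8 + p⁴/64 and p·sinh l ≥ p²/2, so the difference is at
most 1 - p²/4. -/
theorem cosh_sub_sinh_mul_le {p : ℝ} (hp : 0 ≤ p) (hp1 : p ≤ 1) :
    Real.cosh (p / 2) - Real.sinh (p / 2) * p ≤ Real.exp (-(p ^ 2 / 4)) := by
  have h1 := Real.cosh_le_exp_half_sq (p / 2)
  have h2 : p / 2 ≤ Real.sinh (p / 2) := Real.self_le_sinh_iff.2 (by linarith)
  have hu : p ^ 2 ≤ 1 := pow_le_one₀ hp hp1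
  have hu0 : 0 ≤ p ^ 2 := sq_nonneg p
  have h3 := (abs_le.1 (Real.abs_exp_sub_one_sub_id_le (x := (p / 2) ^ 2 / 2)
    (by rw [abs_of_nonneg (by positivity)]; nlinarith))).2
  have h4 := Real.add_one_le_exp (-(p ^ 2 / 4))
  have h5 := mul_le_mul_of_nonneg_right h2 hp
  nlinarith

end Law

/-! ### Pauli operators and Hadamard gates -/

theorem sgn_zero : sgn 0 = 1 := by simp [sgn]

theorem sgn_one : sgn 1 = -1 := by simp [sgn]

theorem zmod_two_eq (a : ZMod 2) : a = 0 ∨ a = 1 := by revert a; decide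

theorem one_add_one_zmod_two : (1 : ZMod 2) + 1 = 0 := by decide

theorem sgn_add (a b : ZMod 2) : sgn (a + b) = sgn a * sgn b := by
  rcases zmod_two_eq a with rfl | rfl <;> rcases zmod_two_eq b with rfl | rfl <;>
    simp [sgn, one_add_one_zmod_two]

theorem sgn_sum {ι : Type} (s : Finset ι) (f : ι → ZMod 2) :
    sgn (∑ i ∈ s, f i) = ∏ i ∈ s, sgn (f i) := by
  classical
  induction s using Finset.induction_on with
  | empty => simp [sgn_zero]
  | insert a s ha ih => rw [Finset.sum_insert ha, Finset.prod_insert ha, sgn_add, ih]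

section Pauli

variable {m : ℕ}

/-- Basis states of `m + 1` qubits, the first of which is singled out. -/
abbrev Qubits (m : ℕ) : Type := ZMod 2 × (Fin m → ZMod 2)

theorem qubits_add_self (i : Qubits m) : i + i = 0 := by
  ext <;> simp [CharTwo.add_self_eq_zero]

/-- The dot product. -/
def dot (b j : Qubits m) : ZMod 2 := b.1 * j.1 + ∑ t, b.2 t * j.2 t

theorem dot_add_right (b i j : Qubits m) : dot b (i + j) = dot b i + dot b j := by
  simp only [dot, Prod.fst_add, Prod.snd_add, Pi.add_apply, mul_add, Finset.sum_add_distrib]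
  ring

theorem dot_add_left (b c j : Qubits m) : dot (b + c) j = dot b j + dot c j := by
  simp only [dot, Prod.fst_add, Prod.snd_add, Pi.add_apply, add_mul, Finset.sum_add_distrib]
  ring

/-- Labels of Pauli operators. -/
abbrev Label (m : ℕ) : Type := Qubits m × Qubits m

theorem label_add_self (l : Label m) : l + l = 0 := by
  ext1 <;> exact qubits_add_self _

/-- The Pauli operator `X^a Z^b` with label `(a, b)`. -/
def pauli (l : Label m) : Matrix (Qubits m) (Qubits m) ℂ :=
  Matrix.of fun i j => if i = j + l.1 then ((sgn (dot l.2 j) : ℝ) : ℂ) else 0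

theorem eq_add_iff (i j a : Qubits m) : i = j + a ↔ j = i + a := by
  constructor <;> rintro rfl <;> rw [add_assoc, qubits_add_self, add_zero]

theorem pauli_mul_apply (l : Label m) (M : Matrix (Qubits m) (Qubits m) ℂ) (i j : Qubits m) :
    (pauli l * M) i j = ((sgn (dot l.2 (i + l.1)) : ℝ) : ℂ) * M (i + l.1) j := by
  rw [Matrix.mul_apply, Finset.sum_eq_single (i + l.1)]
  · rw [pauli, Matrix.of_apply, if_pos]
    rw [add_assoc, qubits_add_self, add_zero]
  · intro k _ hk
    rw [pauli, Matrix.of_apply, if_neg, zero_mul]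
    rw [eq_add_iff]
    exact hk
  · simp

theorem mul_conjTranspose_pauli_apply (l : Label m) (M : Matrix (Qubits m) (Qubits m) ℂ)
    (i j : Qubits m) :
    (M * (pauli l).conjTranspose) i j = M i (j + l.1) * ((sgn (dot l.2 (j + l.1)) : ℝ) : ℂ) := by
  have h := pauli_mul_apply l M.conjTranspose j i
  have h2 : (M * (pauli l).conjTranspose) i j = star ((pauli l * M.conjTranspose) j i) := by
    rw [← Matrix.conjTranspose_apply, Matrix.conjTranspose_mul, Matrix.conjTranspose_conjTranspose]
  rw [h2, h, star_mul', Matrix.conjTranspose_apply, star_star, mul_comm]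
  congr 1
  exact Complex.conj_ofReal _

theorem pauli_conj_apply (l : Label m) (M : Matrix (Qubits m) (Qubits m) ℂ) (i j : Qubits m) :
    (pauli l * M * (pauli l).conjTranspose) i j =
      ((sgn (dot l.2 (i + j)) : ℝ) : ℂ) * M (i + l.1) (j + l.1) := by
  rw [mul_conjTranspose_pauli_apply, pauli_mul_apply]
  have : sgn (dot l.2 (i + j)) = sgn (dot l.2 (i + l.1)) * sgn (dot l.2 (j + l.1)) := by
    rw [← sgn_add, ← dot_add_right]
    congr 2
    rw [add_add_add_comm, qubits_add_self, add_zero]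
  rw [this]
  push_cast
  ring

theorem pauli_mul_conjTranspose_self (l : Label m) : pauli l * (pauli l).conjTranspose = 1 := by
  ext i j
  have := pauli_conj_apply l 1 i j
  rw [Matrix.mul_one] at this
  rw [this, Matrix.one_apply, Matrix.one_apply]
  by_cases h : i = j
  · subst h
    simp [qubits_add_self, dot, sgn_zero]
  · simp [h]

theorem conjTranspose_pauli_mul_self (l : Label m) : (pauli l).conjTranspose * pauli l = 1 :=
  mul_eq_one_comm.1 (pauli_mul_conjTranspose_self l)

/-- Paulis multiply up to a sign, and conjugation cancels the sign, so labels simply add. -/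
theorem pauli_mul_conj (k l : Label m) (M : Matrix (Qubits m) (Qubits m) ℂ) :
    pauli k * (pauli l * M * (pauli l).conjTranspose) * (pauli k).conjTranspose =
      pauli (k + l) * M * (pauli (k + l)).conjTranspose := by
  ext i j
  rw [pauli_conj_apply, pauli_conj_apply, pauli_conj_apply, Prod.snd_add, Prod.fst_add,
    dot_add_left, sgn_add, ← add_assoc, ← add_assoc]
  have : i + k.1 + (j + k.1) = i + j := by
    rw [add_add_add_comm, qubits_add_self, add_zero]
  rw [← add_assoc] at this
  rw [this]
  push_cast
  ring_nf

/-- The entries of the power `h` of the one-qubit Hadamard gate. -/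
def hadEntry (h i j : ZMod 2) : ℝ := if h = 0 then (if i = j then 1 else 0) else sgn (i * j) / √2

/-- The power `h` of the one-qubit Hadamard gate. -/
def hadPow (h : ZMod 2) : Matrix (ZMod 2) (ZMod 2) ℂ := Matrix.of fun i j => (hadEntry h i j : ℂ)

theorem hadEntry_symm (h i j : ZMod 2) : hadEntry h i j = hadEntry h j i := by
  simp only [hadEntry, eq_comm, mul_comm]

theorem sum_zmod_two {M : Type} [AddCommMonoid M] (f : ZMod 2 → M) : ∑ i, f i = f 0 + f 1 := by
  have hu : (Finset.univ : Finset (ZMod 2)) = {0, 1} := rfl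
  rw [hu, Finset.sum_pair zero_ne_one]

theorem sqrt_two_inv_mul_self : (√2)⁻¹ * (√2)⁻¹ = (1 / 2 : ℝ) := by
  rw [← mul_inv, Real.mul_self_sqrt (by norm_num), one_div]

theorem sum_hadEntry_mul (h i j : ZMod 2) :
    ∑ k, hadEntry h i k * hadEntry h k j = if i = j then 1 else 0 := by
  have := sqrt_two_inv_mul_self
  rw [sum_zmod_two]
  rcases zmod_two_eq h with rfl | rfl <;> rcases zmod_two_eq i with rfl | rfl <;>
    rcases zmod_two_eq j with rfl | rfl <;>
    simp [hadEntry, sgn_zero, sgn_one, div_eq_mul_inv] <;> linarith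

theorem conjTranspose_hadPow (h : ZMod 2) : (hadPow h).conjTranspose = hadPow h := by
  ext i j
  rw [Matrix.conjTranspose_apply, hadPow, Matrix.of_apply, Matrix.of_apply, hadEntry_symm]
  exact Complex.conj_ofReal _

theorem hadPow_mul_self (h : ZMod 2) : hadPow h * hadPow h = 1 := by
  ext i j
  simp only [Matrix.mul_apply, hadPow, Matrix.of_apply, Matrix.one_apply]
  have := sum_hadEntry_mul h i j
  rw [← Complex.ofReal_one, ← Complex.ofReal_zero]
  split_ifs with hij
  · rw [if_pos hij] at this
    rw [← this]; push_cast; rfl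
  · rw [if_neg hij] at this
    rw [← this]; push_cast; rfl

/-- Hadamard gates on the qubits selected by `h`; the first qubit is left alone. -/
def hadamards (h : Fin m → ZMod 2) : Matrix (Qubits m) (Qubits m) ℂ :=
  (1 : Matrix (ZMod 2) (ZMod 2) ℂ) ⊗ₖ piKron fun t => hadPow (h t)

theorem conjTranspose_hadamards (h : Fin m → ZMod 2) :
    (hadamards h).conjTranspose = hadamards h := by
  rw [hadamards, Matrix.conjTranspose_kronecker, piKron_conjTranspose, Matrix.conjTranspose_one]
  simp only [conjTranspose_hadPow]

theorem hadamards_mul_self (h : Fin m → ZMod 2) : hadamards h * hadamards h = 1 := by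
  rw [hadamards, ← Matrix.mul_kronecker_mul, piKron_mul, Matrix.one_mul]
  simp only [hadPow_mul_self, piKron_one, Matrix.one_kronecker_one]

/-- The observable `X ⊗ H^{⊗ m}`. -/
def flipHadamard (m : ℕ) : Matrix (Qubits m) (Qubits m) ℂ :=
  (Matrix.of fun u v : ZMod 2 => if u = v then (0 : ℂ) else 1) ⊗ₖ
    piKron fun _ : Fin m => hadPow 1

theorem conjTranspose_flipHadamard : (flipHadamard m).conjTranspose = flipHadamard m := by
  rw [flipHadamard, Matrix.conjTranspose_kronecker, piKron_conjTranspose]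
  simp only [conjTranspose_hadPow]
  congr 1
  ext i j
  simp only [Matrix.conjTranspose_apply, Matrix.of_apply, eq_comm]
  split_ifs <;> simp

theorem flipHadamard_mul_self : flipHadamard m * flipHadamard m = 1 := by
  rw [flipHadamard, ← Matrix.mul_kronecker_mul, piKron_mul]
  simp only [hadPow_mul_self, piKron_one]
  rw [← Matrix.one_kronecker_one]
  congr 1
  ext i j
  simp only [Matrix.mul_apply, Matrix.of_apply, sum_zmod_two]
  rcases zmod_two_eq i with rfl | rfl <;> rcases zmod_two_eq j with rfl | rfl <;> simp

theorem trace_flipHadamard : (flipHadamard m).trace = 0 := by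
  rw [flipHadamard, Matrix.trace_kronecker]
  simp [Matrix.trace]

/-- The label of `H Z^w H†`, where `H` consists of Hadamard gates on the qubits selected by `h`. -/
def rotatedLabel (h : Fin m → ZMod 2) (w : Qubits m) : Label m :=
  ((0, h * w.2), (w.1, (1 - h) * w.2))

/-- On one qubit, HZ = XH when the gate is applied, and Z passes unchanged when it is not. -/
theorem hadEntry_mul_sgn (h w i j : ZMod 2) :
    hadEntry h i j * sgn (w * j) =
      sgn ((1 - h) * w * (i + h * w)) * hadEntry h (i + h * w) j := by
  rcases zmod_two_eq h with rfl | rfl <;> rcases zmod_two_eq i with rfl | rfl <;>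
    rcases zmod_two_eq j with rfl | rfl <;> rcases zmod_two_eq w with rfl | rfl <;>
    simp [hadEntry, sgn_zero, sgn_one, one_add_one_zmod_two, div_eq_mul_inv]

theorem hadamards_apply (h : Fin m → ZMod 2) (i j : Qubits m) :
    hadamards h i j =
      (((if i.1 = j.1 then 1 else 0) * ∏ t, hadEntry (h t) (i.2 t) (j.2 t) : ℝ) : ℂ) := by
  simp only [hadamards, Matrix.kroneckerMap_apply, piKron_apply, hadPow, Matrix.of_apply,
    Matrix.one_apply]
  split_ifs <;> simp

/-- This turns the random error Z^w of Bob's measurement into a Pauli whose label Bob can compute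
from w and the shared h, and so fold into his report. -/
theorem hadamards_mul_pauli (h : Fin m → ZMod 2) (w : Qubits m) :
    hadamards h * pauli (0, w) = pauli (rotatedLabel h w) * hadamards h := by
  ext i j
  rw [pauli_mul_apply, Matrix.mul_apply, Finset.sum_eq_single j]
  · simp only [pauli, Matrix.of_apply, add_zero, if_true, hadamards_apply, ← Complex.ofReal_mul,
      rotatedLabel, dot, sgn_add, sgn_sum, Prod.fst_add, Prod.snd_add, Pi.add_apply, Pi.mul_apply,
      Pi.sub_apply, Pi.one_apply]
    congr 1
    by_cases hij : i.1 = j.1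
    · rw [if_pos hij, hij, one_mul, one_mul, mul_left_comm, ← Finset.prod_mul_distrib, mul_assoc,
        ← Finset.prod_mul_distrib]
      congr 1
      exact Finset.prod_congr rfl fun t _ => hadEntry_mul_sgn _ _ _ _
    · rw [if_neg hij]
      ring
  · intro k _ hk
    simp [pauli, hk]
  · simp

end Pauli

/-! ### The twirl -/

section Twirl

variable {m : ℕ}

/-- Up to phase, the operators X^a Z^a on one qubit are 1 and Y, and Y anticommutes with H.
Averaging over conjugation by Y^a H^h projects onto what commutes with both, the scalars. With the
twist (-1)^a, present for e = 1, it projects onto what commutes with H and anticommutes with Y, the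
multiples of H. -/
theorem sum_hadEntry_kernel (e i j k l : ZMod 2) :
    ∑ a, ∑ h, sgn (a * e) * sgn (a * (i + j)) * (hadEntry h (i + a) k * hadEntry h (j + a) l) =
      2 * (hadEntry e i j * hadEntry e k l) := by
  have := sqrt_two_inv_mul_self
  simp only [sum_zmod_two]
  rcases zmod_two_eq e with rfl | rfl <;> rcases zmod_two_eq i with rfl | rfl <;>
    rcases zmod_two_eq j with rfl | rfl <;> rcases zmod_two_eq k with rfl | rfl <;>
    rcases zmod_two_eq l with rfl | rfl <;>
    simp [hadEntry, sgn_zero, sgn_one, one_add_one_zmod_two, div_eq_mul_inv] <;> linarith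

/-- The label of the Pauli operator that is applied for the bit `τ` and the seed `s`. For `τ = 0`
these operators commute with `X ⊗ H^{⊗ m}`, up to Hadamard gates. -/
def twirlLabel (τ : ZMod 2) (s : Qubits m) : Label m := (s, (∑ t, s.2 t + τ, s.2))

/-- The entries of the `m`-th tensor power of `hadPow e`. -/
def hadProd (e : ZMod 2) (i j : Fin m → ZMod 2) : ℝ := ∏ t, hadEntry e (i t) (j t)

theorem hadProd_zero (i j : Fin m → ZMod 2) : hadProd 0 i j = if i = j then 1 else 0 := by
  simp only [hadProd, hadEntry, if_true, funext_iff]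
  by_cases h : ∀ t, i t = j t
  · simp [h]
  · rw [if_neg h]
    push Not at h
    obtain ⟨t, ht⟩ := h
    exact Finset.prod_eq_zero (Finset.mem_univ t) (by simp [ht])

theorem hadProd_symm (e : ZMod 2) (i j : Fin m → ZMod 2) : hadProd e i j = hadProd e j i :=
  Finset.prod_congr rfl fun _ _ => hadEntry_symm _ _ _

theorem flipHadamard_apply (i j : Qubits m) :
    flipHadamard m i j = ((if i.1 = j.1 then 0 else hadProd 1 i.2 j.2 : ℝ) : ℂ) := by
  simp only [flipHadamard, Matrix.kroneckerMap_apply, piKron_apply, hadPow, Matrix.of_apply,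
    hadProd]
  split_ifs <;> simp

theorem hadamards_conj_apply (h : Fin m → ZMod 2) (M : Matrix (Qubits m) (Qubits m) ℂ)
    (i j : Qubits m) :
    (hadamards h * M * (hadamards h).conjTranspose) i j =
      ∑ k, ∑ l, ((∏ t, (hadEntry (h t) (i.2 t) (k t) * hadEntry (h t) (j.2 t) (l t)) : ℝ) : ℂ) *
        M (i.1, k) (j.1, l) := by
  have h1 : ∀ q, (hadamards h * M) i q =
      ∑ k, ((∏ t, hadEntry (h t) (i.2 t) (k t) : ℝ) : ℂ) * M (i.1, k) q := fun q => by
    rw [Matrix.mul_apply, Fintype.sum_prod_type, Finset.sum_eq_single i.1]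
    · simp [hadamards_apply]
    · intro u _ hu
      simp [hadamards_apply, hu.symm]
    · simp
  rw [conjTranspose_hadamards, Matrix.mul_apply, Fintype.sum_prod_type, Finset.sum_eq_single j.1]
  · simp only [h1, Finset.sum_mul]
    rw [Finset.sum_comm]
    refine Finset.sum_congr rfl fun k _ => Finset.sum_congr rfl fun l _ => ?_
    rw [Finset.prod_mul_distrib, hadamards_apply, if_pos rfl, one_mul,
      Finset.prod_congr rfl fun t _ => hadEntry_symm (h t) (l t) (j.2 t)]
    push_cast
    ring
  · intro u _ hu
    simp [hadamards_apply, hu]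
  · simp

/-- Partial contraction of a matrix with a tensor power of `hadPow e`. -/
def contract (M : Matrix (Qubits m) (Qubits m) ℂ) (e u v : ZMod 2) : ℂ :=
  ∑ k, ∑ l, (hadProd e k l : ℂ) * M (u, k) (v, l)

theorem trace_eq_contract (M : Matrix (Qubits m) (Qubits m) ℂ) :
    M.trace = contract M 0 0 0 + contract M 0 1 1 := by
  have : ∀ u, contract M 0 u u = ∑ k, M (u, k) (u, k) := fun u => by
    refine Finset.sum_congr rfl fun k _ => ?_
    rw [Finset.sum_eq_single k]
    · simp [hadProd_zero]
    · intro l _ hl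
      simp [hadProd_zero, hl.symm]
    · simp
  rw [this, this, Matrix.trace, Fintype.sum_prod_type, sum_zmod_two]
  rfl

theorem trace_flipHadamard_mul (M : Matrix (Qubits m) (Qubits m) ℂ) :
    (flipHadamard m * M).trace = contract M 1 0 1 + contract M 1 1 0 := by
  have : ∀ u v : ZMod 2, u ≠ v → contract M 1 u v =
      ∑ l, ∑ k, flipHadamard m (v, l) (u, k) * M (u, k) (v, l) := fun u v huv => by
    rw [contract, Finset.sum_comm]
    refine Finset.sum_congr rfl fun l _ => Finset.sum_congr rfl fun k _ => ?_
    rw [flipHadamard_apply, if_neg huv.symm, hadProd_symm]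
  rw [this 0 1 (by decide), this 1 0 (by decide)]
  simp only [Matrix.trace, Matrix.diag_apply, Matrix.mul_apply, Fintype.sum_prod_type,
    sum_zmod_two, Finset.sum_add_distrib]
  have h0 : ∀ (u : ZMod 2) (k l : Fin m → ZMod 2), flipHadamard m (u, l) (u, k) = 0 :=
    fun u k l => by simp [flipHadamard_apply]
  simp only [h0, zero_mul, Finset.sum_const_zero, zero_add, add_zero]

/-- Averaging over the Pauli operators with labels `twirlLabel τ s` and over Hadamard gates keeps
only the trace and the expectation of `X ⊗ H^{⊗ m}`. -/
theorem sum_twirl (τ : ZMod 2) (M : Matrix (Qubits m) (Qubits m) ℂ) :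
    ∑ h, ∑ s, pauli (twirlLabel τ s) * (hadamards h * M * (hadamards h).conjTranspose) *
        (pauli (twirlLabel τ s)).conjTranspose =
      (2 ^ m : ℂ) • (M.trace • (1 : Matrix (Qubits m) (Qubits m) ℂ) +
        ((sgn τ : ℂ) * (flipHadamard m * M).trace) • flipHadamard m) := by
  ext ⟨u, i⟩ ⟨v, j⟩
  -- The block (u, v) of the first qubit selects e = u + v. For fixed c, the sums over the remaining
  -- seed a and over h factor over the m qubits into the one-qubit kernel.
  have key : (∑ h, ∑ s, pauli (twirlLabel τ s) * (hadamards h * M * (hadamards h).conjTranspose) *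
        (pauli (twirlLabel τ s)).conjTranspose : Matrix (Qubits m) (Qubits m) ℂ) (u, i) (v, j) =
      ∑ c, (2 ^ m : ℂ) * (sgn (τ * (u + v)) : ℂ) * (hadProd (u + v) i j : ℂ) *
        contract M (u + v) (u + c) (v + c) := by
    simp only [Matrix.sum_apply, pauli_conj_apply, hadamards_conj_apply]
    rw [Finset.sum_comm, Fintype.sum_prod_type]
    refine Finset.sum_congr rfl fun c _ => ?_
    simp only [contract, Finset.mul_sum]
    have hterm : ∀ (a h k l : Fin m → ZMod 2),
        ((sgn (dot (twirlLabel τ (c, a)).2 ((u, i) + (v, j))) : ℝ) : ℂ) *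
          (((∏ t, (hadEntry (h t) (((u, i) + (twirlLabel τ (c, a)).1).2 t) (k t) *
            hadEntry (h t) (((v, j) + (twirlLabel τ (c, a)).1).2 t) (l t)) : ℝ) : ℂ) *
            M (((u, i) + (twirlLabel τ (c, a)).1).1, k) (((v, j) + (twirlLabel τ (c, a)).1).1, l)) =
        ((sgn (τ * (u + v)) : ℝ) : ℂ) * M (u + c, k) (v + c, l) *
          ((∏ t, (sgn (a t * (u + v)) * sgn (a t * (i t + j t)) *
            (hadEntry (h t) (i t + a t) (k t) * hadEntry (h t) (j t + a t) (l t))) : ℝ) : ℂ) := by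
      intro a h k l
      -- The exponent `∑ t, s.2 t + τ` of Z on the first qubit supplies each kernel with its twist
      -- and leaves one overall sign from τ.
      have hs : sgn (dot (twirlLabel τ (c, a)).2 ((u, i) + (v, j))) =
          sgn (τ * (u + v)) * ∏ t, (sgn (a t * (u + v)) * sgn (a t * (i t + j t))) := by
        simp only [dot, twirlLabel, Prod.mk_add_mk, Pi.add_apply, add_mul, sgn_add, sgn_sum,
          Finset.sum_mul, Finset.prod_mul_distrib]
        ring
      rw [hs, Finset.prod_mul_distrib (f := fun t => sgn (a t * (u + v)) * sgn (a t * (i t + j t)))]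
      simp only [twirlLabel, Prod.mk_add_mk, Pi.add_apply]
      push_cast
      ring
    simp only [hterm]
    calc _ = ∑ k, ∑ l, ∑ a : Fin m → ZMod 2, ∑ h : Fin m → ZMod 2,
          ((sgn (τ * (u + v)) : ℝ) : ℂ) * M (u + c, k) (v + c, l) *
          ((∏ t, (sgn (a t * (u + v)) * sgn (a t * (i t + j t)) *
            (hadEntry (h t) (i t + a t) (k t) * hadEntry (h t) (j t + a t) (l t))) : ℝ) : ℂ) := by
          rw [Finset.sum_congr rfl fun a _ => Finset.sum_comm]
          rw [Finset.sum_comm]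
          refine Finset.sum_congr rfl fun k _ => ?_
          rw [Finset.sum_congr rfl fun a _ => Finset.sum_comm]
          rw [Finset.sum_comm]
      _ = _ := by
          refine Finset.sum_congr rfl fun k _ => Finset.sum_congr rfl fun l _ => ?_
          simp only [← Finset.mul_sum]
          have hprod : ∑ a : Fin m → ZMod 2, ∑ h : Fin m → ZMod 2,
              ∏ t, (sgn (a t * (u + v)) * sgn (a t * (i t + j t)) *
              (hadEntry (h t) (i t + a t) (k t) * hadEntry (h t) (j t + a t) (l t))) =
              2 ^ m * (hadProd (u + v) i j * hadProd (u + v) k l) := by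
            have h1 : ∀ a : Fin m → ZMod 2, ∑ h : Fin m → ZMod 2,
                ∏ t, (sgn (a t * (u + v)) * sgn (a t * (i t + j t)) *
                (hadEntry (h t) (i t + a t) (k t) * hadEntry (h t) (j t + a t) (l t))) =
                ∏ t, ∑ h, (sgn (a t * (u + v)) * sgn (a t * (i t + j t)) *
                (hadEntry h (i t + a t) (k t) * hadEntry h (j t + a t) (l t))) := fun a => by
              rw [Finset.prod_univ_sum, Fintype.piFinset_univ]
            simp only [h1]
            have h2 := Finset.prod_univ_sum (fun _ : Fin m => (Finset.univ : Finset (ZMod 2)))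
              (fun t a => ∑ h, (sgn (a * (u + v)) * sgn (a * (i t + j t)) *
                (hadEntry h (i t + a) (k t) * hadEntry h (j t + a) (l t))))
            rw [Fintype.piFinset_univ] at h2
            rw [← h2]
            simp only [sum_hadEntry_kernel]
            rw [Finset.prod_mul_distrib, Finset.prod_mul_distrib, Finset.prod_const,
              Finset.card_univ, Fintype.card_fin]
            rfl
          have hc := congrArg (fun r : ℝ => (r : ℂ)) hprod
          simp only [Complex.ofReal_sum] at hc
          rw [hc]
          push_cast
          ring
  rw [key, sum_zmod_two]
  have h11 := one_add_one_zmod_two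
  rw [Matrix.smul_apply, Matrix.add_apply, Matrix.smul_apply, Matrix.smul_apply, smul_eq_mul,
    smul_eq_mul, smul_eq_mul, trace_eq_contract M, trace_flipHadamard_mul, flipHadamard_apply]
  -- Diagonal blocks give the trace times the identity; off-diagonal ones give the expectation of
  -- `flipHadamard`, and only these carry the sign of τ.
  rcases zmod_two_eq u with rfl | rfl <;> rcases zmod_two_eq v with rfl | rfl <;>
    simp only [add_zero, zero_add, h11, mul_zero, mul_one, sgn_zero, Matrix.one_apply,
      Prod.mk.injEq,
      true_and, one_ne_zero, zero_ne_one, false_and, if_true, if_false, hadProd_zero]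
  · split_ifs <;> push_cast <;> ring
  · ring
  · ring
  · split_ifs <;> push_cast <;> ring

end Twirl

/-! ### The forrelation gadget -/

section ForrelationGadget

variable {m : ℕ}

theorem card_qubits : Fintype.card (Qubits m) = 2 ^ (m + 1) := by
  rw [Fintype.card_prod, Fintype.card_fun, ZMod.card, Fintype.card_fin, pow_succ, mul_comm]

theorem sum_sgn_mul_bit (i : ZMod 2) : ∑ w, sgn (w * i) = if i = 0 then 2 else 0 := by
  rw [sum_zmod_two]
  rcases zmod_two_eq i with rfl | rfl <;> simp [sgn_zero, sgn_one]
  norm_num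

theorem sum_sgn_dot (i : Qubits m) :
    ∑ w, sgn (dot w i) = if i = 0 then (2 : ℝ) ^ (m + 1) else 0 := by
  have h : ∑ w, sgn (dot w i) =
      (if i.1 = 0 then 2 else 0) * ∏ t, if i.2 t = 0 then (2 : ℝ) else 0 := by
    have h2 := Finset.prod_univ_sum (fun _ : Fin m => (Finset.univ : Finset (ZMod 2)))
      (fun t w => sgn (w * i.2 t))
    rw [Fintype.piFinset_univ] at h2
    simp only [sum_sgn_mul_bit] at h2
    rw [h2, ← sum_sgn_mul_bit, Finset.sum_mul_sum, Fintype.sum_prod_type]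
    simp only [dot, sgn_add, sgn_sum]
  rw [h]
  by_cases h0 : i = 0
  · subst h0
    simp [pow_succ, mul_comm]
  · rw [if_neg h0]
    by_cases h1 : i.1 = 0
    · have : ∃ t, i.2 t ≠ 0 := by
        by_contra hc
        push Not at hc
        exact h0 (Prod.ext h1 (funext hc))
      obtain ⟨t, ht⟩ := this
      rw [Finset.prod_eq_zero (Finset.mem_univ t) (by simp [ht]), mul_zero]
    · simp [h1]

/-- The maximally entangled state of two copies of a system. -/
def maxEntangled (I : Type) [Fintype I] [DecidableEq I] : Matrix (I × I) (I × I) ℂ :=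
  (Fintype.card I : ℂ)⁻¹ • Matrix.vecMulVec (fun p : I × I => if p.1 = p.2 then (1 : ℂ) else 0)
    (star fun p : I × I => if p.1 = p.2 then (1 : ℂ) else 0)

theorem isDensity_maxEntangled (I : Type) [Fintype I] [DecidableEq I] [Nonempty I] :
    IsDensity (maxEntangled I) := by
  refine ⟨(Matrix.posSemidef_vecMulVec_self_star _).smul ?_, ?_⟩
  · rw [← Complex.ofReal_natCast, ← Complex.ofReal_inv]
    exact_mod_cast inv_nonneg.2 (Nat.cast_nonneg (α := ℝ) _)
  · rw [maxEntangled, Matrix.trace_smul, Matrix.trace, Fintype.sum_prod_type]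
    simp [Matrix.vecMulVec_apply]

/-- Steering: projecting Bob's half onto a functional s collapses Alice's half to s, with weight the
inverse dimension, and Bob's register then holds b. -/
theorem maxEntangled_conj {I A B : Type} [Fintype I] [DecidableEq I] [DecidableEq B]
    (K : Matrix A I ℂ) (b : B) (s : I → ℂ) :
    (K ⊗ₖ (Matrix.of fun b' k => if b' = b then s k else 0)) * maxEntangled I *
        (K ⊗ₖ (Matrix.of fun b' k => if b' = b then s k else 0)).conjTranspose =
      ((Fintype.card I : ℂ)⁻¹ • (K * Matrix.vecMulVec s (star s) * K.conjTranspose)) ⊗ₖ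
        Matrix.single b b 1 := by
  have hv : (K ⊗ₖ (Matrix.of fun b' k => if b' = b then s k else 0)).mulVec
      (fun p : I × I => if p.1 = p.2 then (1 : ℂ) else 0) =
      fun p => K.mulVec s p.1 * if p.2 = b then 1 else 0 := by
    ext ⟨i, b'⟩
    simp only [Matrix.mulVec, dotProduct, Fintype.sum_prod_type, Matrix.kroneckerMap_apply,
      Matrix.of_apply]
    simp only [mul_ite, mul_one, mul_zero, Finset.sum_ite_eq, Finset.mem_univ, if_true]
    split_ifs <;> simp
  rw [maxEntangled, Matrix.mul_smul, Matrix.smul_mul, Matrix.mul_vecMulVec, Matrix.vecMulVec_mul,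
    Matrix.mul_vecMulVec, Matrix.vecMulVec_mul, ← Matrix.star_mulVec, ← Matrix.star_mulVec, hv]
  ext ⟨i, b₁⟩ ⟨j, b₂⟩
  simp only [Matrix.smul_apply, Matrix.vecMulVec_apply, Matrix.kroneckerMap_apply, Pi.star_apply,
    smul_eq_mul, star_mul', Matrix.single_apply]
  by_cases h1 : b = b₁
  · by_cases h2 : b = b₂
    · simp [← h1, ← h2]
    · simp [h2, Ne.symm h2]
  · simp [h1, Ne.symm h1]

/-- The projectors on the eigenspaces of `X ⊗ H^{⊗ m}`. -/
def eigenProj (m : ℕ) (o : ZMod 2) : Matrix (Qubits m) (Qubits m) ℂ :=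
  (2⁻¹ : ℂ) • (1 + (sgn o : ℂ) • flipHadamard m)

theorem conjTranspose_eigenProj (o : ZMod 2) : (eigenProj m o).conjTranspose = eigenProj m o := by
  rw [eigenProj, Matrix.conjTranspose_smul, Matrix.conjTranspose_add, Matrix.conjTranspose_smul,
    conjTranspose_flipHadamard, Matrix.conjTranspose_one]
  congr 1
  · simp
  · congr 2
    exact Complex.conj_ofReal _

theorem eigenProj_mul (o o' : ZMod 2) :
    eigenProj m o * eigenProj m o' = if o = o' then eigenProj m o else 0 := by
  have h : eigenProj m o * eigenProj m o' = (4⁻¹ : ℂ) • ((1 + (sgn o * sgn o' : ℂ)) •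
      (1 : Matrix (Qubits m) (Qubits m) ℂ) + (sgn o + sgn o' : ℂ) • flipHadamard m) := by
    rw [eigenProj, eigenProj, Matrix.smul_mul, Matrix.mul_smul, smul_smul, Matrix.add_mul,
      Matrix.mul_add, Matrix.mul_add, Matrix.smul_mul, Matrix.mul_smul, Matrix.smul_mul,
      Matrix.mul_smul, flipHadamard_mul_self, Matrix.one_mul, Matrix.one_mul, Matrix.mul_one,
      add_smul, add_smul, one_smul, smul_smul]
    norm_num
    abel
  rw [h]
  rcases zmod_two_eq o with rfl | rfl <;> rcases zmod_two_eq o' with rfl | rfl <;>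
    simp [sgn_zero, sgn_one, eigenProj] <;> module

theorem sum_eigenProj : ∑ o, eigenProj m o = 1 := by
  rw [sum_zmod_two, eigenProj, eigenProj, sgn_zero, sgn_one]
  push_cast
  module

theorem trace_eigenProj (o : ZMod 2) : (eigenProj m o).trace = 2 ^ m := by
  rw [eigenProj, Matrix.trace_smul, Matrix.trace_add, Matrix.trace_smul, trace_flipHadamard,
    Matrix.trace_one, card_qubits]
  push_cast
  rw [smul_zero, add_zero, pow_succ, smul_eq_mul]
  ring

/-- The operator that is `M` in the frame of each Pauli label. -/
def framed (M : Matrix (Qubits m) (Qubits m) ℂ) :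
    Matrix (Qubits m × Label m) (Qubits m × Label m) ℂ :=
  Matrix.blockDiagonal fun l => pauli l * M * (pauli l).conjTranspose

theorem framed_eq_sum (M : Matrix (Qubits m) (Qubits m) ℂ) :
    framed M = ∑ l, (pauli l * M * (pauli l).conjTranspose) ⊗ₖ Matrix.single l l (1 : ℂ) := by
  ext ⟨i, l⟩ ⟨j, l'⟩
  rw [framed, Matrix.blockDiagonal_apply, Matrix.sum_apply, Finset.sum_eq_single l]
  · simp [Matrix.single_apply]
  · intro k _ hk
    simp [hk]
  · simp

theorem framed_mul (M N : Matrix (Qubits m) (Qubits m) ℂ) :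
    framed M * framed N = framed (M * N) := by
  rw [framed, framed, ← Matrix.blockDiagonal_mul, framed]
  congr 1
  ext1 l
  calc pauli l * M * (pauli l).conjTranspose * (pauli l * N * (pauli l).conjTranspose)
      = pauli l * M * ((pauli l).conjTranspose * pauli l) * N * (pauli l).conjTranspose := by
        simp only [Matrix.mul_assoc]
    _ = _ := by rw [conjTranspose_pauli_mul_self, Matrix.mul_one, Matrix.mul_assoc (pauli l) M N]

theorem framed_conjTranspose (M : Matrix (Qubits m) (Qubits m) ℂ) :
    (framed M).conjTranspose = framed M.conjTranspose := by
  rw [framed, Matrix.blockDiagonal_conjTranspose, framed]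
  congr 1
  ext1 l
  rw [Matrix.conjTranspose_mul, Matrix.conjTranspose_mul, Matrix.conjTranspose_conjTranspose,
    Matrix.mul_assoc]

theorem framed_add (M N : Matrix (Qubits m) (Qubits m) ℂ) :
    framed (M + N) = framed M + framed N := by
  rw [framed, framed, framed, ← Matrix.blockDiagonal_add]
  congr 1
  ext1 l
  rw [Matrix.mul_add, Matrix.add_mul]
  rfl

theorem framed_smul (r : ℂ) (M : Matrix (Qubits m) (Qubits m) ℂ) :
    framed (r • M) = r • framed M := by
  rw [framed, framed, ← Matrix.blockDiagonal_smul]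
  congr 1
  ext1 l
  rw [Matrix.mul_smul, Matrix.smul_mul]
  rfl

theorem framed_one : framed (1 : Matrix (Qubits m) (Qubits m) ℂ) = 1 := by
  have h : (fun l : Label m => pauli l * 1 * (pauli l).conjTranspose) = 1 :=
    funext fun l => by rw [Matrix.mul_one, pauli_mul_conjTranspose_self, Pi.one_apply]
  rw [framed, h, Matrix.blockDiagonal_one]

theorem framed_trace (M : Matrix (Qubits m) (Qubits m) ℂ) :
    (framed M).trace = (2 ^ (m + 1)) ^ 2 * M.trace := by
  rw [framed, Matrix.trace_blockDiagonal]
  have : ∀ l : Label m, (pauli l * M * (pauli l).conjTranspose).trace = M.trace := fun l => by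
    rw [Matrix.trace_mul_comm, ← Matrix.mul_assoc, conjTranspose_pauli_mul_self, Matrix.one_mul]
  simp only [this]
  rw [Finset.sum_const, Finset.card_univ, Fintype.card_prod, card_qubits, nsmul_eq_mul, sq]
  push_cast
  rfl

/-- The operator `M`, averaged over all frames. -/
theorem sum_frames (τ : ZMod 2) (r : (Fin m → ZMod 2) → Label m)
    (M : Matrix (Qubits m) (Qubits m) ℂ) :
    ∑ q : Label m, ∑ h, ∑ s, (pauli (q + r h) * (hadamards h * M * (hadamards h).conjTranspose) *
        (pauli (q + r h)).conjTranspose) ⊗ₖ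
          Matrix.single (q + r h + twirlLabel τ s) (q + r h + twirlLabel τ s) (1 : ℂ) =
      (2 ^ m : ℂ) • (M.trace • framed 1 +
        ((sgn τ : ℂ) * (flipHadamard m * M).trace) • framed (flipHadamard m)) := by
  rw [← framed_smul, ← framed_smul, ← framed_add, ← framed_smul, ← sum_twirl, framed_eq_sum]
  rw [Finset.sum_comm]
  simp only [Matrix.mul_sum, Matrix.sum_mul]
  have hk : ∀ (f : (Fin m → ZMod 2) → Qubits m → Matrix (Qubits m) (Qubits m) ℂ) (l : Label m),
      (∑ h, ∑ s, f h s) ⊗ₖ Matrix.single l l (1 : ℂ) =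
        ∑ h, ∑ s, f h s ⊗ₖ Matrix.single l l (1 : ℂ) :=
    fun f l => by
    ext i j
    simp only [Matrix.kroneckerMap_apply, Matrix.sum_apply, Finset.sum_mul]
  simp only [hk]
  rw [Finset.sum_comm (s := (Finset.univ : Finset (Label m)))]
  refine Finset.sum_congr rfl fun h _ => ?_
  rw [Finset.sum_comm, Finset.sum_comm (s := (Finset.univ : Finset (Label m)))]
  refine Finset.sum_congr rfl fun s _ => ?_
  -- Reindexing by the label l that is finally reported: a twirl label is its own inverse, so the
  -- frame q + r h is l + twirl. The correction r h disappears and l ranges uniformly over all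
  -- labels.
  refine Fintype.sum_equiv (Equiv.addRight (r h + twirlLabel τ s)) _ _ fun q => ?_
  have hl : q + (r h + twirlLabel τ s) + twirlLabel τ s = q + r h := by
    rw [← add_assoc, add_assoc (q + r h), label_add_self, add_zero]
  rw [Equiv.coe_addRight]
  beta_reduce
  rw [pauli_mul_conj, hl, add_assoc]

end ForrelationGadget

/-! ### Steering by Bob's measurement, and the two branches of the gadget. -/

section ForrelationProtocol

variable {m : ℕ}

/-- The vector of Bob's `w`-th measurement outcome. -/
def bobVector (v : Qubits m → ℝ) (w : Qubits m) : Qubits m → ℂ :=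
  fun k => ((sgn (dot w k) * v k / √(2 ^ (m + 1)) : ℝ) : ℂ)

/-- Orthogonality of characters; the signs v only conjugate the resolution of the identity and
square to 1. -/
theorem sum_vecMulVec_bobVector {v : Qubits m → ℝ} (hv : ∀ k, v k * v k = 1) :
    ∑ w, Matrix.vecMulVec (bobVector v w) (star (bobVector v w)) = 1 := by
  ext i j
  have hs : ((2 : ℝ) ^ (m + 1))⁻¹ = (√(2 ^ (m + 1)))⁻¹ * (√(2 ^ (m + 1)))⁻¹ := by
    rw [← mul_inv, Real.mul_self_sqrt (by positivity)]
  have h : ∀ w, (Matrix.vecMulVec (bobVector v w) (star (bobVector v w))) i j =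
      (((2 ^ (m + 1))⁻¹ * (v i * v j) * sgn (dot w (i + j)) : ℝ) : ℂ) := fun w => by
    rw [Matrix.vecMulVec_apply, Pi.star_apply, bobVector, bobVector, RCLike.star_def,
      Complex.conj_ofReal, ← Complex.ofReal_mul, dot_add_right, sgn_add, hs]
    congr 1
    ring
  rw [Matrix.sum_apply]
  simp only [h]
  rw [← Complex.ofReal_sum, ← Finset.mul_sum, sum_sgn_dot, Matrix.one_apply]
  by_cases hij : i = j
  · subst hij
    rw [qubits_add_self, if_pos rfl, hv, if_pos rfl, mul_one, inv_mul_cancel₀ (by positivity),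
      Complex.ofReal_one]
  · rw [if_neg hij, if_neg fun h0 => hij ?_, mul_zero, Complex.ofReal_zero]
    rw [← add_zero i, ← qubits_add_self j, ← add_assoc, h0, zero_add]

/-- Bob's Kraus operator that measures `bobVector v w` and reports `b`. -/
def bobOp {B : Type} [DecidableEq B] (b : B) (s : Qubits m → ℂ) : Matrix B (Qubits m) ℂ :=
  Matrix.of fun b' k => if b' = b then s k else 0

theorem conjTranspose_bobOp_mul_self {B : Type} [Fintype B] [DecidableEq B] (b : B)
    (s : Qubits m → ℂ) :
    (bobOp b s).conjTranspose * bobOp b s = Matrix.vecMulVec (star s) s := by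
  ext i j
  rw [Matrix.mul_apply, Finset.sum_eq_single b]
  · simp [bobOp, Matrix.vecMulVec_apply]
  · intro b' _ hb
    simp [bobOp, hb]
  · simp

theorem sum_bobOp {B : Type} [Fintype B] [DecidableEq B] (b : Qubits m → B)
    {v : Qubits m → ℝ} (hv : ∀ k, v k * v k = 1) :
    ∑ w, (bobOp (b w) (bobVector v w)).conjTranspose * bobOp (b w) (bobVector v w) = 1 := by
  have hs : ∀ w, star (bobVector v w) = bobVector v w := fun w => funext fun k => by
    rw [Pi.star_apply, bobVector, RCLike.star_def, Complex.conj_ofReal]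
  rw [← sum_vecMulVec_bobVector hv]
  refine Finset.sum_congr rfl fun w _ => ?_
  rw [conjTranspose_bobOp_mul_self, hs]

/-- Alice's operators before the frame change: multiplication by her signs `u`, or a reflection
into the positive eigenspace of `X ⊗ H^{⊗ m}`. -/
def prep (u : Qubits m → ℝ) : Bool → Bool → Matrix (Qubits m) (Qubits m) ℂ
  | true, true => Matrix.diagonal fun k => (u k : ℂ)
  | true, false => 0
  | false, true => eigenProj m 0
  | false, false => pauli (0, (1, 0)) * eigenProj m 1

theorem prep_complete {u : Qubits m → ℝ} (hu : ∀ k, u k * u k = 1) (c : Bool) :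
    ∑ b, (prep u c b).conjTranspose * prep u c b = 1 := by
  rw [Fintype.sum_bool]
  cases c
  · simp only [prep]
    rw [Matrix.conjTranspose_mul, Matrix.mul_assoc, ← Matrix.mul_assoc (pauli _).conjTranspose,
      conjTranspose_pauli_mul_self, Matrix.one_mul, conjTranspose_eigenProj,
      conjTranspose_eigenProj, eigenProj_mul, eigenProj_mul, if_pos rfl, if_pos rfl,
      ← sum_zmod_two, sum_eigenProj]
  · simp only [prep]
    rw [Matrix.mul_zero, add_zero, Matrix.diagonal_conjTranspose, Matrix.diagonal_mul_diagonal,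
      ← Matrix.diagonal_one]
    congr 1
    ext k
    rw [Pi.star_apply, RCLike.star_def, Complex.conj_ofReal, ← Complex.ofReal_mul, hu,
      Complex.ofReal_one]

/-- Z on the first qubit anticommutes with the factor X, so it exchanges the two eigenspaces. -/
theorem pauli_conj_flipHadamard :
    pauli (0, (1, 0)) * flipHadamard m * (pauli (0, (1, 0))).conjTranspose = -flipHadamard m := by
  ext i j
  rw [pauli_conj_apply, Matrix.neg_apply, add_zero, add_zero]
  have h : dot ((1, 0) : Qubits m) (i + j) = i.1 + j.1 := by simp [dot]
  rw [h, flipHadamard_apply]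
  rcases zmod_two_eq i.1 with h1 | h1 <;> rcases zmod_two_eq j.1 with h2 | h2 <;>
    simp [h1, h2, sgn_one]

theorem pauli_conj_eigenProj :
    pauli (0, (1, 0)) * eigenProj m 1 * (pauli (0, (1, 0))).conjTranspose = eigenProj m 0 := by
  rw [eigenProj, eigenProj, Matrix.mul_smul, Matrix.smul_mul, Matrix.mul_add, Matrix.add_mul,
    Matrix.mul_smul, Matrix.smul_mul, pauli_conj_flipHadamard, Matrix.mul_one,
    pauli_mul_conjTranspose_self, sgn_zero, sgn_one]
  push_cast
  module

/-- Alice measures F on her half and flips a negative outcome. The state left behind is maximally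
mixed on the positive eigenspace, of correlation exactly 1. -/
theorem sum_prep_false_conj (u : Qubits m → ℝ) :
    ∑ b, prep u false b * (prep u false b).conjTranspose = 1 + flipHadamard m := by
  rw [Fintype.sum_bool]
  simp only [prep]
  have h : pauli (0, (1, 0)) * eigenProj m 1 * (pauli (0, (1, 0)) * eigenProj m 1).conjTranspose =
      eigenProj m 0 := by
    rw [Matrix.conjTranspose_mul, conjTranspose_eigenProj, Matrix.mul_assoc,
      ← Matrix.mul_assoc (eigenProj m 1), eigenProj_mul, if_pos rfl, ← Matrix.mul_assoc,
      pauli_conj_eigenProj]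
  rw [h, conjTranspose_eigenProj, eigenProj_mul, if_pos rfl, eigenProj, sgn_zero]
  push_cast
  module

/-- The index set of the shared randomness of the forrelation gadget. -/
abbrev Frame (m : ℕ) : Type := Label m × ((Fin m → ZMod 2) × Qubits m)

/-- Alice's Kraus operators. -/
def aliceOp (u : Qubits m → ℝ) (c : Bool) (g : Frame m) (b : Bool) :
    Matrix (Qubits m) (Qubits m) ℂ :=
  pauli g.1 * hadamards g.2.1 * prep u c b

/-- The label that Bob reports. -/
def report (τ : ZMod 2) (c : Bool) (g : Frame m) (w : Qubits m) : Label m :=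
  g.1 + (if c then rotatedLabel g.2.1 w else 0) + twirlLabel τ g.2.2

theorem aliceOp_complete {u : Qubits m → ℝ} (hu : ∀ k, u k * u k = 1) (c : Bool) (g : Frame m) :
    ∑ b, (aliceOp u c g b).conjTranspose * aliceOp u c g b = 1 := by
  rw [← prep_complete hu c]
  refine Finset.sum_congr rfl fun b _ => ?_
  rw [aliceOp, Matrix.conjTranspose_mul, Matrix.conjTranspose_mul, Matrix.mul_assoc,
    Matrix.mul_assoc, Matrix.mul_assoc, ← Matrix.mul_assoc (pauli g.1).conjTranspose,
    conjTranspose_pauli_mul_self, Matrix.one_mul,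
    ← Matrix.mul_assoc (hadamards g.2.1).conjTranspose,
    conjTranspose_hadamards, hadamards_mul_self, Matrix.one_mul]

/-- The correlation `n⁻¹ ⟨z|X ⊗ H^{⊗ m}|z⟩`. -/
def correlation (z : Qubits m → ℝ) : ℝ :=
  (2 ^ (m + 1))⁻¹ * ∑ i, ∑ j, z i * (if i.1 = j.1 then 0 else hadProd 1 i.2 j.2) * z j

/-- The operator of the real vector `z`. -/
def signState (z : Qubits m → ℝ) : Matrix (Qubits m) (Qubits m) ℂ :=
  Matrix.of fun i j => ((z i * z j : ℝ) : ℂ)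

theorem trace_signState {z : Qubits m → ℝ} (hz : ∀ k, z k * z k = 1) :
    (signState z).trace = 2 ^ (m + 1) := by
  simp only [Matrix.trace, Matrix.diag_apply, signState, Matrix.of_apply, hz]
  rw [Finset.sum_const, Finset.card_univ, card_qubits]
  simp

theorem trace_flipHadamard_mul_signState (z : Qubits m → ℝ) :
    (flipHadamard m * signState z).trace = (2 ^ (m + 1) * correlation z : ℝ) := by
  rw [correlation, ← mul_assoc, mul_inv_cancel₀ (by positivity), one_mul]
  simp only [Matrix.trace, Matrix.diag_apply, Matrix.mul_apply, flipHadamard_apply, signState,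
    Matrix.of_apply, ← Complex.ofReal_mul, ← Complex.ofReal_sum]
  congr 1
  refine Finset.sum_congr rfl fun i _ => Finset.sum_congr rfl fun j _ => ?_
  ring

/-- Alice's signs and Bob's outcome phases are all diagonal, so they combine into the state of u * v
up to the error Z^w. -/
theorem prep_true_conj_bobVector (u v : Qubits m → ℝ) (w : Qubits m) :
    prep u true true * Matrix.vecMulVec (bobVector v w) (star (bobVector v w)) *
        (prep u true true).conjTranspose =
      (2 ^ (m + 1) : ℂ)⁻¹ • (pauli (0, w) * signState (u * v) *
        (pauli (0, w)).conjTranspose) := by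
  have hs : ((2 : ℝ) ^ (m + 1))⁻¹ = (√(2 ^ (m + 1)))⁻¹ * (√(2 ^ (m + 1)))⁻¹ := by
    rw [← mul_inv, Real.mul_self_sqrt (by positivity)]
  ext i j
  rw [Matrix.smul_apply, pauli_conj_apply, prep, Matrix.diagonal_conjTranspose,
    Matrix.mul_diagonal, Matrix.diagonal_mul, Matrix.vecMulVec_apply, Pi.star_apply, Pi.star_apply,
    bobVector, bobVector, RCLike.star_def, Complex.conj_ofReal, Complex.conj_ofReal, signState,
    Matrix.of_apply, dot_add_right, sgn_add, add_zero, add_zero, Pi.mul_apply, Pi.mul_apply,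
    smul_eq_mul]
  have h2 : ((2 : ℂ) ^ (m + 1))⁻¹ = (((2 ^ (m + 1))⁻¹ : ℝ) : ℂ) := by push_cast; rfl
  rw [h2, hs]
  simp only [← Complex.ofReal_mul]
  congr 1
  ring

theorem sum_gadget_true (u : Qubits m → ℝ) {v : Qubits m → ℝ}
    (hz : ∀ k, (u * v) k * (u * v) k = 1) (τ : ZMod 2) :
    ∑ g : Frame m, ∑ b, ∑ w, (aliceOp u true g b ⊗ₖ bobOp (report τ true g w) (bobVector v w)) *
        maxEntangled (Qubits m) *
        (aliceOp u true g b ⊗ₖ bobOp (report τ true g w) (bobVector v w)).conjTranspose =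
      (2 ^ m : ℂ) • (framed 1 +
        ((sgn τ * correlation (u * v) : ℝ) : ℂ) • framed (flipHadamard m)) := by
  have h1 : ∀ (g : Frame m) (w : Qubits m),
      aliceOp u true g true * Matrix.vecMulVec (bobVector v w) (star (bobVector v w)) *
        (aliceOp u true g true).conjTranspose =
      (2 ^ (m + 1) : ℂ)⁻¹ • (pauli (g.1 + rotatedLabel g.2.1 w) * (hadamards g.2.1 *
        signState (u * v) * (hadamards g.2.1).conjTranspose) *
          (pauli (g.1 + rotatedLabel g.2.1 w)).conjTranspose) := fun g w => by
    calc aliceOp u true g true * Matrix.vecMulVec (bobVector v w) (star (bobVector v w)) *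
          (aliceOp u true g true).conjTranspose
        = pauli g.1 * (hadamards g.2.1 * (prep u true true *
            Matrix.vecMulVec (bobVector v w) (star (bobVector v w)) *
              (prep u true true).conjTranspose) * (hadamards g.2.1).conjTranspose) *
              (pauli g.1).conjTranspose := by
          rw [aliceOp, Matrix.conjTranspose_mul, Matrix.conjTranspose_mul]
          simp only [Matrix.mul_assoc]
      _ = (2 ^ (m + 1) : ℂ)⁻¹ • (pauli g.1 * ((hadamards g.2.1 * pauli (0, w)) * signState (u * v) *
            (hadamards g.2.1 * pauli (0, w)).conjTranspose) * (pauli g.1).conjTranspose) := by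
          rw [prep_true_conj_bobVector, Matrix.conjTranspose_mul]
          simp only [Matrix.mul_assoc, Matrix.mul_smul, Matrix.smul_mul]
      _ = _ := by
          rw [hadamards_mul_pauli, ← pauli_mul_conj, Matrix.conjTranspose_mul]
          simp only [Matrix.mul_assoc]
  have h2 : ∀ (g : Frame m) (w : Qubits m),
      (aliceOp u true g false ⊗ₖ bobOp (report τ true g w) (bobVector v w)) = 0 := fun g w => by
    rw [aliceOp, prep, Matrix.mul_zero, Matrix.zero_kronecker]
  have h3 : ∀ (g : Frame m) (w : Qubits m),
      (aliceOp u true g true ⊗ₖ bobOp (report τ true g w) (bobVector v w)) *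
        maxEntangled (Qubits m) *
        (aliceOp u true g true ⊗ₖ bobOp (report τ true g w) (bobVector v w)).conjTranspose =
      ((2 ^ (m + 1) : ℂ)⁻¹ * (2 ^ (m + 1) : ℂ)⁻¹) •
        ((pauli (g.1 + rotatedLabel g.2.1 w) * (hadamards g.2.1 *
        signState (u * v) * (hadamards g.2.1).conjTranspose) *
          (pauli (g.1 + rotatedLabel g.2.1 w)).conjTranspose) ⊗ₖ
          Matrix.single (g.1 + rotatedLabel g.2.1 w + twirlLabel τ g.2.2)
            (g.1 + rotatedLabel g.2.1 w + twirlLabel τ g.2.2) (1 : ℂ)) := fun g w => by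
    have := maxEntangled_conj (aliceOp u true g true) (report τ true g w) (bobVector v w)
    rw [bobOp, this, h1, card_qubits, smul_smul, Matrix.smul_kronecker, report, if_pos rfl]
    push_cast
    rfl
  simp only [Fintype.sum_bool, h2, Matrix.zero_mul, Finset.sum_const_zero, add_zero, h3]
  -- Bob's outcome w is moved outermost: for each fixed w, `sum_frames` applies with the shift
  -- `rotatedLabel h w`, and its result no longer depends on w.
  rw [Finset.sum_comm]
  simp only [← Finset.smul_sum, Fintype.sum_prod_type (α₁ := Label m),
    Fintype.sum_prod_type (α₁ := Fin m → ZMod 2), sum_frames τ fun h => rotatedLabel h _]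
  rw [Finset.sum_const, Finset.card_univ, card_qubits, trace_signState hz,
    trace_flipHadamard_mul_signState]
  rw [← Nat.cast_smul_eq_nsmul ℂ]
  simp only [smul_add, smul_smul]
  push_cast
  congr 2 <;> field_simp

theorem sum_gadget_false (u : Qubits m → ℝ) {v : Qubits m → ℝ} (hv : ∀ k, v k * v k = 1)
    (τ : ZMod 2) :
    ∑ g : Frame m, ∑ b, ∑ w, (aliceOp u false g b ⊗ₖ bobOp (report τ false g w) (bobVector v w)) *
        maxEntangled (Qubits m) *
        (aliceOp u false g b ⊗ₖ bobOp (report τ false g w) (bobVector v w)).conjTranspose =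
      (2 ^ m : ℂ) • (framed 1 + (sgn τ : ℂ) • framed (flipHadamard m)) := by
  have hk : ∀ (f : Qubits m → Matrix (Qubits m) (Qubits m) ℂ) (l : Label m),
      ∑ w, f w ⊗ₖ Matrix.single l l (1 : ℂ) = (∑ w, f w) ⊗ₖ Matrix.single l l (1 : ℂ) :=
    fun f l => by
    ext i j
    simp only [Matrix.kroneckerMap_apply, Matrix.sum_apply, Finset.sum_mul]
  have hb : ∀ (f : Bool → Matrix (Qubits m) (Qubits m) ℂ) (l : Label m),
      ∑ w, f w ⊗ₖ Matrix.single l l (1 : ℂ) = (∑ w, f w) ⊗ₖ Matrix.single l l (1 : ℂ) :=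
    fun f l => by
    ext i j
    simp only [Matrix.kroneckerMap_apply, Matrix.sum_apply, Finset.sum_mul]
  have h3 : ∀ g : Frame m, ∑ b, ∑ w,
      (aliceOp u false g b ⊗ₖ bobOp (report τ false g w) (bobVector v w)) *
        maxEntangled (Qubits m) *
        (aliceOp u false g b ⊗ₖ bobOp (report τ false g w) (bobVector v w)).conjTranspose =
      (2 ^ (m + 1) : ℂ)⁻¹ • ((pauli (g.1 + 0) * (hadamards g.2.1 *
        (1 + flipHadamard m) * (hadamards g.2.1).conjTranspose) *
          (pauli (g.1 + 0)).conjTranspose) ⊗ₖ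
          Matrix.single (g.1 + 0 + twirlLabel τ g.2.2)
            (g.1 + 0 + twirlLabel τ g.2.2) (1 : ℂ)) := fun g => by
    have h4 : ∀ b w, (aliceOp u false g b ⊗ₖ bobOp (report τ false g w) (bobVector v w)) *
        maxEntangled (Qubits m) *
        (aliceOp u false g b ⊗ₖ bobOp (report τ false g w) (bobVector v w)).conjTranspose =
        (2 ^ (m + 1) : ℂ)⁻¹ • ((aliceOp u false g b *
          Matrix.vecMulVec (bobVector v w) (star (bobVector v w)) *
            (aliceOp u false g b).conjTranspose) ⊗ₖ
          Matrix.single (g.1 + 0 + twirlLabel τ g.2.2)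
            (g.1 + 0 + twirlLabel τ g.2.2) (1 : ℂ)) := fun b w => by
      have := maxEntangled_conj (aliceOp u false g b) (report τ false g w) (bobVector v w)
      rw [bobOp, this, card_qubits, Matrix.smul_kronecker, report]
      push_cast
      rfl
    simp only [h4, ← Finset.smul_sum, hk, ← Matrix.sum_mul, ← Matrix.mul_sum,
      sum_vecMulVec_bobVector hv, Matrix.mul_one, hb]
    congr 2
    rw [← sum_prep_false_conj u]
    simp only [Matrix.sum_mul, Matrix.mul_sum, add_zero, aliceOp, Matrix.conjTranspose_mul,
      Matrix.mul_assoc]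
  simp only [h3, ← Finset.smul_sum, Fintype.sum_prod_type (α₁ := Label m),
    Fintype.sum_prod_type (α₁ := Fin m → ZMod 2), sum_frames τ fun _ => 0]
  rw [Matrix.mul_add, flipHadamard_mul_self, Matrix.mul_one, add_comm (flipHadamard m),
    Matrix.trace_add, trace_flipHadamard, Matrix.trace_one, card_qubits, add_zero]
  simp only [smul_add, smul_smul]
  push_cast
  congr 2 <;> field_simp

end ForrelationProtocol

/-! ### The assembled gadget, and its bias in terms of forrelation. -/

section ForrelationProtocol

variable {m : ℕ}

theorem card_frame : (Fintype.card (Frame m) : ℝ) = (2 ^ (m + 1)) ^ 3 * 2 ^ m := by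
  simp only [Fintype.card_prod, Fintype.card_fun, ZMod.card, Fintype.card_fin]
  push_cast
  ring

/-- With probability `θ` Alice and Bob estimate the correlation of the product of their sign
vectors, and otherwise they produce a fixed outcome. -/
def forrelationGadget {X Y : Type} (u : X → Qubits m → ℝ) (v : Y → Qubits m → ℝ)
    (hu : ∀ x k, u x k * u x k = 1) (hv : ∀ y k, v y k * v y k = 1) (θ : ℝ) (h0 : 0 ≤ θ)
    (h1 : θ ≤ 1) :
    Gadget X Y (Qubits m) (Qubits m) (Qubits m) (Label m) (Bool × Frame m) Bool (Qubits m) where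
  weight g := (if g.1 then θ else 1 - θ) * ((2 ^ (m + 1)) ^ 3 * 2 ^ m)⁻¹
  weight_nonneg g := by
    have : 0 ≤ 1 - θ := by linarith
    split_ifs <;> positivity
  weight_sum := by
    rw [Fintype.sum_prod_type, Fintype.sum_bool]
    simp only [if_true, Bool.false_eq_true, if_false, Finset.sum_const, Finset.card_univ,
      nsmul_eq_mul, card_frame]
    field_simp
    ring
  state := maxEntangled (Qubits m)
  state_isDensity := isDensity_maxEntangled _
  alice x g b := aliceOp (u x) g.1 g.2 b
  alice_complete x g := aliceOp_complete (hu x) g.1 g.2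
  bob y τ g w := bobOp (report τ g.1 g.2 w) (bobVector (v y) w)
  bob_complete y τ g := sum_bobOp _ (hv y)
  proj o := framed (eigenProj m o)
  proj_isHermitian o := by rw [framed_conjTranspose, conjTranspose_eigenProj]
  proj_mul o o' := by
    rw [framed_mul, eigenProj_mul]
    split_ifs with h
    · rfl
    · rw [← zero_smul ℂ (1 : Matrix (Qubits m) (Qubits m) ℂ), framed_smul, zero_smul]
  proj_sum := by rw [sum_zmod_two, ← framed_add, ← sum_zmod_two, sum_eigenProj, framed_one]
  rank := (2 ^ (m + 1)) ^ 2 * 2 ^ m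
  rank_pos := by positivity
  proj_trace o := by
    rw [framed_trace, trace_eigenProj]
    push_cast
    rfl
  bias x y := 1 - θ + θ * correlation (u x * v y)
  output_eq x y τ := by
    have hz : ∀ k, (u x * v y) k * (u x * v y) k = 1 := fun k => by
      rw [Pi.mul_apply, mul_mul_mul_comm, hu, hv, one_mul]
    simp only [← Finset.smul_sum]
    rw [Fintype.sum_prod_type, Fintype.sum_bool]
    simp only [if_true, Bool.false_eq_true, if_false, ← Finset.smul_sum]
    -- Both branches give `framed 1` plus a signed multiple of `framed (flipHadamard m)`, with
    -- coefficient the correlation or 1. Mixing them averages these coefficients into the bias.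
    rw [sum_gadget_true (u x) hz, sum_gadget_false (u x) (hv y), sum_zmod_two, sgn_zero, sgn_one,
      eigenProj, eigenProj, framed_smul, framed_smul, framed_add, framed_add, framed_smul,
      framed_smul, sgn_zero, sgn_one]
    push_cast
    have h2 : (2 : ℂ) ^ m ≠ 0 := by positivity
    simp only [pow_succ (2 : ℂ) m, mul_inv]
    generalize (2 : ℂ) ^ m = N at h2
    match_scalars <;> field_simp <;> ring

/-- F is symmetric with F² = 1, so 0 ≤ ‖z + eFz‖² = 2n(1 + e · correlation) for e = ±1. -/
theorem abs_correlation_le {z : Qubits m → ℝ} (hz : ∀ k, z k * z k = 1) :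
    |correlation z| ≤ 1 := by
  have key : ∀ e : ℝ, e * e = 1 → 0 ≤ 1 + e * correlation z := fun e he => by
    have hA : ∀ i j : Qubits m, ∑ k : Qubits m, (if k.1 = i.1 then 0 else hadProd 1 k.2 i.2) *
        (if k.1 = j.1 then 0 else hadProd 1 k.2 j.2) = if i = j then 1 else 0 := fun i j => by
      have h := congrFun (congrFun (flipHadamard_mul_self (m := m)) i) j
      rw [Matrix.mul_apply, Matrix.one_apply] at h
      simp only [flipHadamard_apply, ← Complex.ofReal_mul, ← Complex.ofReal_sum] at h
      have h' : ∑ k : Qubits m, (if i.1 = k.1 then 0 else hadProd 1 i.2 k.2) *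
        (if k.1 = j.1 then 0 else hadProd 1 k.2 j.2) = if i = j then 1 else 0 := by
        split_ifs at h ⊢ <;> exact_mod_cast h
      rw [← h']
      refine Finset.sum_congr rfl fun k _ => ?_
      rw [hadProd_symm 1 k.2 i.2]
      simp only [eq_comm]
    have h1 : 0 ≤ ∑ k : Qubits m,
        (z k + e * ∑ j, (if k.1 = j.1 then 0 else hadProd 1 k.2 j.2) * z j) ^ 2 :=
      Finset.sum_nonneg fun k _ => sq_nonneg _
    have h2 : ∑ k : Qubits m, (∑ j, (if k.1 = j.1 then 0 else hadProd 1 k.2 j.2) * z j) ^ 2 =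
        2 ^ (m + 1) := by
      simp only [sq, Finset.sum_mul_sum]
      rw [Finset.sum_comm]
      have : ∀ i : Qubits m, ∑ k : Qubits m, ∑ j,
          (if k.1 = i.1 then 0 else hadProd 1 k.2 i.2) * z i *
          ((if k.1 = j.1 then 0 else hadProd 1 k.2 j.2) * z j) = 1 := fun i => by
        rw [Finset.sum_comm]
        calc _ = ∑ j, (if i = j then 1 else 0) * (z i * z j) := by
              refine Finset.sum_congr rfl fun j _ => ?_
              rw [← hA i j, Finset.sum_mul]
              exact Finset.sum_congr rfl fun k _ => by ring
          _ = 1 := by simp [hz]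
      rw [Finset.sum_congr rfl fun i _ => this i, Finset.sum_const, Finset.card_univ, card_qubits]
      simp
    have h3 : ∑ k : Qubits m, z k * ∑ j, (if k.1 = j.1 then 0 else hadProd 1 k.2 j.2) * z j =
        2 ^ (m + 1) * correlation z := by
      rw [correlation, ← mul_assoc, mul_inv_cancel₀ (by positivity), one_mul]
      refine Finset.sum_congr rfl fun k _ => ?_
      rw [Finset.mul_sum]
      exact Finset.sum_congr rfl fun j _ => by ring
    have h4 : ∑ k : Qubits m, z k ^ 2 = 2 ^ (m + 1) := by
      simp only [sq, hz]
      rw [Finset.sum_const, Finset.card_univ, card_qubits]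
      simp
    have h5 : ∑ k : Qubits m,
        (z k + e * ∑ j, (if k.1 = j.1 then 0 else hadProd 1 k.2 j.2) * z j) ^ 2 =
        2 ^ (m + 1) * (2 * (1 + e * correlation z)) := by
      calc _ = ∑ k : Qubits m, z k ^ 2 + 2 * e * ∑ k : Qubits m,
            z k * ∑ j, (if k.1 = j.1 then 0 else hadProd 1 k.2 j.2) * z j
          + ∑ k : Qubits m, (∑ j, (if k.1 = j.1 then 0 else hadProd 1 k.2 j.2) * z j) ^ 2 := by
            rw [Finset.mul_sum, ← Finset.sum_add_distrib, ← Finset.sum_add_distrib]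
            refine Finset.sum_congr rfl fun k _ => ?_
            linear_combination (∑ j, (if k.1 = j.1 then 0 else hadProd 1 k.2 j.2) * z j) ^ 2 * he
        _ = _ := by
            rw [h2, h3, h4]
            ring
    rw [h5] at h1
    have := nonneg_of_mul_nonneg_right h1 (by positivity)
    linarith
  have hp := key 1 (by norm_num)
  have hn := key (-1) (by norm_num)
  rw [abs_le]
  constructor <;> linarith

/-! ### Reading indices in binary -/

/-- The binary digits of an index. -/
def bits (i : Fin (2 ^ m)) : Fin m → ZMod 2 := fun t => if i.val.testBit t then 1 else 0

theorem bits_injective : Function.Injective (bits (m := m)) := fun i j h => by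
  refine Fin.ext (Nat.eq_of_testBit_eq fun t => ?_)
  by_cases ht : t < m
  · have := congrFun h ⟨t, ht⟩
    simp only [bits] at this
    by_cases h1 : i.val.testBit t <;> by_cases h2 : j.val.testBit t <;> simp_all
  · rw [Nat.testBit_lt_two_pow, Nat.testBit_lt_two_pow]
    · exact j.isLt.trans_le (Nat.pow_le_pow_right (by norm_num) (not_lt.1 ht))
    · exact i.isLt.trans_le (Nat.pow_le_pow_right (by norm_num) (not_lt.1 ht))

theorem bits_bijective : Function.Bijective (bits (m := m)) :=
  (Fintype.bijective_iff_injective_and_card _).2 ⟨bits_injective, by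
    rw [Fintype.card_fin, Fintype.card_fun, ZMod.card, Fintype.card_fin]⟩

/-- Indices below `2 ^ m` as strings of binary digits. -/
def bitsEquiv (m : ℕ) : Fin (2 ^ m) ≃ (Fin m → ZMod 2) := Equiv.ofBijective bits bits_bijective

theorem hadamardPow_eq_hadProd (i j : Fin (2 ^ m)) :
    Forrelation.hadamardPow m i j = hadProd 1 (bitsEquiv m i) (bitsEquiv m j) := by
  rw [Forrelation.hadamardPow, hadProd, Finset.prod_range]
  refine Finset.prod_congr rfl fun t _ => ?_
  simp only [bitsEquiv, Equiv.ofBijective_apply, bits, hadEntry, Forrelation.hadamardGate,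
    one_ne_zero, if_false]
  by_cases h1 : i.val.testBit t <;> by_cases h2 : j.val.testBit t <;>
    simp [h1, h2, sgn_zero, sgn_one]

/-- A sign string as a vector indexed by `Qubits m`, with the first half multiplied by `ε`. -/
def signVector (ε : ℝ) (z : Fin (2 ^ (m + 1)) → ℤˣ) (k : Qubits m) : ℝ :=
  if k.1 = 0 then ε * ((Forrelation.firstHalf z ((bitsEquiv m).symm k.2) : ℤ) : ℝ)
  else ((Forrelation.secondHalf z ((bitsEquiv m).symm k.2) : ℤ) : ℝ)

theorem intUnit_mul_self (a : ℤˣ) : ((a : ℤ) : ℝ) * ((a : ℤ) : ℝ) = 1 := by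
  rcases Int.units_eq_one_or a with rfl | rfl <;> simp

theorem signVector_mul_self {ε : ℝ} (hε : ε * ε = 1) (z : Fin (2 ^ (m + 1)) → ℤˣ) (k : Qubits m) :
    signVector ε z k * signVector ε z k = 1 := by
  rw [signVector]
  split_ifs
  · rw [mul_mul_mul_comm, hε, intUnit_mul_self, one_mul]
  · exact intUnit_mul_self _

theorem signVector_mul (ε : ℝ) (x y : Fin (2 ^ (m + 1)) → ℤˣ) :
    signVector ε x * signVector 1 y = signVector ε (x * y) := by
  ext k
  simp only [Pi.mul_apply, signVector, Forrelation.firstHalf, Forrelation.secondHalf]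
  split_ifs
  · push_cast
    ring
  · push_cast
    ring

/-- The factor X pairs the two halves in both orders, and the symmetry of H^{⊗m} makes the two
contributions equal, whence the 2. -/
theorem correlation_signVector (ε : ℝ) (z : Fin (2 ^ (m + 1)) → ℤˣ) :
    correlation (signVector ε z) = 2 * ε * Forrelation.forr z := by
  have h : ∑ i, ∑ j, ((Forrelation.firstHalf z i : ℤ) : ℝ) * Forrelation.hadamardPow m i j *
      ((Forrelation.secondHalf z j : ℤ) : ℝ) =
      ∑ i, ∑ j, ((Forrelation.firstHalf z ((bitsEquiv m).symm i) : ℤ) : ℝ) * hadProd 1 i j *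
        ((Forrelation.secondHalf z ((bitsEquiv m).symm j) : ℤ) : ℝ) := by
    refine Fintype.sum_equiv (bitsEquiv m) _ _ fun i =>
      Fintype.sum_equiv (bitsEquiv m) _ _ fun j => ?_
    rw [Equiv.symm_apply_apply, Equiv.symm_apply_apply, hadamardPow_eq_hadProd]
  rw [correlation, Forrelation.forr, h]
  simp only [Fintype.sum_prod_type, sum_zmod_two, signVector, if_true, one_ne_zero, if_false,
    zero_ne_one, mul_zero, zero_mul, Finset.sum_const_zero, zero_add, add_zero]
  have h2 : ∑ i, ∑ j, ((Forrelation.secondHalf z ((bitsEquiv m).symm i) : ℤ) : ℝ) * hadProd 1 i j *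
      (ε * ((Forrelation.firstHalf z ((bitsEquiv m).symm j) : ℤ) : ℝ)) =
      ∑ i, ∑ j, ε * ((Forrelation.firstHalf z ((bitsEquiv m).symm i) : ℤ) : ℝ) * hadProd 1 i j *
        ((Forrelation.secondHalf z ((bitsEquiv m).symm j) : ℤ) : ℝ) := by
    rw [Finset.sum_comm]
    refine Finset.sum_congr rfl fun i _ => Finset.sum_congr rfl fun j _ => ?_
    rw [hadProd_symm]
    ring
  rw [h2]
  simp only [mul_assoc ε, ← Finset.mul_sum]
  push_cast
  rw [one_div]
  ring

theorem abs_forr_le (z : Fin (2 ^ (m + 1)) → ℤˣ) : |Forrelation.forr z| ≤ 1 / 2 := by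
  have h := abs_correlation_le (signVector_mul_self (mul_one (1 : ℝ)) z)
  rw [correlation_signVector, abs_le] at h
  rw [abs_le]
  constructor <;> linarith [h.1, h.2]

end ForrelationProtocol

/-! ### Numerical errors, cost and amplification. -/

section ForrelationProtocol

variable {m : ℕ}

theorem HasProtocol.mono {X Y : Type} {f : X → Y → Option Bool} {ε δ t e t' e' : ℝ}
    (h : HasProtocol f ε δ t e) (ht : t ≤ t') (he : e ≤ e') : HasProtocol f ε δ t' e' := by
  obtain ⟨L, R, MA, MB, i1, i2, i3, i4, i5, i6, i7, i8, P, hc, hs, hM, hL⟩ := h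
  exact ⟨L, R, MA, MB, i1, i2, i3, i4, i5, i6, i7, i8, P, hc, hs, hM.trans ht, hL.trans he⟩

theorem logb_two_of_eq_pow {n : ℕ} {k : ℕ} (h : n = 2 ^ k) : Real.logb 2 (n : ℝ) = k := by
  rw [h, Nat.cast_pow, Nat.cast_ofNat, Real.logb_pow, Real.logb_self_eq_one (by norm_num), mul_one]

/-- The error of the majority decoder. -/
theorem four_mul_pow_le {p : ℝ} (h0 : 0 ≤ p) (h1 : p ≤ 1) {K : ℕ} (hK : 16 ≤ K * p ^ 2) :
    2 * (2 * (Real.cosh (p / 2) - Real.sinh (p / 2) * p) ^ K) ≤ 0.09 := by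
  have hnn : 0 ≤ Real.cosh (p / 2) - Real.sinh (p / 2) * p := by
    have hs : 0 ≤ Real.sinh (p / 2) := Real.sinh_nonneg_iff.2 (by linarith)
    have := Real.sinh_lt_cosh (p / 2)
    nlinarith
  have h2 := pow_le_pow_left₀ hnn (cosh_sub_sinh_mul_le h0 h1) K
  rw [← Real.exp_nat_mul] at h2
  -- The total error is at most 4·exp(-4) ≤ 4/50 = 0.08; this is what the threshold 16 is for.
  have h3 : Real.exp (K * -(p ^ 2 / 4)) ≤ Real.exp (-4) := Real.exp_le_exp.2 (by linarith)
  have h4 : Real.exp (-4) ≤ 1 / 50 := by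
    rw [Real.exp_neg, inv_eq_one_div]
    refine one_div_le_one_div_of_le (by norm_num) ?_
    have h5 : Real.exp 4 = Real.exp 1 ^ 4 := by rw [← Real.exp_nat_mul]; norm_num
    rw [h5]
    have h6 : (2.7 : ℝ) ≤ Real.exp 1 := by linarith [Real.exp_one_gt_d9]
    calc (50 : ℝ) ≤ 2.7 ^ 4 := by norm_num
      _ ≤ _ := pow_le_pow_left₀ (by norm_num) h6 4
  linarith

/-- The error of the simulator. -/
theorem sqrt_pow_sub_one_le {p : ℝ} {K : ℕ} (hK : K * p ^ 2 ≤ 0.002) :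
    √((1 + p ^ 2) ^ (2 * K) - 1) ≤ 0.09 := by
  have h1 : (1 + p ^ 2) ^ (2 * K) ≤ Real.exp (p ^ 2) ^ (2 * K) :=
    pow_le_pow_left₀ (by positivity) (by linarith [Real.add_one_le_exp (p ^ 2)]) _
  rw [← Real.exp_nat_mul] at h1
  -- With 2K blocks the exponent is at most 0.004, and exp(0.004) - 1 lies below 0.09² = 0.0081.
  have h2 : Real.exp ((2 * K : ℕ) * p ^ 2) ≤ Real.exp 0.004 :=
    Real.exp_le_exp.2 (by push_cast; linarith)
  have h3 : Real.exp 0.004 ≤ 1 / (1 - 0.004) := Real.exp_bound_div_one_sub_of_interval (by norm_num)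
    (by norm_num)
  refine Real.sqrt_le_iff.2 ⟨by norm_num, ?_⟩
  have h4 : (1 / (1 - 0.004) : ℝ) ≤ 0.09 ^ 2 + 1 := by norm_num
  exact sub_le_iff_le_add.2 (h1.trans (h2.trans (h3.trans h4)))

-- Combines the Chernoff and χ² bounds for the forrelation gadget. The condition θ ≤ 1/2 keeps the
-- bias in [0,1], so that b^d is nonnegative and can serve to set the Chernoff parameter b^d/2.
set_option synthInstance.maxHeartbeats 200000 in
set_option synthInstance.maxSize 1024 in
theorem hasProtocol_of_bias (f : (Fin (2 ^ (m + 1)) → ℤˣ) → (Fin (2 ^ (m + 1)) → ℤˣ) → Option Bool)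
    {d : ℕ} (hd : 0 < d) (K : ℕ) {θ ε : ℝ} (h0 : 0 ≤ θ) (h1 : θ ≤ 1 / 2) (hε : ε * ε = 1)
    (hyes : ∀ x y, f x y = some true →
      16 ≤ K * ((1 - θ + θ * (2 * ε * Forrelation.forr (x * y))) ^ d) ^ 2)
    (hno : ∀ x y, f x y = some false →
      K * ((1 - θ + θ * (2 * ε * Forrelation.forr (x * y))) ^ d) ^ 2 ≤ 0.002) :
    HasProtocol f 0.09 0.09 ((4 + 24 * (K * d)) * (m + 1)) ((4 + 24 * (K * d)) * (m + 1)) := by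
  let 𝒢 := forrelationGadget (signVector (m := m) ε) (signVector (m := m) 1)
    (signVector_mul_self hε) (signVector_mul_self (mul_one 1)) θ h0 (by linarith)
  have hbias : ∀ x y, 𝒢.bias x y = 1 - θ + θ * (2 * ε * Forrelation.forr (x * y)) := fun x y => by
    rw [← correlation_signVector, ← signVector_mul]
    rfl
  have hrange : ∀ x y, 0 ≤ 𝒢.bias x y ∧ 𝒢.bias x y ≤ 1 := fun x y => by
    have h := abs_le.1 (abs_correlation_le (signVector_mul_self hε (x * y)))
    rw [correlation_signVector] at h
    rw [hbias]
    constructor <;> nlinarith [h.1, h.2]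
  refine ⟨_, _, _, _, _, _, _, _, _, _, _, _, 𝒢.protocol (blockLaw_nonneg (d := d) (K := K))
    (sum_blockLaw hd), ?_, ?_, ?_, ?_⟩
  · intro x y hxy
    refine ⟨𝒢.decoder majority, 𝒢.isChannel_decoder majority, ?_⟩
    have h2 := 𝒢.diamondDist_decoder (blockLaw_nonneg (d := d) (K := K)) (sum_blockLaw hd)
      majority x y
    refine le_trans h2 (ENNReal.ofReal_le_ofReal ?_)
    obtain ⟨hb0, hb1⟩ := hrange x y
    have hp0 := pow_nonneg hb0 d
    have h3 := sum_wrong_law_le (d := d) (K := K) hd (abs_le.2 ⟨by linarith, hb1⟩)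
      (div_nonneg hp0 zero_le_two)
    have h4 := hyes x y hxy
    rw [← hbias] at h4
    have h5 := four_mul_pow_le hp0 (pow_le_one₀ hb0 hb1) h4
    linarith
  · intro x y hxy
    obtain ⟨σ, hσ, h2⟩ := 𝒢.exists_diamondDist_encoding (blockLaw_nonneg (d := d) (K := K))
      (sum_blockLaw hd) x y
    refine ⟨σ, hσ, le_trans h2 (ENNReal.ofReal_le_ofReal ?_)⟩
    have h4 := hno x y hxy
    rw [← hbias] at h4
    exact (sum_abs_uniform_sub_law_le hd _).trans (sqrt_pow_sub_one_le h4)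
  · rw [logb_two_of_eq_pow (k := 1 + (m + 1) * (2 * K * d)),
      logb_two_of_eq_pow (k := 2 * (m + 1) * (2 * K * d))]
    · push_cast
      nlinarith [mul_nonneg (Nat.cast_nonneg (α := ℝ) m) (Nat.cast_nonneg (α := ℝ) (K * d)),
        Nat.cast_nonneg (α := ℝ) m, Nat.cast_nonneg (α := ℝ) (K * d), Nat.cast_mul (α := ℝ) K d]
    · simp only [Fintype.card_prod, Fintype.card_fun, ZMod.card, Fintype.card_fin, ← pow_succ',
        ← pow_mul, ← pow_add]
      congr 1
      ring
    · simp only [Fintype.card_prod, Fintype.card_fun, ZMod.card, Fintype.card_fin, ← pow_succ',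
        ← pow_mul]
      congr 1
      ring
  -- Two bits for the key. Each of the 2Kd gadgets costs a bit τ, a branch bit, 4m + 3 bits of frame
  -- and m + 1 entangled qubits, which is 5m + 6 in all; Bob's side has the same size.
  · have hc : Fintype.card (((Key × ((ZMod 2 × Fin K) × Fin d → ZMod 2)) ×
        ((ZMod 2 × Fin K) × Fin d → Bool × Frame m)) × ((ZMod 2 × Fin K) × Fin d → Qubits m)) =
        2 ^ (2 + (2 * K * d) * (5 * m + 6)) := by
      simp only [Fintype.card_prod, Fintype.card_fun, ZMod.card, Fintype.card_fin,
        Fintype.card_bool, ← pow_succ', ← pow_mul, ← pow_add]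
      congr 1
      ring
    rw [logb_two_of_eq_pow hc]
    push_cast
    nlinarith [mul_nonneg (Nat.cast_nonneg (α := ℝ) m) (Nat.cast_nonneg (α := ℝ) (K * d)),
      Nat.cast_nonneg (α := ℝ) m, Nat.cast_nonneg (α := ℝ) (K * d), Nat.cast_mul (α := ℝ) K d]

/-- Powers amplify a gap between numbers of `[0, 1]`. -/
theorem exists_amplification {gap : ℝ} (hg : 0 < gap) :
    ∃ d : ℕ, 0 < d ∧ ∃ K₀ : ℕ, ∀ A B : ℝ, 0 ≤ B → A ≤ 1 → gap ≤ A - B →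
      ∃ K ≤ K₀, 16 ≤ K * (A ^ d) ^ 2 ∧ K * (B ^ d) ^ 2 ≤ 0.002 := by
  -- From A ≤ 1 and gap ≤ A - B follows B ≤ (1 - gap)A, so the ratio B/A is bounded away from 1; the
  -- maximum keeps r nonnegative.
  set r := max (1 - gap) 0 with hr
  have hr0 : 0 ≤ r := le_max_right _ _
  have hr1 : r < 1 := max_lt (by linarith) one_pos
  -- Rounding 16/A^(2d) up to an integer K gives K·A^(2d) ≤ 17, since A ≤ 1. The ratio r^(2d) must
  -- then bring 17 below 0.002.
  obtain ⟨d, hd⟩ := exists_pow_lt_of_lt_one (show (0 : ℝ) < 0.002 / 17 by norm_num)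
    (show r ^ 2 < 1 by nlinarith)
  have hd0 : 0 < d := by
    rcases Nat.eq_zero_or_pos d with rfl | h
    · norm_num at hd
    · exact h
  -- K depends on A, but A ≥ gap bounds it by a constant that depends on the gap alone.
  refine ⟨d, hd0, ⌈16 / (gap ^ d) ^ 2⌉₊, fun A B hB hA hAB => ?_⟩
  have hgA : gap ≤ A := by linarith
  have hA0 : 0 < A := hg.trans_le hgA
  have hBA : B ≤ r * A := by
    have : 1 - gap ≤ r := le_max_left _ _
    nlinarith
  have hpos : 0 < (A ^ d) ^ 2 := by positivity
  refine ⟨⌈16 / (A ^ d) ^ 2⌉₊, Nat.ceil_le_ceil ?_, ?_, ?_⟩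
  · gcongr
  · exact (div_le_iff₀ hpos).1 (Nat.le_ceil _)
  · have h1 : (⌈16 / (A ^ d) ^ 2⌉₊ : ℝ) * (A ^ d) ^ 2 ≤ 17 := by
      have h2 := (Nat.ceil_lt_add_one (div_nonneg (by norm_num : (0 : ℝ) ≤ 16) hpos.le)).le
      have h3 := mul_le_mul_of_nonneg_right h2 hpos.le
      rw [add_mul, div_mul_cancel₀ _ hpos.ne'] at h3
      have h4 : (A ^ d) ^ 2 ≤ 1 := pow_le_one₀ (by positivity) (pow_le_one₀ hA0.le hA)
      linarith
    calc (⌈16 / (A ^ d) ^ 2⌉₊ : ℝ) * (B ^ d) ^ 2 ≤ ⌈16 / (A ^ d) ^ 2⌉₊ * ((r * A) ^ d) ^ 2 := by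
          gcongr
      _ = ⌈16 / (A ^ d) ^ 2⌉₊ * (A ^ d) ^ 2 * (r ^ 2) ^ d := by ring
      _ ≤ 17 * (0.002 / 17) := by gcongr
      _ = 0.002 := by norm_num

end ForrelationProtocol

theorem problem_map_eq_some {m : ℕ} {α β : ℝ} {x y : Fin (2 ^ (m + 1)) → ℤˣ} {bit : ℤˣ ≃ Bool}
    {b : Bool} (h : (Forrelation.problem m α β x y).map bit = some b) :
    (b = bit (-1) ∧ α ≤ Forrelation.forr (x * y)) ∨
      (b = !bit (-1) ∧ Forrelation.forr (x * y) ≤ β) := by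
  have hne : bit 1 ≠ bit (-1) := fun h' => absurd (bit.injective h') (by decide)
  unfold Forrelation.problem at h
  split_ifs at h with h1 h2
  · left
    exact ⟨by simpa using h.symm, h1⟩
  · right
    refine ⟨?_, h2⟩
    have : b = bit 1 := by simpa using h.symm
    rw [this]
    exact Bool.eq_not_of_ne hne
  · simp at h

end CDQS

end

/-! ### Choice of parameters for every pair of thresholds and both identifications of the values. -/

theorem mainTheorem6 :
    ∃ c : ℝ, 0 < c ∧
      ∀ gap : ℝ, 0 < gap →
        ∃ C : ℝ, 0 < C ∧
          ∀ (m : ℕ) (α β : ℝ), 0 < β → gap ≤ α - β →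
            ∀ bit : ℤˣ ≃ Bool,
              CDQS.HasProtocol
                (fun x y => (Forrelation.problem m α β x y).map bit)
                0.09 0.09
                (C * Real.logb 2 ((2 ^ (m + 1) : ℕ) : ℝ) ^ c)
                (C * Real.logb 2 ((2 ^ (m + 1) : ℕ) : ℝ) ^ c) := by
  refine ⟨1, one_pos, fun gap hg => ?_⟩
  obtain ⟨d, hd, K₀, hK₀⟩ := CDQS.exists_amplification hg
  -- The summand 16 covers the degenerate protocol with K = 16 and d = 1.
  refine ⟨4 + 24 * (16 + K₀ * d), by positivity, fun m α β hβ hαβ bit => ?_⟩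
  rw [Real.rpow_one, CDQS.logb_two_of_eq_pow rfl]
  push_cast
  have bound : ∀ K d' : ℕ, (K * d' : ℝ) ≤ 16 + K₀ * d →
      (4 + 24 * (K * d' : ℝ)) * (m + 1) ≤ (4 + 24 * (16 + K₀ * d)) * (m + 1) := fun K d' h => by
    gcongr
  have hforr := fun z => abs_le.1 (CDQS.abs_forr_le (m := m) z)
  -- Since |forr| ≤ 1/2, no input reaches a threshold α > 1/2, and the partial function is constant
  -- where it is defined.
  rcases lt_or_ge (1 / 2) α with hα | hα
  · cases hb : bit (-1)
    -- Security is vacuous here: θ = 0 gives bias 1, and 16 blocks of one gadget meet the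
    -- correctness threshold.
    · have h := CDQS.hasProtocol_of_bias (m := m)
        (fun x y => (Forrelation.problem m α β x y).map bit) one_pos 16 (θ := 0) (ε := 1) le_rfl
        (by norm_num) (by norm_num) (fun x y _ => by norm_num) (fun x y hxy => by
          rcases CDQS.problem_map_eq_some hxy with ⟨_, h⟩ | ⟨h, _⟩
          · linarith [(hforr (x * y)).2]
          · simp [hb] at h)
      have hk := bound 16 1 (by
        have : (0 : ℝ) ≤ K₀ * d := by positivity
        push_cast
        linarith)
      exact h.mono hk hk
    -- Correctness is vacuous here: with K = 0 no gadget is run and the pad key is never sent.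
    · have h := CDQS.hasProtocol_of_bias (m := m)
        (fun x y => (Forrelation.problem m α β x y).map bit) one_pos 0 (θ := 0) (ε := 1) le_rfl
        (by norm_num) (by norm_num) (fun x y hxy => by
          rcases CDQS.problem_map_eq_some hxy with ⟨_, h⟩ | ⟨h, _⟩
          · linarith [(hforr (x * y)).2]
          · simp [hb] at h) (fun x y _ => by norm_num)
      have hk := bound 0 1 (by rw [Nat.cast_zero, zero_mul]; positivity)
      exact h.mono hk hk
  -- With θ = 1/2 the bias is 1/2 + ε·forr, which lies in [0,1]. The sign ε is chosen so that the
  -- inputs on which the secret must be disclosed have the larger bias.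
  · have main : ∀ (ε A B : ℝ), ε * ε = 1 → 0 ≤ B → A ≤ 1 → gap ≤ A - B →
        (∀ x y, (Forrelation.problem m α β x y).map bit = some true →
          A ≤ 1 / 2 + ε * Forrelation.forr (x * y)) →
        (∀ x y, (Forrelation.problem m α β x y).map bit = some false →
          1 / 2 + ε * Forrelation.forr (x * y) ≤ B) →
        CDQS.HasProtocol (fun x y => (Forrelation.problem m α β x y).map bit) 0.09 0.09
          ((4 + 24 * (16 + K₀ * d)) * (m + 1)) ((4 + 24 * (16 + K₀ * d)) * (m + 1)) := by
      intro ε A B hε hB hA hAB hyes hno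
      obtain ⟨K, hK, hKA, hKB⟩ := hK₀ A B hB hA hAB
      have hw : ∀ t : ℝ, 1 - 1 / 2 + 1 / 2 * (2 * ε * t) = 1 / 2 + ε * t := fun t => by ring
      have hw0 : ∀ z, 0 ≤ 1 / 2 + ε * Forrelation.forr z := fun z => by
        have := hforr z
        rcases mul_self_eq_one_iff.1 hε with rfl | rfl <;> linarith [this.1, this.2]
      have h := CDQS.hasProtocol_of_bias (m := m)
        (fun x y => (Forrelation.problem m α β x y).map bit) hd K (θ := 1 / 2) (ε := ε)
        (by norm_num) le_rfl hε (fun x y hxy => by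
          rw [hw]
          have := hyes x y hxy
          have hA0 : 0 ≤ A := by linarith
          exact hKA.trans (by gcongr)) (fun x y hxy => by
          rw [hw]
          have := hno x y hxy
          have := hw0 (x * y)
          refine le_trans ?_ hKB
          gcongr)
      have hk := bound K d (by
        have : (K : ℝ) * d ≤ K₀ * d := by gcongr
        linarith)
      exact h.mono hk hk
    cases hb : bit (-1)
    -- Disclosure for small forrelation: ε = -1 reverses the order of the thresholds, and α ≤ 1/2
    -- makes the lower bias 1/2 - α nonnegative.
    · refine main (-1) (1 / 2 - β) (1 / 2 - α) (by norm_num) (by linarith) (by linarith)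
        (by linarith) (fun x y hxy => ?_) (fun x y hxy => ?_)
      · rcases CDQS.problem_map_eq_some hxy with ⟨h, _⟩ | ⟨_, h⟩
        · simp [hb] at h
        · linarith
      · rcases CDQS.problem_map_eq_some hxy with ⟨_, h⟩ | ⟨h, _⟩
        · linarith
        · simp [hb] at h
    -- Disclosure for large forrelation: here α ≤ 1/2 keeps the upper bias 1/2 + α at most 1.
    · refine main 1 (1 / 2 + α) (1 / 2 + β) (by norm_num) (by linarith) (by linarith)
        (by linarith) (fun x y hxy => ?_) (fun x y hxy => ?_)
      · rcases CDQS.problem_map_eq_some hxy with ⟨_, h⟩ | ⟨h, _⟩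
        · linarith
        · simp [hb] at h
      · rcases CDQS.problem_map_eq_some hxy with ⟨h, _⟩ | ⟨_, h⟩
        · simp [hb] at h
        · linarith
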